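/- **Setting.** Let $n\ge 1$ and let $S\subseteq\{1,\dots,5\}^n$ be a set of "special questions"; the values $1,2,3,4,5$ stand for the bases $\mathrm x,\mathrm y,\mathrm z,\mathrm x+\mathrm y,\mathrm x-\mathrm y$. For a string $\boldsymbol x$ of length $n$ let $\boldsymbol x_j$ be $\boldsymbol x$ with its $j$th entry removed. Let $\mathcal X$ be the set of strings that differ from some $\boldsymbol\chi\in S$ in at most two entries, and $\mathcal R^{(j)}$ the set of strings of length $n-1$ that differ from $\boldsymbol\chi_j$, for some $\boldsymbol\chi\in S$, in at most one entry. Alice and Bob have Hilbert spaces $\mathcal A,\mathcal B$ and share a unit vector $|\psi\rangle\in\mathcal A\otimes\mathcal B$. Alice has a projective measurement with outcomes in $\{+,-\}^n$ for each $\boldsymbol x\in\mathcal X$; Bob has projective measurements with outcomes in $\{+,-\}^n$ for each $y\in\{1,\dots,6\}$, with outcomes in $\{1,2,3,4\}^{\lfloor n/2\rfloor}$ for a question $\lozenge$, and with outcomes in $\{1,2,3,4\}^{\lceil n/2\rceil-1}$ for a question $\blacklozenge$. Let $A_{\boldsymbol x}^{(j)}$ be Alice's $\pm1$-valued observable for the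 $j$th entry of the outcome (the projector onto "$j$th entry $+$" minus the projector onto "$j$th entry $-$"), and write $A^{(j)}_{q,\boldsymbol r}=A^{(j)}_{\boldsymbol x}$ for the $\boldsymbol x$ with $x_j=q$ and $\boldsymbol x_j=\boldsymbol r$. Let $D^{(j)}_{zx},E^{(j)}_{zx},D^{(j)}_{zy},E^{(j)}_{zy},D^{(j)}_{xy},E^{(j)}_{xy}$ be Bob's corresponding observables for $y=1,\dots,6$. For $1\le j<n$ let $\Gamma^{(j)}_b$ be Bob's projector onto the outcomes with value $b\in\{1,2,3,4\}$ in the entry associated with the pair $(j,j+1)$; for odd $j$ this is entry $(j+1)/2$ of the answer to $\lozenge$, for even $j$ it is entry $j/2$ of the answer to $\blacklozenge$. For $\boldsymbol s\in\{0,1\}^n$ put $A_{\boldsymbol\chi}^{\boldsymbol s}=\prod_{j=1}^n (A_{\boldsymbol\chi}^{(j)})^{s_j}$. **Requested observations with tolerance $\varepsilon\ge 0$.** 1. For all $1\le j\le n$ and $\boldsymbol r\in\mathcal R^{(j)}$, $$\begin{aligned}\langle\psi|\big[&A_{3,\boldsymbol r}^{(j)}\otimes(D_{zx}^{(j)}+E_{zx}^{(j)})+A_{1,\boldsymbol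 r}^{(j)}\otimes(D_{zx}^{(j)}-E_{zx}^{(j)})+A_{3,\boldsymbol r}^{(j)}\otimes(D_{zy}^{(j)}+E_{zy}^{(j)})\\&+A_{2,\boldsymbol r}^{(j)}\otimes(D_{zy}^{(j)}-E_{zy}^{(j)})+A_{1,\boldsymbol r}^{(j)}\otimes(D_{xy}^{(j)}+E_{xy}^{(j)})+A_{2,\boldsymbol r}^{(j)}\otimes(D_{xy}^{(j)}-E_{xy}^{(j)})\big]|\psi\rangle\ \ge\ 6\sqrt2-\tfrac{\varepsilon}{\sqrt2}.\end{aligned}$$ 2. For all $\boldsymbol\chi\in S$ and $1\le j\le n$, $\langle\psi|A_{4,\boldsymbol\chi_j}^{(j)}\otimes D_{xy}^{(j)}|\psi\rangle\ge1-\varepsilon$ and $\langle\psi|A_{5,\boldsymbol\chi_j}^{(j)}\otimes E_{xy}^{(j)}|\psi\rangle\ge1-\varepsilon$. 3. For one fixed $\boldsymbol\chi\in S$, all $1\le j<n$ and all $q\in\{1,2,3\}$, with $\boldsymbol w=(\chi_1,\dots,\chi_{j-1},q,q,\chi_{j+2},\dots,\chi_n)$ and $[P]=1$ if $P$ holds,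 $0$ otherwise, $$\langle\psi|A_{\boldsymbol w}^{(j)}A_{\boldsymbol w}^{(j+1)}\otimes\big[(-1)^{[q=2]}\Gamma_1^{(j)}+(-1)^{[q=1]}\Gamma_2^{(j)}+(-1)^{[q=3]}\Gamma_3^{(j)}-\Gamma_4^{(j)}\big]|\psi\rangle\ge1-\tfrac{\varepsilon}{2}.$$ **Reference.** Let $\sigma_1,\sigma_2,\sigma_3$ be the Pauli matrices $\sigma_{\mathrm x},\sigma_{\mathrm y},\sigma_{\mathrm z}$, $\sigma_4=(\sigma_1+\sigma_2)/\sqrt2$ and $\sigma_5=(\sigma_1-\sigma_2)/\sqrt2$. Let $*$ be complex conjugation in the orthonormal basis $(|0\rangle+|1\rangle)/\sqrt2,\ i(|0\rangle-|1\rangle)/\sqrt2$, so that $\sigma_3^*=-\sigma_3$ and $\sigma_q^*=\sigma_q$ for $q\ne3$. The ancillas $\mathcal A',\mathcal A'',\mathcal B',\mathcal B''$ are registers of $n$ qubits each; in $\mathcal A''$ and $\mathcal B''$ write $|b\rangle=|b\dots b\rangle$ for $b\in\{0,1\}$. Let $|\Phi^+\rangle=(|00\rangle+|11\rangle)/\sqrt2$.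 For vectors $|\xi_0\rangle,|\xi_1\rangle\in\mathcal A\otimes\mathcal B$ put $$|\xi\rangle=|0\rangle_{\mathcal A''}|0\rangle_{\mathcal B''}\otimes|\xi_0\rangle+|1\rangle_{\mathcal A''}|1\rangle_{\mathcal B''}\otimes|\xi_1\rangle,\qquad |R\rangle=\bigotimes_{j=1}^n|\Phi^+\rangle_{\mathcal A'_j\mathcal B'_j}\otimes|\xi\rangle .$$ **Claim.** There are functions $\delta(\varepsilon,n)\ge0$ and $\gamma(\varepsilon,n)\ge0$, depending only on $\varepsilon$ and $n$, with $\delta(0,n)=\gamma(0,n)=0$ for all $n$, such that for every state and measurements as above that attain the requested observations with tolerance $\varepsilon$: (i) There exist $|\xi_0\rangle,|\xi_1\rangle\in\mathcal A\otimes\mathcal B$ with $\|\xi_0\|^2+\|\xi_1\|^2=1$, isometries $V_{\mathcal A}^{\boldsymbol\chi}:\mathcal A\to\mathcal A\otimes\mathcal A'\otimes\mathcal A''$ for $\boldsymbol\chi\in S$, and one isometry $V_{\mathcal B}:\mathcal B\to\mathcal B\otimes\mathcal B'\otimes\mathcal B''$ such that $V^{\boldsymbol\chi}=V_{\mathcal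 A}^{\boldsymbol\chi}\otimes V_{\mathcal B}$ satisfies, for all $\boldsymbol\chi\in S$, $q\in\{1,\dots,5\}$ and $k\in\{1,\dots,n\}$, $$\big\|V^{\boldsymbol\chi}|\psi\rangle-|R\rangle\big\|\le\delta(\varepsilon,n),\qquad \big\|V^{\boldsymbol\chi}A_{q,\boldsymbol\chi_k}^{(k)}|\psi\rangle-\sigma_q^{\mathcal B'_k}\otimes Z_q^{\mathcal B''}|R\rangle\big\|\le\delta(\varepsilon,n),$$ where $Z_3=|0\rangle\langle0|-|1\rangle\langle1|$ and $Z_q$ is the identity for $q\ne3$. (ii) All $|\xi_0\rangle,|\xi_1\rangle$, $V_{\mathcal A}^{\boldsymbol\chi}$, $V_{\mathcal B}$ as in (i) also satisfy, for all $\boldsymbol\chi\in S$ and $\boldsymbol s\in\{0,1\}^n$, $$\Big\|V^{\boldsymbol\chi}A_{\boldsymbol\chi}^{\boldsymbol s}|\psi\rangle-\Big[\bigotimes_{j=1}^n\big(\sigma_{\chi_j}^{\mathcal B'_j}\big)^{s_j}\otimes|0\rangle\langle0|_{\mathcal B''}+\bigotimes_{j=1}^n\big((\sigma_{\chi_j}^{\mathcal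 B'_j})^{*}\big)^{s_j}\otimes|1\rangle\langle1|_{\mathcal B''}\Big]|R\rangle\Big\|\le\gamma(\varepsilon,n).$$ -/

import Mathlib

open scoped TensorProduct NNReal

noncomputable section

namespace SelfTesting

/-! ### Hilbert space tensor products -/

/-- The Hilbert space tensor product: completion of the algebraic tensor product with respect to
`⟪a ⊗ b, a' ⊗ b'⟫ = ⟪a, a'⟫ ⟪b, b'⟫`. -/
abbrev HTensor (A B : Type*) [NormedAddCommGroup A] [InnerProductSpace ℂ A]
    [NormedAddCommGroup B] [InnerProductSpace ℂ B] : Type _ :=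
  UniformSpace.Completion (A ⊗[ℂ] B)

infixl:70 " ⊗ₕ " => HTensor

/-- The bounded operator `f ⊗ g` on Hilbert space tensor products. -/
def hmap {A B A₁ B₁ : Type*} [NormedAddCommGroup A] [InnerProductSpace ℂ A]
    [NormedAddCommGroup B] [InnerProductSpace ℂ B] [NormedAddCommGroup A₁]
    [InnerProductSpace ℂ A₁] [NormedAddCommGroup B₁] [InnerProductSpace ℂ B₁]
    (f : A →L[ℂ] A₁) (g : B →L[ℂ] B₁) : A ⊗ₕ B →L[ℂ] A₁ ⊗ₕ B₁ :=
  (TensorProduct.mapL f g).completion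

/-- The real number `⟨ψ| T |ψ⟩` (its real part, all the operators used being self-adjoint). -/
def expect {H : Type*} [NormedAddCommGroup H] [InnerProductSpace ℂ H] (ψ : H) (T : H →L[ℂ] H) : ℝ :=
  (inner ℂ ψ (T ψ)).re

/-! ### Measurements and observables -/

/-- A projective measurement with outcome set `ι`. -/
structure IsProjMeas {ι H : Type*} [Fintype ι] [NormedAddCommGroup H] [InnerProductSpace ℂ H]
    [CompleteSpace H] (P : ι → H →L[ℂ] H) : Prop where
  isStarProjection : ∀ i, IsStarProjection (P i)
  mul_eq_zero : ∀ i j, i ≠ j → P i * P j = 0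
  sum_eq_one : ∑ i, P i = 1

/-- The projector for the outcome `a` at the position `j` of the outcome string. -/
def localProj {J α H : Type*} [Fintype J] [DecidableEq J] [Fintype α] [DecidableEq α]
    [NormedAddCommGroup H] [InnerProductSpace ℂ H]
    (P : (J → α) → H →L[ℂ] H) (j : J) (a : α) : H →L[ℂ] H :=
  ∑ s : J → α with s j = a, P s

/-- The `±1`-outcome observable at position `j`. The answer `+` is encoded by `0`, the answer `-`
by `1`. -/
def obs {n : ℕ} {H : Type*} [NormedAddCommGroup H] [InnerProductSpace ℂ H]
    (P : (Fin n → Fin 2) → H →L[ℂ] H) (j : Fin n) : H →L[ℂ] H :=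
  localProj P j 0 - localProj P j 1

/-! ### Alice's questions

The bases `x, y, z, x + y, x - y` are encoded by `0, 1, 2, 3, 4 : Fin 5`; addition is modulo `5`. -/

/-- A question string of length `n`. -/
abbrev Question (n : ℕ) : Type := Fin n → Fin 5

/-- A question string with position `j` removed. -/
abbrev ShortQuestion (n : ℕ) (j : Fin n) : Type := {i : Fin n // i ≠ j} → Fin 5

/-- Remove the position `j` from `x`. -/
def removeAt {n : ℕ} (j : Fin n) (x : Question n) : ShortQuestion n j := fun i => x i.1

/-- The question with the value `q` at position `j` and `r` at all other positions. -/
def insertAt {n : ℕ} (j : Fin n) (q : Fin 5) (r : ShortQuestion n j) : Question n :=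
  fun i => if h : i = j then q else r ⟨i, h⟩

/-- Alice's questions: the special questions, shifted arbitrarily in at most two positions. -/
def questionSet {n : ℕ} (S : Set (Question n)) : Set (Question n) :=
  {x | ∃ χ ∈ S, ∃ (i j : Fin n) (k l : Fin 5), x = χ + Pi.single i k + Pi.single j l}

/-- The special questions with position `j` removed, shifted in at most one remaining position. -/
def shortQuestionSet {n : ℕ} (S : Set (Question n)) (j : Fin n) : Set (ShortQuestion n j) :=
  {r | ∃ χ ∈ S, r = removeAt j χ ∨
    ∃ (i : {i : Fin n // i ≠ j}) (k : Fin 5), r = removeAt j χ + Pi.single i k}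

/-! ### Physical strategies -/

/-- A physical strategy of Alice and Bob in the game with `n` positions and special questions `S`.
Only Alice's measurements for questions in `questionSet S` are relevant. -/
structure Strategy (n : ℕ) (S : Set (Question n)) (A B : Type*)
    [NormedAddCommGroup A] [InnerProductSpace ℂ A] [CompleteSpace A]
    [NormedAddCommGroup B] [InnerProductSpace ℂ B] [CompleteSpace B] where
  /-- the shared state -/
  ψ : A ⊗ₕ B
  norm_ψ : ‖ψ‖ = 1
  /-- Alice's projectors for question `x` and answer `a` -/
  projA : Question n → (Fin n → Fin 2) → A →L[ℂ] A
  isProjMeas_projA : ∀ x ∈ questionSet S, IsProjMeas (projA x)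
  /-- Bob's projectors for the six questions `1, …, 6` (encoded by `0, …, 5`) -/
  projB : Fin 6 → (Fin n → Fin 2) → B →L[ℂ] B
  isProjMeas_projB : ∀ y, IsProjMeas (projB y)
  /-- Bob's projectors for the question `◇`, with answers in `{1, 2, 3, 4}^⌊n/2⌋` -/
  projDiamond : (Fin (n / 2) → Fin 4) → B →L[ℂ] B
  isProjMeas_projDiamond : IsProjMeas projDiamond
  /-- Bob's projectors for the question `◆`, with answers in `{1, 2, 3, 4}^(⌈n/2⌉ - 1)` -/
  projBlack : (Fin ((n + 1) / 2 - 1) → Fin 4) → B →L[ℂ] B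
  isProjMeas_projBlack : IsProjMeas projBlack

namespace Strategy

variable {n : ℕ} {S : Set (Question n)} {A B : Type*}
  [NormedAddCommGroup A] [InnerProductSpace ℂ A] [CompleteSpace A]
  [NormedAddCommGroup B] [InnerProductSpace ℂ B] [CompleteSpace B]

/-- Alice's observable at position `j` for the question `x`. -/
def obsA (σ : Strategy n S A B) (x : Question n) (j : Fin n) : A →L[ℂ] A := obs (σ.projA x) j

/-- Alice's observable at position `j` for the question with `q` at `j` and `r` elsewhere. -/
def obsAt (σ : Strategy n S A B) (j : Fin n) (q : Fin 5) (r : ShortQuestion n j) : A →L[ℂ] A :=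
  σ.obsA (insertAt j q r) j

/-- Alice's product observable `∏ⱼ (A_χ^(j))^(sⱼ)`, factors in increasing order of `j`. -/
def obsProd (σ : Strategy n S A B) (χ : Question n) (s : Fin n → Fin 2) : A →L[ℂ] A :=
  (List.ofFn fun j => σ.obsA χ j ^ (s j : ℕ)).prod

/-- Bob's observables `D_zx, E_zx, D_zy, E_zy, D_xy, E_xy` for `y = 0, …, 5`. -/
def obsB (σ : Strategy n S A B) (y : Fin 6) (j : Fin n) : B →L[ℂ] B := obs (σ.projB y) j

/-- Bob's projector with outcome `b` (encoded by `0, …, 3`) for the pair of positions `j, j + 1`.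
Counting positions from `0`, the even `j` belong to the question `◇` and the odd ones to `◆`. -/
def Gam (σ : Strategy n S A B) (j : ℕ) (hj : j + 1 < n) (b : Fin 4) : B →L[ℂ] B :=
  if h : j % 2 = 0 then localProj σ.projDiamond ⟨j / 2, by omega⟩ b
  else localProj σ.projBlack ⟨j / 2, by omega⟩ b

/-- The triple CHSH operator at position `j` with remaining question `r`. -/
def tripleCHSH (σ : Strategy n S A B) (j : Fin n) (r : ShortQuestion n j) :
    A ⊗ₕ B →L[ℂ] A ⊗ₕ B :=
  hmap (σ.obsAt j 2 r) (σ.obsB 0 j + σ.obsB 1 j) + hmap (σ.obsAt j 0 r) (σ.obsB 0 j - σ.obsB 1 j)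
  + hmap (σ.obsAt j 2 r) (σ.obsB 2 j + σ.obsB 3 j) + hmap (σ.obsAt j 1 r) (σ.obsB 2 j - σ.obsB 3 j)
  + hmap (σ.obsAt j 0 r) (σ.obsB 4 j + σ.obsB 5 j) + hmap (σ.obsAt j 1 r) (σ.obsB 4 j - σ.obsB 5 j)

/-- The sign `(-1)^[p]`. -/
def sgn (p : Prop) [Decidable p] : ℂ := if p then -1 else 1

/-- Bob's combination of projectors that is correlated with the basis `q` at `j, j + 1`. -/
def conjB (σ : Strategy n S A B) (j : ℕ) (hj : j + 1 < n) (q : Fin 5) : B →L[ℂ] B :=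
  sgn (q = 1) • σ.Gam j hj 0 + sgn (q = 0) • σ.Gam j hj 1 + sgn (q = 2) • σ.Gam j hj 2
    - σ.Gam j hj 3

/-- The question `χ` with the values at positions `j` and `j + 1` replaced by `q`. -/
def doubled (χ : Question n) (j : ℕ) (hj : j + 1 < n) (q : Fin 5) : Question n :=
  Function.update (Function.update χ ⟨j, by omega⟩ q) ⟨j + 1, hj⟩ q

/-- All requested Bell values and correlations are attained within the tolerance `ε`. The
conjugation correlations are only requested for one special question. -/
structure AttainsRequested (σ : Strategy n S A B) (ε : ℝ) : Prop where
  chsh : ∀ (j : Fin n), ∀ r ∈ shortQuestionSet S j,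
    6 * √2 - ε / √2 ≤ expect σ.ψ (σ.tripleCHSH j r)
  corr_add : ∀ χ ∈ S, ∀ j : Fin n,
    1 - ε ≤ expect σ.ψ (hmap (σ.obsAt j 3 (removeAt j χ)) (σ.obsB 4 j))
  corr_sub : ∀ χ ∈ S, ∀ j : Fin n,
    1 - ε ≤ expect σ.ψ (hmap (σ.obsAt j 4 (removeAt j χ)) (σ.obsB 5 j))
  conj : ∃ χ ∈ S, ∀ (j : ℕ) (hj : j + 1 < n) (q : Fin 5), q < 3 →
    1 - ε / 2 ≤ expect σ.ψ
      (hmap (σ.obsA (doubled χ j hj q) ⟨j, by omega⟩ * σ.obsA (doubled χ j hj q) ⟨j + 1, hj⟩)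
        (σ.conjB j hj q))

end Strategy

/-! ### Reference operators -/

/-- The observables `σ_x, σ_y, σ_z, σ_{x+y}, σ_{x-y}`. -/
def pauli : Fin 5 → Matrix (Fin 2) (Fin 2) ℂ :=
  ![!![0, 1; 1, 0], !![0, -Complex.I; Complex.I, 0], !![1, 0; 0, -1],
    ((√2 : ℝ) : ℂ)⁻¹ • (!![0, 1; 1, 0] + !![0, -Complex.I; Complex.I, 0]),
    ((√2 : ℝ) : ℂ)⁻¹ • (!![0, 1; 1, 0] - !![0, -Complex.I; Complex.I, 0])]

/-- The unitary whose columns are the orthonormal basis `(|0⟩ + |1⟩)/√2, i(|0⟩ - |1⟩)/√2`, in which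
`σ_x` and `σ_y` have real entries and `σ_z` imaginary ones. -/
def conjBasis : Matrix (Fin 2) (Fin 2) ℂ :=
  ((√2 : ℝ) : ℂ)⁻¹ • !![1, Complex.I; 1, -Complex.I]

/-- Entrywise complex conjugation of `M` with respect to the basis `conjBasis`. -/
def conjOp (M : Matrix (Fin 2) (Fin 2) ℂ) : Matrix (Fin 2) (Fin 2) ℂ :=
  conjBasis * (conjBasis.conjTranspose * M * conjBasis).map (starRingEnd ℂ) *
    conjBasis.conjTranspose

lemma inv_sqrt_two_mul_self : (((√2 : ℝ) : ℂ)⁻¹) * (((√2 : ℝ) : ℂ)⁻¹) = 1 / 2 := by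
  rw [← mul_inv, ← Complex.ofReal_mul, Real.mul_self_sqrt (by norm_num)]
  norm_num

lemma conjOp_eq (M : Matrix (Fin 2) (Fin 2) ℂ) :
    conjOp M = !![star (M 1 1), star (M 1 0); star (M 0 1), star (M 0 0)] := by
  have h := inv_sqrt_two_mul_self
  have hc : (starRingEnd ℂ) (((√2 : ℝ) : ℂ)⁻¹) = ((√2 : ℝ) : ℂ)⁻¹ := by simp
  have hI := Complex.I_mul_I
  unfold conjOp conjBasis
  generalize ((√2 : ℝ) : ℂ)⁻¹ = c at h hc
  rw [Matrix.eta_fin_two M]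
  ext i j
  fin_cases i <;> fin_cases j <;>
    simp only [Matrix.mul_apply, Fin.sum_univ_two, Matrix.map_apply,
      Matrix.conjTranspose_apply] <;>
    simp [hc] <;> grind

/-- `σ_z` changes its sign under the conjugation, all other reference observables are fixed. -/
lemma conjOp_pauli (q : Fin 5) : conjOp (pauli q) = if q = 2 then -pauli q else pauli q := by
  rw [conjOp_eq]
  fin_cases q <;> ext i j <;> fin_cases i <;> fin_cases j <;> simp [pauli] <;> ring

/-- A register of `n` qubits, with the computational basis labelled by bit strings. -/
abbrev Qubits (n : ℕ) : Type := EuclideanSpace ℂ (Fin n → Fin 2)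

/-- The computational basis vector `|z⟩`. -/
def ket {n : ℕ} (z : Fin n → Fin 2) : Qubits n := EuclideanSpace.single z 1

/-- The matrix of `⨂ⱼ Mⱼ` in the computational basis. -/
def tensorMatrix {n : ℕ} (M : Fin n → Matrix (Fin 2) (Fin 2) ℂ) :
    Matrix (Fin n → Fin 2) (Fin n → Fin 2) ℂ :=
  Matrix.of fun z w => ∏ j, M j (z j) (w j)

/-- The operator `⨂ⱼ Mⱼ` on `n` qubits. -/
def tensorOp {n : ℕ} (M : Fin n → Matrix (Fin 2) (Fin 2) ℂ) : Qubits n →L[ℂ] Qubits n :=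
  Matrix.toEuclideanCLM (𝕜 := ℂ) (tensorMatrix M)

/-- The single-qubit operator `M` at position `k`. -/
def siteOp {n : ℕ} (k : Fin n) (M : Matrix (Fin 2) (Fin 2) ℂ) : Qubits n →L[ℂ] Qubits n :=
  tensorOp fun j => if j = k then M else 1

/-- The logical basis state `|b…b⟩` of the second ancilla register (`A''` or `B''`), written
`|b⟩` in that register. -/
def logical (n : ℕ) (b : Fin 2) : Fin n → Fin 2 := fun _ => b

/-- The projector `|b⟩⟨b|` of the second ancilla register. -/
def logicalProj (n : ℕ) (b : Fin 2) : Qubits n →L[ℂ] Qubits n :=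
  Matrix.toEuclideanCLM (𝕜 := ℂ) (Matrix.single (logical n b) (logical n b) 1)

/-- The logical `σ_z = |0⟩⟨0| - |1⟩⟨1|` of the second ancilla register. -/
def logicalZ (n : ℕ) : Qubits n →L[ℂ] Qubits n := logicalProj n 0 - logicalProj n 1

/-! ### The self-testing statements -/

/-- A space `A` together with its ancilla registers `A'` and `A''` of `n` qubits each. The
registers being finite-dimensional, no completion is needed. -/
abbrev WithAncillas (n : ℕ) (A : Type*) [NormedAddCommGroup A] [InnerProductSpace ℂ A] : Type _ :=
  A ⊗[ℂ] (Qubits n ⊗[ℂ] Qubits n)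

section

variable {n : ℕ} {A B : Type*} [NormedAddCommGroup A] [InnerProductSpace ℂ A]
  [NormedAddCommGroup B] [InnerProductSpace ℂ B]

/-- The map `a ↦ a ⊗ |z⟩_{A'} ⊗ |w⟩_{A''}`. -/
def attach (z w : Fin n → Fin 2) : A →L[ℂ] WithAncillas n A :=
  (TensorProduct.mkL ℂ A (Qubits n ⊗[ℂ] Qubits n)).flip (ket z ⊗ₜ[ℂ] ket w)

/-- The coefficients of the Bell state `|Φ⁺⟩ = (|00⟩ + |11⟩)/√2`. -/
def bell (a b : Fin 2) : ℂ := if a = b then ((√2 : ℝ) : ℂ)⁻¹ else 0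

/-- The reference state `⨂ⱼ |Φ⁺⟩_{A'ⱼB'ⱼ} ⊗ |ξ⟩` with the junk state
`|ξ⟩ = |0⟩_{A''} |0⟩_{B''} ⊗ |ξ₀⟩_{AB} + |1⟩_{A''} |1⟩_{B''} ⊗ |ξ₁⟩_{AB}`. -/
def refState (ξ : Fin 2 → A ⊗ₕ B) : WithAncillas n A ⊗ₕ WithAncillas n B :=
  ∑ z : Fin n → Fin 2, ∑ w : Fin n → Fin 2, (∏ j, bell (z j) (w j)) •
    ∑ b : Fin 2, hmap (attach z (logical n b)) (attach w (logical n b)) (ξ b)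

/-- The extension to the whole space of an operator on Bob's registers `B' ⊗ B''`. -/
def onBob (T : (Qubits n ⊗[ℂ] Qubits n) →L[ℂ] (Qubits n ⊗[ℂ] Qubits n)) :
    WithAncillas n A ⊗ₕ WithAncillas n B →L[ℂ] WithAncillas n A ⊗ₕ WithAncillas n B :=
  hmap (.id ℂ _) (TensorProduct.mapL (.id ℂ B) T)

/-- The operator `σ_q^{B'_k} ⊗ σ_{3[q=3]}^{B''}` (with `σ_0` the identity). -/
def singleRef (k : Fin n) (q : Fin 5) :
    (Qubits n ⊗[ℂ] Qubits n) →L[ℂ] (Qubits n ⊗[ℂ] Qubits n) :=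
  TensorProduct.mapL (siteOp k (pauli q)) (if q = 2 then logicalZ n else .id ℂ _)

/-- The operator `⨂ⱼ (σ_{χⱼ})^{sⱼ} ⊗ |0⟩⟨0|_{B''} + ⨂ⱼ (σ_{χⱼ}^*)^{sⱼ} ⊗ |1⟩⟨1|_{B''}`. -/
def productRef (χ : Question n) (s : Fin n → Fin 2) :
    (Qubits n ⊗[ℂ] Qubits n) →L[ℂ] (Qubits n ⊗[ℂ] Qubits n) :=
  TensorProduct.mapL (tensorOp fun j => pauli (χ j) ^ (s j : ℕ)) (logicalProj n 0)
  + TensorProduct.mapL (tensorOp fun j => conjOp (pauli (χ j)) ^ (s j : ℕ)) (logicalProj n 1)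

/-- The local isometry `V^χ = V_A^χ ⊗ V_B`. -/
def localIsom (VA : A →ₗᵢ[ℂ] WithAncillas n A) (VB : B →ₗᵢ[ℂ] WithAncillas n B) :
    A ⊗ₕ B →L[ℂ] WithAncillas n A ⊗ₕ WithAncillas n B :=
  hmap VA.toContinuousLinearMap VB.toContinuousLinearMap

end

namespace Strategy

variable {n : ℕ} {S : Set (Question n)} {A B : Type*}
  [NormedAddCommGroup A] [InnerProductSpace ℂ A] [CompleteSpace A]
  [NormedAddCommGroup B] [InnerProductSpace ℂ B] [CompleteSpace B]

/-- The junk vectors `ξ` and isometries `VA χ`, `VB` certify the `n` Bell states and every single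
observable of Alice, up to `δ`. The isometry `VB` and the vectors `ξ` serve all `χ`. -/
structure CertifiesSingle (σ : Strategy n S A B) (ξ : Fin 2 → A ⊗ₕ B)
    (VA : Question n → A →ₗᵢ[ℂ] WithAncillas n A) (VB : B →ₗᵢ[ℂ] WithAncillas n B)
    (δ : ℝ) : Prop where
  norm_junk : ‖ξ 0‖ ^ 2 + ‖ξ 1‖ ^ 2 = 1
  state : ∀ χ ∈ S, ‖localIsom (VA χ) VB σ.ψ - refState ξ‖ ≤ δ
  observable : ∀ χ ∈ S, ∀ (k : Fin n) (q : Fin 5),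
    ‖localIsom (VA χ) VB (hmap (σ.obsAt k q (removeAt k χ)) (.id ℂ B) σ.ψ)
      - onBob (singleRef k q) (refState ξ)‖ ≤ δ

/-- The junk vectors `ξ` and isometries `VA χ`, `VB` certify every product observable of Alice for
the special questions, up to `γ`. -/
def CertifiesProducts (σ : Strategy n S A B) (ξ : Fin 2 → A ⊗ₕ B)
    (VA : Question n → A →ₗᵢ[ℂ] WithAncillas n A) (VB : B →ₗᵢ[ℂ] WithAncillas n B)
    (γ : ℝ) : Prop :=
  ∀ χ ∈ S, ∀ s : Fin n → Fin 2,
    ‖localIsom (VA χ) VB (hmap (σ.obsProd χ s) (.id ℂ B) σ.ψ)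
      - onBob (productRef χ s) (refState ξ)‖ ≤ γ

end Strategy

end SelfTesting

end

open SelfTesting

/-! For fixed `n`, all strategies that attain the observations, with every tolerance and every
choice of a special question, form one index type `Attaining`, and operators are treated as families
over it. A family of vectors counts as small if its norms are at most `C √ε` with a single `C`;
uniformity over strategies is thus built in and no explicit constants are tracked. The bounded
families `b` of Bob for which some bounded family `a` of Alice satisfies `a ψ ≈ b ψ` form an algebra
`mirrored`. Those with `b ψ ≈ 0` form a two-sided ideal in it, because a factor on the right can be
handed over to Alice. In the quotient `StateAlgebra` approximate relations become equalities, and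
the self-test becomes exact algebra.

The CHSH deficit is a sum of squares (`chsh_defect`), so Bob's normalized sums and differences of
observables mirror Alice's x, y, z observables. Their classes square to one because Alice's
observables do (`pauliClass_sq`), anticommute because Bob's original observables square to one
(`pauliClass_anti`), and commute between positions because Alice measures all positions at once
(`pauliClass_comm`). What remains free is a complex conjugation at each position. The questions ◇
and ◆ act as Bell measurements whose three sign observables multiply to `-1`; this forces the
product XYZ to be the same at neighbouring positions (`pauliClass_hand`).

The handedness `F = -i XYZ` is therefore a central reflection, whose eigenspaces separate the
reference from its conjugate. Factoring it out leaves one anticommuting pair `c = i XZ`, `d = -i YZ`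
per position. The swap isometry writes the pairs into the first register and the sign of `F` into
the second. It has to be an exact isometry, so Bob uses unitary words in his observables that
represent `c` and `d`, and a word that agrees with `F` where `c = 1` (`flagWord_mul`). Alice's
words, moved to Bob's side, appear reversed on the right, and every component of the swapped state
is evaluated by `component_state` and `component_pauli`. Rescaling the junk to norm one costs no
more than the error already made. Bob's isometry and the junk contain no operator of Alice, hence
serve all special questions.

Part (ii) holds for any certifying data: an operator of Alice transported through her isometry is a
contraction commuting with Bob's registers, so the observables can be multiplied one at a time with
a controlled error (`norm_mul_sub_le`). -/

noncomputable section

namespace SelfTesting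

/-! ### Operators on Hilbert space tensor products -/

section hmap

variable {A B A₁ B₁ A₂ B₂ A₃ B₃ : Type*} [NormedAddCommGroup A] [InnerProductSpace ℂ A]
  [NormedAddCommGroup B] [InnerProductSpace ℂ B] [NormedAddCommGroup A₁] [InnerProductSpace ℂ A₁]
  [NormedAddCommGroup B₁] [InnerProductSpace ℂ B₁] [NormedAddCommGroup A₂] [InnerProductSpace ℂ A₂]
  [NormedAddCommGroup B₂] [InnerProductSpace ℂ B₂] [NormedAddCommGroup A₃] [InnerProductSpace ℂ A₃]
  [NormedAddCommGroup B₃] [InnerProductSpace ℂ B₃]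

/-! Shortcuts for the instance search. -/

instance : NormedAddCommGroup (A ⊗ₕ B) := inferInstance
instance : SeminormedAddCommGroup (A ⊗ₕ B) := inferInstance
instance : AddCommGroup (A ⊗ₕ B) := inferInstance
instance : AddCommMonoid (A ⊗ₕ B) := inferInstance
instance : TopologicalSpace (A ⊗ₕ B) := inferInstance
instance : InnerProductSpace ℂ (A ⊗ₕ B) := inferInstance
instance : NormedSpace ℂ (A ⊗ₕ B) := inferInstance
instance : Module ℂ (A ⊗ₕ B) := inferInstance

lemma hmap_coe (f : A →L[ℂ] A₁) (g : B →L[ℂ] B₁) (x : A ⊗[ℂ] B) :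
    hmap f g (x : A ⊗ₕ B) = ((TensorProduct.mapL f g x : A₁ ⊗[ℂ] B₁) : A₁ ⊗ₕ B₁) := by
  exact ContinuousLinearMap.completion_apply_coe _ _

lemma htensor_clm_ext {H : Type*} [NormedAddCommGroup H] [NormedSpace ℂ H]
    {S T : A ⊗ₕ B →L[ℂ] H}
    (h : ∀ a b, S ((a ⊗ₜ[ℂ] b : A ⊗[ℂ] B) : A ⊗ₕ B) = T ((a ⊗ₜ[ℂ] b : A ⊗[ℂ] B) : A ⊗ₕ B)) :
    S = T := by
  ext x
  induction x using UniformSpace.Completion.induction_on with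
  | hp => exact isClosed_eq S.continuous T.continuous
  | ih x =>
    induction x using TensorProduct.induction_on with
    | zero => rw [UniformSpace.Completion.coe_zero, map_zero, map_zero]
    | tmul a b => exact h a b
    | add x y hx hy => simp [UniformSpace.Completion.coe_add, hx, hy]

lemma hmap_comp (f : A₁ →L[ℂ] A₂) (g : B₁ →L[ℂ] B₂) (f' : A →L[ℂ] A₁) (g' : B →L[ℂ] B₁) :
    hmap f g ∘L hmap f' g' = hmap (f ∘L f') (g ∘L g') :=
  htensor_clm_ext fun a b => by simp [hmap_coe]

lemma hmap_hmap (f : A₁ →L[ℂ] A₂) (g : B₁ →L[ℂ] B₂) (f' : A →L[ℂ] A₁) (g' : B →L[ℂ] B₁)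
    (x : A ⊗ₕ B) : hmap f g (hmap f' g' x) = hmap (f ∘L f') (g ∘L g') x := by
  rw [← hmap_comp]; rfl

lemma hmap_add_left (f f' : A →L[ℂ] A₁) (g : B →L[ℂ] B₁) :
    hmap (f + f') g = hmap f g + hmap f' g :=
  htensor_clm_ext fun a b => by
    simp [hmap_coe, TensorProduct.add_tmul, UniformSpace.Completion.coe_add]

lemma hmap_add_right (f : A →L[ℂ] A₁) (g g' : B →L[ℂ] B₁) :
    hmap f (g + g') = hmap f g + hmap f g' :=
  htensor_clm_ext fun a b => by
    simp [hmap_coe, TensorProduct.tmul_add, UniformSpace.Completion.coe_add]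

lemma hmap_smul_left (c : ℂ) (f : A →L[ℂ] A₁) (g : B →L[ℂ] B₁) :
    hmap (c • f) g = c • hmap f g :=
  htensor_clm_ext fun a b => by
    simp [hmap_coe, ← TensorProduct.smul_tmul', UniformSpace.Completion.coe_smul]

lemma hmap_smul_right (c : ℂ) (f : A →L[ℂ] A₁) (g : B →L[ℂ] B₁) :
    hmap f (c • g) = c • hmap f g :=
  htensor_clm_ext fun a b => by
    simp [hmap_coe, UniformSpace.Completion.coe_smul]

/-- `hmap` as a bilinear map. -/
def hmapBilin : (A →L[ℂ] A₁) →ₗ[ℂ] (B →L[ℂ] B₁) →ₗ[ℂ] (A ⊗ₕ B →L[ℂ] A₁ ⊗ₕ B₁) :=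
  LinearMap.mk₂ ℂ hmap hmap_add_left hmap_smul_left hmap_add_right hmap_smul_right

lemma hmapBilin_apply (f : A →L[ℂ] A₁) (g : B →L[ℂ] B₁) : hmapBilin f g = hmap f g := rfl

lemma hmap_sub_right (f : A →L[ℂ] A₁) (g g' : B →L[ℂ] B₁) :
    hmap f (g - g') = hmap f g - hmap f g' := by
  simp [← hmapBilin_apply]

lemma hmap_neg_right (f : A →L[ℂ] A₁) (g : B →L[ℂ] B₁) : hmap f (-g) = -hmap f g := by
  simp [← hmapBilin_apply]

lemma hmap_sum_left {κ : Type*} (s : Finset κ) (f : κ → A →L[ℂ] A₁) (g : B →L[ℂ] B₁) :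
    hmap (∑ k ∈ s, f k) g = ∑ k ∈ s, hmap (f k) g := by
  simp [← hmapBilin_apply]

lemma hmap_sum_right {κ : Type*} (s : Finset κ) (f : A →L[ℂ] A₁) (g : κ → B →L[ℂ] B₁) :
    hmap f (∑ k ∈ s, g k) = ∑ k ∈ s, hmap f (g k) := by
  simp [← hmapBilin_apply]

lemma hmap_id_id : hmap (.id ℂ A) (.id ℂ B) = .id ℂ (A ⊗ₕ B) :=
  htensor_clm_ext fun a b => by simp [hmap_coe]

lemma norm_hmap_le (f : A →L[ℂ] A₁) (g : B →L[ℂ] B₁) : ‖hmap f g‖ ≤ ‖f‖ * ‖g‖ := by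
  refine ContinuousLinearMap.opNorm_le_bound _ (by positivity) fun x => ?_
  induction x using UniformSpace.Completion.induction_on with
  | hp => exact isClosed_le (by fun_prop) (by fun_prop)
  | ih x =>
    rw [hmap_coe, UniformSpace.Completion.norm_coe, UniformSpace.Completion.norm_coe]
    exact ContinuousLinearMap.le_of_opNorm_le _ (TensorProduct.norm_mapL_le f g) x

/-- Inner products of images under tensor products of operators depend only on the Gram data of
the factors. -/
lemma inner_hmap_congr
    {f : A →L[ℂ] A₁} {f' : A₂ →L[ℂ] A₁} {h : A →L[ℂ] A₃} {h' : A₂ →L[ℂ] A₃}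
    {g : B →L[ℂ] B₁} {g' : B₂ →L[ℂ] B₁} {k : B →L[ℂ] B₃} {k' : B₂ →L[ℂ] B₃}
    (hf : ∀ a a', inner ℂ (f a) (f' a') = inner ℂ (h a) (h' a'))
    (hg : ∀ b b', inner ℂ (g b) (g' b') = inner ℂ (k b) (k' b'))
    (x : A ⊗ₕ B) (y : A₂ ⊗ₕ B₂) :
    inner ℂ (hmap f g x) (hmap f' g' y) = inner ℂ (hmap h k x) (hmap h' k' y) := by
  induction x, y using UniformSpace.Completion.induction_on₂ with
  | hp => exact isClosed_eq (by fun_prop) (by fun_prop)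
  | ih x y =>
    simp only [hmap_coe, UniformSpace.Completion.inner_coe]
    induction x using TensorProduct.induction_on with
    | zero => simp
    | add x₁ x₂ h₁ h₂ => simp only [map_add, inner_add_left, h₁, h₂]
    | tmul a b =>
      induction y using TensorProduct.induction_on with
      | zero => simp
      | add x₁ x₂ h₁ h₂ => simp only [map_add, inner_add_right, h₁, h₂]
      | tmul a' b' => simp [hf, hg]

lemma norm_hmap_eq {f : A →L[ℂ] A₁} {g : B →L[ℂ] B₁} (hf : ∀ a, ‖f a‖ = ‖a‖)
    (hg : ∀ b, ‖g b‖ = ‖b‖) (x : A ⊗ₕ B) : ‖hmap f g x‖ = ‖x‖ := by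
  have hf' : ∀ a a', inner ℂ (f a) (f a') = inner ℂ a a' :=
    (LinearMap.norm_map_iff_inner_map_map f).1 hf
  have hg' : ∀ a a', inner ℂ (g a) (g a') = inner ℂ a a' :=
    (LinearMap.norm_map_iff_inner_map_map g).1 hg
  have := inner_hmap_congr (f := f) (f' := f) (h := .id ℂ A) (h' := .id ℂ A)
    (g := g) (g' := g) (k := .id ℂ B) (k' := .id ℂ B) (by simpa using hf') (by simpa using hg') x x
  rw [hmap_id_id] at this
  rw [← sq_eq_sq₀ (norm_nonneg _) (norm_nonneg _), ← inner_self_eq_norm_sq (𝕜 := ℂ),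
    ← inner_self_eq_norm_sq (𝕜 := ℂ), this]
  rfl

lemma inner_hmap_left [CompleteSpace A] [CompleteSpace A₁] [CompleteSpace B] [CompleteSpace B₁]
    (f : A →L[ℂ] A₁) (g : B →L[ℂ] B₁) (x : A ⊗ₕ B) (y : A₁ ⊗ₕ B₁) :
    inner ℂ (hmap f g x) y = inner ℂ x (hmap f.adjoint g.adjoint y) := by
  have := inner_hmap_congr (f := f) (f' := .id ℂ A₁) (h := .id ℂ A)
    (h' := f.adjoint) (g := g) (g' := .id ℂ B₁) (k := .id ℂ B) (k' := g.adjoint)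
    (by simp [ContinuousLinearMap.adjoint_inner_right])
    (by simp [ContinuousLinearMap.adjoint_inner_right]) x y
  simpa [hmap_id_id] using this

end hmap

/-! ### Ordered products over positions -/

section ofFn

variable {M : Type*} [Monoid M]

/-- Only factors at different positions need to commute, so the order within a position survives.
Identities between words can then be checked one position at a time. -/
lemma ofFn_prod_mul_ofFn_prod {n : ℕ} (f g : Fin n → M)
    (h : ∀ i j, i ≠ j → Commute (f i) (g j)) :
    (List.ofFn f).prod * (List.ofFn g).prod = (List.ofFn fun j => f j * g j).prod := by
  induction n with
  | zero => simp
  | succ n ih =>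
    simp only [List.ofFn_succ, List.prod_cons]
    rw [← ih (fun j => f j.succ) (fun j => g j.succ)
      (fun i j hij => h _ _ (by simpa using hij))]
    have : Commute (List.ofFn fun j : Fin n => f j.succ).prod (g 0) := by
      refine Commute.list_prod_left _ _ fun x hx => ?_
      obtain ⟨j, rfl⟩ := (List.mem_ofFn' _ _).1 hx
      exact h _ _ (Fin.succ_ne_zero j)
    rw [mul_assoc, mul_assoc, ← mul_assoc _ (g 0), this.eq, mul_assoc]

/-- Spreads a single element over all positions, so that an operator at position `k` can take part
in positionwise multiplication. -/
lemma ofFn_prod_ite {n : ℕ} (k : Fin n) (a : M) :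
    (List.ofFn fun j => if j = k then a else 1).prod = a := by
  induction n with
  | zero => exact k.elim0
  | succ n ih =>
    simp only [List.ofFn_succ, List.prod_cons]
    cases k using Fin.cases with
    | zero => simp [List.ofFn_const]
    | succ k => simpa [(Fin.succ_ne_zero k).symm] using ih k

lemma ofFn_reverse_prod {n : ℕ} (f : Fin n → M) (h : ∀ i j, Commute (f i) (f j)) :
    (List.ofFn f).reverse.prod = (List.ofFn f).prod := by
  refine List.Perm.prod_eq' (List.reverse_perm _) ?_
  refine List.pairwise_of_forall_mem_list fun a ha b hb => ?_
  obtain ⟨i, rfl⟩ := (List.mem_ofFn' _ _).1 (List.mem_reverse.1 ha)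
  obtain ⟨j, rfl⟩ := (List.mem_ofFn' _ _).1 (List.mem_reverse.1 hb)
  exact h i j

lemma commute_ofFn_prod {n : ℕ} {a : M} {f : Fin n → M} (h : ∀ j, Commute a (f j)) :
    Commute a (List.ofFn f).prod := by
  refine Commute.list_prod_right _ _ fun x hx => ?_
  obtain ⟨j, rfl⟩ := (List.mem_ofFn' _ _).1 hx
  exact h j

end ofFn

/-! ### Words of the swap isometry -/

section algebra

variable {R R' : Type*} [Ring R] [Algebra ℂ R] [Ring R'] [Algebra ℂ R']

lemma ofFn_smul_prod {n : ℕ} (s : Fin n → ℂ) (a : Fin n → R) :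
    (List.ofFn fun j => s j • a j).prod = (∏ j, s j) • (List.ofFn a).prod := by
  induction n with
  | zero => simp
  | succ n ih =>
    simp only [List.ofFn_succ, List.prod_cons, Fin.prod_univ_succ, ih, smul_mul_smul_comm]

/-- The Kraus operators of the swap gadget built from a sign operator `c` and a flip `d`. -/
def swapPart (c d : R) (z : Fin 2) : R :=
  if z = 0 then (1 / 2 : ℂ) • (1 + c) else d * ((1 / 2 : ℂ) • (1 - c))

/-- The Kraus operators of the swap gadget with the order of the factors reversed. -/
def swapPartRev (c d : R) (z : Fin 2) : R :=
  if z = 0 then (1 / 2 : ℂ) • (1 + c) else ((1 / 2 : ℂ) • (1 - c)) * d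

/-- The Kraus operators of `n` successive swap gadgets. -/
def swapWord {n : ℕ} (c d : Fin n → R) (z : Fin n → Fin 2) : R :=
  (List.ofFn fun j => swapPart (c j) (d j) (z j)).prod

/-- The words `swapWord` with the order of all factors reversed. -/
def swapWordRev {n : ℕ} (c d : Fin n → R) (z : Fin n → Fin 2) : R :=
  (List.ofFn fun j => swapPartRev (c j) (d j) (z j)).reverse.prod

/-- `(1 ± u) / 2`. -/
def flagPart (u : R) (b : Fin 2) : R :=
  if b = 0 then (1 / 2 : ℂ) • (1 + u) else (1 / 2 : ℂ) • (1 - u)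

lemma map_swapPart (φ : R →ₐ[ℂ] R') (c d : R) (z : Fin 2) :
    φ (swapPart c d z) = swapPart (φ c) (φ d) z := by
  unfold swapPart; split_ifs <;> simp

lemma map_swapWord (φ : R →ₐ[ℂ] R') {n : ℕ} (c d : Fin n → R) (z : Fin n → Fin 2) :
    φ (swapWord c d z) = swapWord (fun j => φ (c j)) (fun j => φ (d j)) z := by
  simp [swapWord, map_list_prod, List.map_ofFn, Function.comp_def, map_swapPart]

lemma map_swapPartRev (φ : R →ₐ[ℂ] R') (c d : R) (z : Fin 2) :
    φ (swapPartRev c d z) = swapPartRev (φ c) (φ d) z := by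
  unfold swapPartRev; split_ifs <;> simp

lemma map_swapWordRev (φ : R →ₐ[ℂ] R') {n : ℕ} (c d : Fin n → R) (z : Fin n → Fin 2) :
    φ (swapWordRev c d z) = swapWordRev (fun j => φ (c j)) (fun j => φ (d j)) z := by
  simp [swapWordRev, map_list_prod, List.map_ofFn, Function.comp_def, map_swapPartRev,
    List.map_reverse]

lemma map_flagPart (φ : R →ₐ[ℂ] R') (u : R) (b : Fin 2) :
    φ (flagPart u b) = flagPart (φ u) b := by
  unfold flagPart; split_ifs <;> simp

/-- The action of `d, c, -i d c` on the labels of the swap gadget. -/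
def swapPauli : Fin 3 → Matrix (Fin 2) (Fin 2) ℂ :=
  ![!![0, 1; 1, 0], !![1, 0; 0, -1], !![0, Complex.I; -Complex.I, 0]]

/-- The elements `d, c, -i d c`. -/
def swapElem (c d : R) : Fin 3 → R := ![d, c, -Complex.I • (d * c)]

section gadget

variable {c d : R} (hc : c * c = 1) (hd : d * d = 1) (hcd : c * d = -(d * c))

include hc hd hcd

/-- With `P = (1 + c) / 2`, anticommutation gives `d (1 - c) = (1 + c) d`. The left factor is thus
`P d^w`, the right one `d^z P`, and `P d P = 0`. -/
lemma swapPart_mul_swapPartRev (w z : Fin 2) :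
    swapPart c d w * swapPartRev c d z
      = (1 : Matrix (Fin 2) (Fin 2) ℂ) w z • swapPart c d 0 := by
  have hd' : ∀ a, d * (d * a) = a := fun a => by rw [← mul_assoc, hd, one_mul]
  have hcd' : ∀ a, c * (d * a) = -(d * (c * a)) := fun a => by
    rw [← mul_assoc, hcd, neg_mul, mul_assoc]
  fin_cases w <;> fin_cases z <;>
    simp [swapPart, swapPartRev, mul_add, add_mul, sub_mul, mul_sub, mul_assoc, hc, hd, hcd, hd',
      hcd'] <;> module

/-- Compressing `d^w s d^z` by `P = (1 + c) / 2` leaves a multiple of `P`; the scalars are the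
matrix entries of `s` in the basis labelled by the powers of `d`. -/
lemma swapPart_mul_swapElem_mul_swapPartRev (q : Fin 3) (w z : Fin 2) :
    swapPart c d w * swapElem c d q * swapPartRev c d z
      = swapPauli q w z • swapPart c d 0 := by
  have hd' : ∀ a, d * (d * a) = a := fun a => by rw [← mul_assoc, hd, one_mul]
  have hcd' : ∀ a, c * (d * a) = -(d * (c * a)) := fun a => by
    rw [← mul_assoc, hcd, neg_mul, mul_assoc]
  fin_cases q <;> fin_cases w <;> fin_cases z <;>
    simp [swapPart, swapPartRev, swapElem, swapPauli, mul_add, add_mul, sub_mul, mul_sub,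
      mul_assoc, hc, hd, hcd, hd', hcd'] <;> module

end gadget

/-- Pairwise anticommuting reflections `p 0 j, p 1 j, p 2 j` for each position `j`, commuting
between different positions and of the same handedness at all positions. -/
structure PauliFamily {n : ℕ} (p : Fin 3 → Fin n → R) : Prop where
  sq : ∀ q j, p q j * p q j = 1
  anti : ∀ q q' j, q ≠ q' → p q j * p q' j = -(p q' j * p q j)
  comm : ∀ q q' j k, j ≠ k → Commute (p q j) (p q' k)
  hand : ∀ j k, p 0 j * p 1 j * p 2 j = p 0 k * p 1 k * p 2 k

/-! ### Pauli families: the central handedness and the matrix elements of the swap -/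

namespace PauliFamily

variable {n : ℕ} {p : Fin 3 → Fin n → R}

/-- The sign operator at position `j`. -/
def sgnElem (p : Fin 3 → Fin n → R) (j : Fin n) : R := Complex.I • (p 0 j * p 2 j)

/-- The flip operator at position `j`. -/
def flipElem (p : Fin 3 → Fin n → R) (j : Fin n) : R := -Complex.I • (p 1 j * p 2 j)

/-- The handedness at position `j`. -/
def handElem (p : Fin 3 → Fin n → R) (j : Fin n) : R := -Complex.I • (p 0 j * p 1 j * p 2 j)

variable (h : PauliFamily p)

include h

omit [Algebra ℂ R] in
/-- The rewriting rules that sort words at a single position. -/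
lemma rules (j : Fin n) :
    (p 0 j * p 0 j = 1 ∧ p 1 j * p 1 j = 1 ∧ p 2 j * p 2 j = 1) ∧
    (p 1 j * p 0 j = -(p 0 j * p 1 j) ∧ p 2 j * p 0 j = -(p 0 j * p 2 j) ∧
      p 2 j * p 1 j = -(p 1 j * p 2 j)) ∧
    ((∀ a, p 0 j * (p 0 j * a) = a) ∧ (∀ a, p 1 j * (p 1 j * a) = a) ∧
      (∀ a, p 2 j * (p 2 j * a) = a)) ∧
    ((∀ a, p 1 j * (p 0 j * a) = -(p 0 j * (p 1 j * a))) ∧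
      (∀ a, p 2 j * (p 0 j * a) = -(p 0 j * (p 2 j * a))) ∧
      (∀ a, p 2 j * (p 1 j * a) = -(p 1 j * (p 2 j * a)))) := by
  refine ⟨⟨h.sq _ _, h.sq _ _, h.sq _ _⟩, ⟨h.anti _ _ _ (by decide), h.anti _ _ _ (by decide),
    h.anti _ _ _ (by decide)⟩, ⟨?_, ?_, ?_⟩, ?_, ?_, ?_⟩ <;> intro a
  · rw [← mul_assoc, h.sq, one_mul]
  · rw [← mul_assoc, h.sq, one_mul]
  · rw [← mul_assoc, h.sq, one_mul]
  · rw [← mul_assoc, h.anti 1 0 j (by decide), neg_mul, mul_assoc]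
  · rw [← mul_assoc, h.anti 2 0 j (by decide), neg_mul, mul_assoc]
  · rw [← mul_assoc, h.anti 2 1 j (by decide), neg_mul, mul_assoc]

lemma sgn_sq (j : Fin n) : sgnElem p j * sgnElem p j = 1 := by
  obtain ⟨⟨a1, a2, a3⟩, ⟨b1, b2, b3⟩, ⟨c1, c2, c3⟩, d1, d2, d3⟩ := h.rules j
  simp [sgnElem, mul_assoc, *, smul_smul]

lemma flip_sq (j : Fin n) : flipElem p j * flipElem p j = 1 := by
  obtain ⟨⟨a1, a2, a3⟩, ⟨b1, b2, b3⟩, ⟨c1, c2, c3⟩, d1, d2, d3⟩ := h.rules j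
  simp [flipElem, mul_assoc, *, smul_smul]

lemma sgn_mul_flip (j : Fin n) :
    sgnElem p j * flipElem p j = -(flipElem p j * sgnElem p j) := by
  obtain ⟨⟨a1, a2, a3⟩, ⟨b1, b2, b3⟩, ⟨c1, c2, c3⟩, d1, d2, d3⟩ := h.rules j
  simp [sgnElem, flipElem, mul_assoc, *]

lemma hand_sq (j : Fin n) : handElem p j * handElem p j = 1 := by
  obtain ⟨⟨a1, a2, a3⟩, ⟨b1, b2, b3⟩, ⟨c1, c2, c3⟩, d1, d2, d3⟩ := h.rules j
  simp [handElem, mul_assoc, *, smul_smul]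

lemma hand_eq (j k : Fin n) : handElem p j = handElem p k := by
  rw [handElem, h.hand j k, handElem]

/-- Once the central reflection `F` is split off, what is left is a standard qubit algebra generated
by `c` and `d`. The sign of `F` is all that distinguishes the two conjugate versions. -/
lemma swapElem_mul_hand (q : Fin 3) (j : Fin n) :
    p q j = swapElem (sgnElem p j) (flipElem p j) q * handElem p j := by
  obtain ⟨⟨a1, a2, a3⟩, ⟨b1, b2, b3⟩, ⟨c1, c2, c3⟩, d1, d2, d3⟩ := h.rules j
  fin_cases q <;> simp [swapElem, sgnElem, flipElem, handElem, mul_assoc, *, smul_smul]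

lemma hand_comm_self (q : Fin 3) (j : Fin n) : Commute (handElem p j) (p q j) := by
  obtain ⟨⟨a1, a2, a3⟩, ⟨b1, b2, b3⟩, ⟨c1, c2, c3⟩, d1, d2, d3⟩ := h.rules j
  rw [commute_iff_eq]
  fin_cases q <;> simp [handElem, mul_assoc, *]

/-- A single handedness commutes with its own position. Since all handednesses are equal, it is
central for the whole family. -/
lemma hand_comm (q : Fin 3) (j k : Fin n) : Commute (handElem p j) (p q k) := by
  rw [h.hand_eq j k]; exact h.hand_comm_self q k

lemma commute_of_mem_adjoin {j k : Fin n} (hjk : j ≠ k) {a b : R}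
    (ha : a ∈ Algebra.adjoin ℂ {x | ∃ q, x = p q j})
    (hb : b ∈ Algebra.adjoin ℂ {x | ∃ q, x = p q k}) : Commute a b := by
  refine Algebra.commute_of_mem_adjoin_of_forall_mem_commute hb fun y hy => ?_
  refine (Algebra.commute_of_mem_adjoin_of_forall_mem_commute ha fun x hx => ?_).symm
  obtain ⟨q, rfl⟩ := hx
  obtain ⟨q', rfl⟩ := hy
  exact (h.comm q q' j k hjk).symm

omit h in
lemma mem_adjoin (q : Fin 3) (j : Fin n) : p q j ∈ Algebra.adjoin ℂ {x | ∃ q, x = p q j} :=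
  Algebra.subset_adjoin ⟨q, rfl⟩

omit h in
lemma sgn_mem (j : Fin n) : sgnElem p j ∈ Algebra.adjoin ℂ {x | ∃ q, x = p q j} :=
  Subalgebra.smul_mem _ (mul_mem (mem_adjoin _ _) (mem_adjoin _ _)) _

omit h in
lemma flip_mem (j : Fin n) : flipElem p j ∈ Algebra.adjoin ℂ {x | ∃ q, x = p q j} :=
  Subalgebra.smul_mem _ (mul_mem (mem_adjoin _ _) (mem_adjoin _ _)) _

omit h in
lemma swapPart_mem (j : Fin n) (w : Fin 2) :
    swapPart (sgnElem p j) (flipElem p j) w ∈ Algebra.adjoin ℂ {x | ∃ q, x = p q j} := by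
  unfold swapPart
  split_ifs
  · exact Subalgebra.smul_mem _ (add_mem (one_mem _) (sgn_mem j)) _
  · exact mul_mem (flip_mem j) (Subalgebra.smul_mem _ (sub_mem (one_mem _) (sgn_mem j)) _)

omit h in
lemma swapPartRev_mem (j : Fin n) (w : Fin 2) :
    swapPartRev (sgnElem p j) (flipElem p j) w ∈ Algebra.adjoin ℂ {x | ∃ q, x = p q j} := by
  unfold swapPartRev
  split_ifs
  · exact Subalgebra.smul_mem _ (add_mem (one_mem _) (sgn_mem j)) _
  · exact mul_mem (Subalgebra.smul_mem _ (sub_mem (one_mem _) (sgn_mem j)) _) (flip_mem j)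

omit h in
lemma swapElem_mem (q : Fin 3) (j : Fin n) :
    swapElem (sgnElem p j) (flipElem p j) q ∈ Algebra.adjoin ℂ {x | ∃ q, x = p q j} := by
  fin_cases q
  · exact flip_mem j
  · exact sgn_mem j
  · exact Subalgebra.smul_mem _ (mul_mem (flip_mem j) (sgn_mem j)) _

/-- Mirroring reverses a word completely. Between positions the reversal is immaterial because these
factors commute; within a position it stays. -/
lemma swapWordRev_eq (z : Fin n → Fin 2) : swapWordRev (sgnElem p) (flipElem p) z
    = (List.ofFn fun j => swapPartRev (sgnElem p j) (flipElem p j) (z j)).prod := by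
  refine ofFn_reverse_prod _ fun i j => ?_
  rcases eq_or_ne i j with rfl | hij
  · exact Commute.refl _
  · exact h.commute_of_mem_adjoin hij (swapPartRev_mem _ _) (swapPartRev_mem _ _)

lemma hand_comm_of_mem_adjoin (i j : Fin n) {a : R}
    (ha : a ∈ Algebra.adjoin ℂ {x | ∃ q, x = p q j}) : Commute (handElem p i) a := by
  refine Algebra.commute_of_mem_adjoin_of_forall_mem_commute ha fun x hx => ?_
  obtain ⟨q, rfl⟩ := hx
  exact h.hand_comm q i j

lemma swapWord_mul_swapWordRev (w z : Fin n → Fin 2) :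
    swapWord (sgnElem p) (flipElem p) w * swapWordRev (sgnElem p) (flipElem p) z
      = tensorMatrix (fun _ => 1) w z • swapWord (sgnElem p) (flipElem p) 0 := by
  rw [h.swapWordRev_eq, swapWord, ofFn_prod_mul_ofFn_prod _ _ fun i j hij =>
    h.commute_of_mem_adjoin hij (swapPart_mem _ _) (swapPartRev_mem _ _)]
  simp_rw [swapPart_mul_swapPartRev (h.sgn_sq _) (h.flip_sq _) (h.sgn_mul_flip _),
    ofFn_smul_prod]
  rfl

lemma swapWord_mul_swapElem_mul_swapWordRev (q : Fin 3) (k : Fin n) (w z : Fin n → Fin 2) :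
    swapWord (sgnElem p) (flipElem p) w * swapElem (sgnElem p k) (flipElem p k) q
        * swapWordRev (sgnElem p) (flipElem p) z
      = tensorMatrix (fun j => if j = k then swapPauli q else 1) w z
        • swapWord (sgnElem p) (flipElem p) 0 := by
  have key : ∀ j : Fin n, (if j = k then swapElem (sgnElem p k) (flipElem p k) q else 1)
      ∈ Algebra.adjoin ℂ {x | ∃ q, x = p q j} := by
    intro j
    split_ifs with hj
    · rw [hj]; exact swapElem_mem q k
    · exact one_mem _
  rw [h.swapWordRev_eq, swapWord,
    ← ofFn_prod_ite k (swapElem (sgnElem p k) (flipElem p k) q),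
    ofFn_prod_mul_ofFn_prod _ _ fun i j hij =>
      h.commute_of_mem_adjoin hij (swapPart_mem _ _) (key j),
    ofFn_prod_mul_ofFn_prod _ _ fun i j hij =>
      h.commute_of_mem_adjoin hij (mul_mem (swapPart_mem _ _) (key i)) (swapPartRev_mem _ _)]
  have : ∀ j, swapPart (sgnElem p j) (flipElem p j) (w j)
      * (if j = k then swapElem (sgnElem p k) (flipElem p k) q else 1)
      * swapPartRev (sgnElem p j) (flipElem p j) (z j)
      = ((if j = k then swapPauli q else 1 : Matrix (Fin 2) (Fin 2) ℂ) (w j) (z j))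
        • swapPart (sgnElem p j) (flipElem p j) 0 := by
    intro j
    split_ifs with hj
    · subst hj
      exact swapPart_mul_swapElem_mul_swapPartRev (h.sgn_sq _) (h.flip_sq _)
        (h.sgn_mul_flip _) _ _ _
    · rw [mul_one]
      exact swapPart_mul_swapPartRev (h.sgn_sq _) (h.flip_sq _) (h.sgn_mul_flip _) _ _
  simp_rw [this, ofFn_smul_prod]
  rfl

/-- Each gadget ends in the eigenspace `c = 1`, so `(1 + c_i) / 2` acts trivially on the left of a
swap word. Hence `u` may be exchanged for the handedness there, although the two need not agree
elsewhere. -/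
lemma mul_swapWord {u : R} {i : Fin n}
    (hu : u * (1 + sgnElem p i) = handElem p i * (1 + sgnElem p i)) (w : Fin n → Fin 2) :
    u * swapWord (sgnElem p) (flipElem p) w
      = handElem p i * swapWord (sgnElem p) (flipElem p) w := by
  have h1 : (1 + sgnElem p i) * swapWord (sgnElem p) (flipElem p) w
      = (2 : ℂ) • swapWord (sgnElem p) (flipElem p) w := by
    have key : ∀ j : Fin n, (if j = i then (1 / 2 : ℂ) • (1 + sgnElem p i) else 1)
        ∈ Algebra.adjoin ℂ {x | ∃ q, x = p q j} := by
      intro j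
      split_ifs with hj
      · rw [hj]; exact Subalgebra.smul_mem _ (add_mem (one_mem _) (sgn_mem i)) _
      · exact one_mem _
    have h2 : ((1 / 2 : ℂ) • (1 + sgnElem p i)) * swapWord (sgnElem p) (flipElem p) w
        = swapWord (sgnElem p) (flipElem p) w := by
      rw [swapWord, ← ofFn_prod_ite i ((1 / 2 : ℂ) • (1 + sgnElem p i)),
        ofFn_prod_mul_ofFn_prod _ _ fun j k hjk =>
          h.commute_of_mem_adjoin hjk (key j) (swapPart_mem _ _)]
      congr 2
      funext j
      split_ifs with hj
      · subst hj
        have hc := h.sgn_sq j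
        have hd : ∀ a, sgnElem p j * (flipElem p j * a) = -(flipElem p j * (sgnElem p j * a)) :=
          fun a => by rw [← mul_assoc, h.sgn_mul_flip, neg_mul, mul_assoc]
        unfold swapPart
        split_ifs
        · simp [mul_add, add_mul, hc]; module
        · simp [add_mul, mul_sub, hc, hd, h.sgn_mul_flip]; module
      · rw [one_mul]
    rw [← h2, ← mul_assoc, mul_smul_comm]
    have h3 : (1 + sgnElem p i) * (1 + sgnElem p i) = (2 : ℂ) • (1 + sgnElem p i) := by
      simp [mul_add, add_mul, h.sgn_sq i]; module
    rw [h3, smul_comm, smul_mul_assoc, h2]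
  have h2 : swapWord (sgnElem p) (flipElem p) w
      = (1 / 2 : ℂ) • ((1 + sgnElem p i) * swapWord (sgnElem p) (flipElem p) w) := by
    rw [h1, smul_smul]; norm_num
  rw [h2, mul_smul_comm, mul_smul_comm, ← mul_assoc, ← mul_assoc, hu]

lemma flagPart_hand_mul (i : Fin n) (b b' : Fin 2) :
    flagPart (handElem p i) b' * flagPart (handElem p i) b
      = if b = b' then flagPart (handElem p i) b else 0 := by
  have hs := h.hand_sq i
  fin_cases b <;> fin_cases b' <;>
    simp [flagPart, mul_add, add_mul, mul_sub, sub_mul, hs] <;> module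

omit h in
lemma flagPart_mul_swapWord {u : R} {i : Fin n} {W : R} (hW : u * W = handElem p i * W)
    (b : Fin 2) : flagPart u b * W = flagPart (handElem p i) b * W := by
  unfold flagPart
  split_ifs <;> simp [add_mul, sub_mul, hW]

lemma hand_mul_flagPart (i : Fin n) (b : Fin 2) :
    handElem p i * flagPart (handElem p i) b
      = ((-1 : ℂ) ^ (b : ℕ)) • flagPart (handElem p i) b := by
  have hs := h.hand_sq i
  fin_cases b <;> simp [flagPart, mul_add, mul_sub, hs] <;> module

lemma hand_comm_swapWord (i : Fin n) (w : Fin n → Fin 2) :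
    Commute (handElem p i) (swapWord (sgnElem p) (flipElem p) w) :=
  commute_ofFn_prod fun j => h.hand_comm_of_mem_adjoin i j (swapPart_mem _ _)

lemma hand_comm_swapWordRev (i : Fin n) (w : Fin n → Fin 2) :
    Commute (handElem p i) (swapWordRev (sgnElem p) (flipElem p) w) := by
  rw [h.swapWordRev_eq]
  exact commute_ofFn_prod fun j => h.hand_comm_of_mem_adjoin i j (swapPartRev_mem _ _)

omit h in
lemma _root_.Commute.flagPart_left {u a : R} (hu : Commute u a) (b : Fin 2) :
    Commute (flagPart u b) a := by
  unfold flagPart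
  split_ifs
  · exact ((Commute.one_left a).add_left hu).smul_left _
  · exact ((Commute.one_left a).sub_left hu).smul_left _

/-- The components of the swapped state. -/
lemma component_state {u : R} {i : Fin n}
    (hu : u * (1 + sgnElem p i) = handElem p i * (1 + sgnElem p i)) (b b' : Fin 2)
    (w z : Fin n → Fin 2) :
    flagPart u b' * swapWord (sgnElem p) (flipElem p) w
        * (swapWordRev (sgnElem p) (flipElem p) z * flagPart (handElem p i) b)
      = if b = b' then tensorMatrix (fun _ => 1) w z
        • (flagPart u b * swapWord (sgnElem p) (flipElem p) 0) else 0 := by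
  -- After `u` has been exchanged for the handedness, both flag projectors are central for the words
  -- and meet, which gives the Kronecker delta in `b, b'`.
  rw [flagPart_mul_swapWord (h.mul_swapWord hu w), flagPart_mul_swapWord (h.mul_swapWord hu 0),
    ((h.hand_comm_swapWordRev i z).flagPart_left b).symm.eq, mul_assoc,
    ← mul_assoc (swapWord _ _ _), ((h.hand_comm_swapWord i w).flagPart_left b).symm.eq,
    mul_assoc (flagPart _ b), ← mul_assoc, h.flagPart_hand_mul, h.swapWord_mul_swapWordRev]
  split_ifs <;> simp

/-- The components of the swapped state after an application of a Pauli operator. -/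
lemma component_pauli {u : R} {i : Fin n}
    (hu : u * (1 + sgnElem p i) = handElem p i * (1 + sgnElem p i)) (q : Fin 3) (k : Fin n)
    (b b' : Fin 2) (w z : Fin n → Fin 2) :
    flagPart u b' * swapWord (sgnElem p) (flipElem p) w * p q k
        * (swapWordRev (sgnElem p) (flipElem p) z * flagPart (handElem p i) b)
      = if b = b' then
          ((-1 : ℂ) ^ (b : ℕ) * tensorMatrix (fun j => if j = k then swapPauli q else 1) w z)
            • (flagPart u b * swapWord (sgnElem p) (flipElem p) 0) else 0 := by
  have e := h.swapElem_mul_hand q k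
  rw [h.hand_eq k i] at e
  rw [flagPart_mul_swapWord (h.mul_swapWord hu w), flagPart_mul_swapWord (h.mul_swapWord hu 0), e]
  set F := handElem p i
  set W := swapWord (sgnElem p) (flipElem p)
  set V := swapWordRev (sgnElem p) (flipElem p) z
  set T := swapElem (sgnElem p k) (flipElem p k) q
  have hV : Commute F V := h.hand_comm_swapWordRev i z
  have hT : Commute F T := h.hand_comm_of_mem_adjoin i k (swapElem_mem q k)
  have hW : Commute F (W w) := h.hand_comm_swapWord i w
  have h₁ : F * flagPart F b = (-1 : ℂ) ^ (b : ℕ) • flagPart F b := h.hand_mul_flagPart i b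
  have h₂ : flagPart F b' * flagPart F b = if b = b' then flagPart F b else 0 :=
    h.flagPart_hand_mul i b b'
  have h₃ : W w * T * V = tensorMatrix (fun j => if j = k then swapPauli q else 1) w z • W 0 :=
    h.swapWord_mul_swapElem_mul_swapWordRev q k w z
  -- The central `F` is moved to its own spectral projector, where it becomes the sign `(-1)^b`; the
  -- two spectral projectors are then brought together, leaving the word `W T V`.
  calc flagPart F b' * W w * (T * F) * (V * flagPart F b)
      = flagPart F b' * (W w * T * V) * (F * flagPart F b) := by
        simp only [mul_assoc]
        rw [← mul_assoc F V, hV.eq, mul_assoc]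
    _ = (-1 : ℂ) ^ (b : ℕ) • ((flagPart F b' * flagPart F b) * (W w * T * V)) := by
        rw [h₁, mul_smul_comm, mul_assoc (flagPart F b'), mul_assoc (flagPart F b'),
          ← (((hW.mul_right hT).mul_right hV).flagPart_left b).eq]
    _ = _ := by
        rw [h₂, h₃]
        split_ifs <;> simp [smul_smul]

section words

variable {r : ℂ} (hr : r * r = 1 / 2)

include hr

/-- Words in the rotated reflections `(p q ± p q') / √2` represent the elements of the swap
gadget. -/
lemma sgnElem_eq (j : Fin n) :
    Complex.I • ((r • (p 2 j + p 0 j)) * (r • (p 2 j - p 0 j))) = sgnElem p j := by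
  obtain ⟨⟨a1, a2, a3⟩, ⟨b1, b2, b3⟩, ⟨c1, c2, c3⟩, d1, d2, d3⟩ := h.rules j
  simp only [smul_mul_smul_comm, hr, sgnElem]
  simp [mul_sub, add_mul, *]
  module

lemma flipElem_eq (j : Fin n) :
    -Complex.I • ((r • (p 2 j + p 1 j)) * (r • (p 2 j - p 1 j))) = flipElem p j := by
  obtain ⟨⟨a1, a2, a3⟩, ⟨b1, b2, b3⟩, ⟨c1, c2, c3⟩, d1, d2, d3⟩ := h.rules j
  simp only [smul_mul_smul_comm, hr, flipElem]
  simp [mul_sub, add_mul, *]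
  module

/-- Expanding gives `(X + Y)(Z + X)(Z + Y) = 2 (Y - XYZ)`, with `XYZ = i F`. Since `Y = c F`, the
operator `Y` acts as `F` where `c = 1`, so `Y - XYZ` acts as `(1 - i) F`. The prefactor `(1 + i) r`
and the three factors `r` make the total scalar one. The point of the word is that it is a phase
times a product of rotated reflections, which Bob possesses exactly, whereas `F` itself he has only
approximately. -/
lemma flagWord_mul (j : Fin n) :
    (((1 + Complex.I) * r) • ((r • (p 0 j + p 1 j)) * (r • (p 2 j + p 0 j))
        * (r • (p 2 j + p 1 j)))) * (1 + sgnElem p j)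
      = handElem p j * (1 + sgnElem p j) := by
  obtain ⟨⟨a1, a2, a3⟩, ⟨b1, b2, b3⟩, ⟨c1, c2, c3⟩, d1, d2, d3⟩ := h.rules j
  have e : (p 0 j + p 1 j) * (p 2 j + p 0 j) * (p 2 j + p 1 j)
      = (2 : ℂ) • (p 1 j - p 0 j * p 1 j * p 2 j) := by
    simp [mul_add, add_mul, mul_assoc, *]
    module
  rw [smul_mul_smul_comm, smul_mul_smul_comm, e, hr, smul_smul, smul_smul]
  have e2 : (1 + Complex.I) * r * (1 / 2 * r) * 2 = (1 + Complex.I) / 2 := by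
    linear_combination (1 + Complex.I) * hr
  rw [e2]
  simp only [sgnElem, handElem]
  simp [mul_add, sub_mul, mul_assoc, *, smul_smul, smul_sub]
  match_scalars <;> simp [Complex.ext_iff] <;> norm_num

end words

end PauliFamily

end algebra

/-! ### Families of strategies and approximate equality up to a uniform error -/

section families

variable {ι : Type*}

section vectors

variable {H K : ι → Type*} [∀ i, NormedAddCommGroup (H i)] [∀ i, NormedSpace ℂ (H i)]
  [∀ i, NormedAddCommGroup (K i)] [∀ i, NormedSpace ℂ (K i)]

/-- The families of vectors of norm `O(η)`. -/
def smallFam (H : ι → Type*) [∀ i, NormedAddCommGroup (H i)] [∀ i, NormedSpace ℂ (H i)]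
    (η : ι → ℝ) : Submodule ℂ (∀ i, H i) where
  carrier := {v | ∃ C, ∀ i, ‖v i‖ ≤ C * η i}
  zero_mem' := ⟨0, by simp⟩
  add_mem' := by
    rintro v w ⟨C, hC⟩ ⟨D, hD⟩
    exact ⟨C + D, fun i => by
      rw [add_mul]; exact (norm_add_le _ _).trans (add_le_add (hC i) (hD i))⟩
  smul_mem' := by
    rintro c v ⟨C, hC⟩
    exact ⟨‖c‖ * C, fun i => by
      rw [Pi.smul_apply, norm_smul, mul_assoc]
      exact mul_le_mul_of_nonneg_left (hC i) (norm_nonneg c)⟩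

/-- The uniformly bounded families of operators. -/
def boundedFam (H K : ι → Type*) [∀ i, NormedAddCommGroup (H i)] [∀ i, NormedSpace ℂ (H i)]
    [∀ i, NormedAddCommGroup (K i)] [∀ i, NormedSpace ℂ (K i)] :
    Submodule ℂ (∀ i, H i →L[ℂ] K i) := smallFam (fun i => H i →L[ℂ] K i) fun _ => 1

lemma mem_boundedFam {T : ∀ i, H i →L[ℂ] K i} {C : ℝ} (h : ∀ i, ‖T i‖ ≤ C) :
    T ∈ boundedFam H K := ⟨C, by simpa using h⟩

lemma exists_bound {T : ∀ i, H i →L[ℂ] K i} (h : T ∈ boundedFam H K) :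
    ∃ C, 0 ≤ C ∧ ∀ i, ‖T i‖ ≤ C := by
  obtain ⟨C, hC⟩ := h
  exact ⟨max C 0, le_max_right _ _, fun i => (hC i).trans (by simp)⟩

lemma mem_boundedFam_of_norm_map {T : ∀ i, H i →L[ℂ] K i} (h : ∀ i x, ‖T i x‖ = ‖x‖) :
    T ∈ boundedFam H K :=
  mem_boundedFam (C := 1) fun i =>
    ContinuousLinearMap.opNorm_le_bound _ zero_le_one fun x => by rw [h, one_mul]

lemma apply_mem_smallFam {T : ∀ i, H i →L[ℂ] K i} (hT : T ∈ boundedFam H K) {η : ι → ℝ}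
    {v : ∀ i, H i} (hv : v ∈ smallFam H η) : (fun i => T i (v i)) ∈ smallFam K η := by
  obtain ⟨C, hC0, hC⟩ := exists_bound hT
  obtain ⟨D, hD⟩ := hv
  refine ⟨C * D, fun i => ?_⟩
  rw [mul_assoc]
  exact ((T i).le_of_opNorm_le (hC i) _).trans (mul_le_mul_of_nonneg_left (hD i) hC0)

lemma mul_mem_boundedFam {S T : ∀ i, H i →L[ℂ] H i} (hS : S ∈ boundedFam H H)
    (hT : T ∈ boundedFam H H) : S * T ∈ boundedFam H H := by
  obtain ⟨C, hC0, hC⟩ := exists_bound hS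
  obtain ⟨D, hD0, hD⟩ := exists_bound hT
  exact mem_boundedFam (C := C * D) fun i =>
    (norm_mul_le _ _).trans (mul_le_mul (hC i) (hD i) (norm_nonneg _) hC0)

lemma one_mem_boundedFam : (1 : ∀ i, H i →L[ℂ] H i) ∈ boundedFam H H :=
  mem_boundedFam_of_norm_map fun _ _ => rfl

end vectors

variable {A B : ι → Type*} [∀ i, NormedAddCommGroup (A i)] [∀ i, InnerProductSpace ℂ (A i)]
  [∀ i, NormedAddCommGroup (B i)] [∀ i, InnerProductSpace ℂ (B i)]
  {A₁ B₁ : ι → Type*} [∀ i, NormedAddCommGroup (A₁ i)] [∀ i, InnerProductSpace ℂ (A₁ i)]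
  [∀ i, NormedAddCommGroup (B₁ i)] [∀ i, InnerProductSpace ℂ (B₁ i)]

lemma hmap_mem_boundedFam {f : ∀ i, A i →L[ℂ] A₁ i} {g : ∀ i, B i →L[ℂ] B₁ i}
    (hf : f ∈ boundedFam A A₁) (hg : g ∈ boundedFam B B₁) :
    (fun i => hmap (f i) (g i)) ∈ boundedFam (fun i => A i ⊗ₕ B i) (fun i => A₁ i ⊗ₕ B₁ i) := by
  obtain ⟨C, hC0, hC⟩ := exists_bound hf
  obtain ⟨D, hD0, hD⟩ := exists_bound hg
  exact mem_boundedFam (C := C * D) fun i =>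
    (norm_hmap_le _ _).trans (mul_le_mul (hC i) (hD i) (norm_nonneg _) hC0)

lemma id_mem_boundedFam : (fun i => .id ℂ (A i)) ∈ boundedFam A A := one_mem_boundedFam

variable (ψ : ∀ i, A i ⊗ₕ B i) (η : ι → ℝ)

/-- The bounded families `a` of Alice and `b` of Bob act on the states `ψ` in the same way, up to
`O(η)`. -/
structure Mirror (a : ∀ i, A i →L[ℂ] A i) (b : ∀ i, B i →L[ℂ] B i) : Prop where
  left : a ∈ boundedFam A A
  right : b ∈ boundedFam B B
  small : (fun i => hmap (a i) (.id ℂ _) (ψ i) - hmap (.id ℂ _) (b i) (ψ i)) ∈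
    smallFam (fun i => A i ⊗ₕ B i) η

variable {ψ η}

lemma Mirror.add {a a' : ∀ i, A i →L[ℂ] A i} {b b' : ∀ i, B i →L[ℂ] B i} (h : Mirror ψ η a b)
    (h' : Mirror ψ η a' b') : Mirror ψ η (a + a') (b + b') := by
  refine ⟨add_mem h.left h'.left, add_mem h.right h'.right, ?_⟩
  convert add_mem h.small h'.small using 1
  funext i
  simp only [Pi.add_apply, hmap_add_left, hmap_add_right, add_apply]
  abel

lemma Mirror.smul (c : ℂ) {a : ∀ i, A i →L[ℂ] A i} {b : ∀ i, B i →L[ℂ] B i}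
    (h : Mirror ψ η a b) : Mirror ψ η (c • a) (c • b) := by
  refine ⟨Submodule.smul_mem _ c h.left, Submodule.smul_mem _ c h.right, ?_⟩
  convert Submodule.smul_mem _ c h.small using 1
  funext i
  simp only [Pi.smul_apply, hmap_smul_left, hmap_smul_right, smul_apply, smul_sub]

lemma Mirror.one : Mirror ψ η (1 : ∀ i, A i →L[ℂ] A i) (1 : ∀ i, B i →L[ℂ] B i) := by
  refine ⟨one_mem_boundedFam, one_mem_boundedFam, ?_⟩
  convert zero_mem (smallFam (fun i => A i ⊗ₕ B i) η) using 1
  funext i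
  exact sub_self _

lemma Mirror.sub {a a' : ∀ i, A i →L[ℂ] A i} {b b' : ∀ i, B i →L[ℂ] B i} (h : Mirror ψ η a b)
    (h' : Mirror ψ η a' b') : Mirror ψ η (a - a') (b - b') := by
  simpa [sub_eq_add_neg] using h.add (h'.smul (-1))

/-- Alice's operators commute with Bob's: `a a' ψ ≈ a b' ψ = b' a ψ ≈ b' b ψ`. This is why products
come out in reversed order. -/
lemma Mirror.mul {a a' : ∀ i, A i →L[ℂ] A i} {b b' : ∀ i, B i →L[ℂ] B i} (h : Mirror ψ η a b)
    (h' : Mirror ψ η a' b') : Mirror ψ η (a * a') (b' * b) := by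
  refine ⟨mul_mem_boundedFam h.left h'.left, mul_mem_boundedFam h'.right h.right, ?_⟩
  convert add_mem (apply_mem_smallFam (hmap_mem_boundedFam h.left id_mem_boundedFam) h'.small)
    (apply_mem_smallFam (hmap_mem_boundedFam id_mem_boundedFam h'.right) h.small) using 1
  funext i
  simp only [Pi.add_apply, map_sub, hmap_hmap, Pi.mul_apply, ContinuousLinearMap.id_comp,
    ContinuousLinearMap.comp_id, ContinuousLinearMap.mul_def]
  abel

lemma Mirror.swapPart {a a' : ∀ i, A i →L[ℂ] A i} {b b' : ∀ i, B i →L[ℂ] B i}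
    (h : Mirror ψ η a b) (h' : Mirror ψ η a' b') (z : Fin 2) :
    Mirror ψ η (swapPart a a' z) (swapPartRev b b' z) := by
  unfold SelfTesting.swapPart swapPartRev
  split_ifs
  · exact (Mirror.one.add h).smul _
  · exact h'.mul ((Mirror.one.sub h).smul _)

lemma Mirror.flagPart {a : ∀ i, A i →L[ℂ] A i} {b : ∀ i, B i →L[ℂ] B i}
    (h : Mirror ψ η a b) (z : Fin 2) :
    Mirror ψ η (flagPart a z) (flagPart b z) := by
  unfold SelfTesting.flagPart
  split_ifs
  · exact (Mirror.one.add h).smul _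
  · exact (Mirror.one.sub h).smul _

lemma Mirror.ofFn {n : ℕ} {a : Fin n → ∀ i, A i →L[ℂ] A i} {b : Fin n → ∀ i, B i →L[ℂ] B i}
    (h : ∀ j, Mirror ψ η (a j) (b j)) :
    Mirror ψ η (List.ofFn a).prod (List.ofFn b).reverse.prod := by
  induction n with
  | zero => simpa using Mirror.one
  | succ n ih =>
    simpa [List.ofFn_succ] using (h 0).mul (ih fun j => h j.succ)

lemma Mirror.swapWord {n : ℕ} {a a' : Fin n → ∀ i, A i →L[ℂ] A i}
    {b b' : Fin n → ∀ i, B i →L[ℂ] B i} (h : ∀ j, Mirror ψ η (a j) (b j))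
    (h' : ∀ j, Mirror ψ η (a' j) (b' j)) (z : Fin n → Fin 2) :
    Mirror ψ η (swapWord a a' z) (swapWordRev b b' z) :=
  Mirror.ofFn fun j => (h j).swapPart (h' j) (z j)

variable (ψ η)

/-- The algebra of Bob's families that are mirrored by a family of Alice. -/
def mirrored : Subalgebra ℂ (∀ i, B i →L[ℂ] B i) where
  carrier := {b | ∃ a, Mirror ψ η a b}
  mul_mem' := by
    rintro b b' ⟨a, h⟩ ⟨a', h'⟩
    exact ⟨_, h'.mul h⟩
  add_mem' := by
    rintro b b' ⟨a, h⟩ ⟨a', h'⟩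
    exact ⟨_, h.add h'⟩
  algebraMap_mem' c := ⟨c • 1, by
    rw [Algebra.algebraMap_eq_smul_one]; exact Mirror.one.smul c⟩

variable {ψ η}

lemma Mirror.mem {a : ∀ i, A i →L[ℂ] A i} {b : ∀ i, B i →L[ℂ] B i} (h : Mirror ψ η a b) :
    b ∈ mirrored ψ η := ⟨a, h⟩

lemma bounded_of_mirrored (b : mirrored ψ η) : (b : ∀ i, B i →L[ℂ] B i) ∈ boundedFam B B := by
  obtain ⟨a, h⟩ := b.2
  exact h.right

variable (ψ η)

/-- The families of Bob that annihilate the states `ψ` up to `O(η)`. -/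
def IsNull (b : ∀ i, B i →L[ℂ] B i) : Prop :=
  (fun i => hmap (.id ℂ _) (b i) (ψ i)) ∈ smallFam (fun i => A i ⊗ₕ B i) η

variable {ψ η}

lemma IsNull.add {b b' : ∀ i, B i →L[ℂ] B i} (h : IsNull ψ η b) (h' : IsNull ψ η b') :
    IsNull ψ η (b + b') := by
  unfold IsNull at *
  convert add_mem h h' using 1
  funext i
  simp [hmap_add_right]

lemma IsNull.neg {b : ∀ i, B i →L[ℂ] B i} (h : IsNull ψ η b) : IsNull ψ η (-b) := by
  unfold IsNull at *
  convert neg_mem h using 1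
  funext i
  simp [hmap_neg_right]

lemma IsNull.mul_left {b b' : ∀ i, B i →L[ℂ] B i} (h : IsNull ψ η b)
    (hb' : b' ∈ boundedFam B B) : IsNull ψ η (b' * b) := by
  unfold IsNull at *
  convert apply_mem_smallFam (hmap_mem_boundedFam (id_mem_boundedFam (A := A)) hb') h using 1
  funext i
  simp [hmap_hmap, ContinuousLinearMap.mul_def]

/-- Here the mirror is indispensable: `b b' ψ ≈ b a ψ = a b ψ ≈ 0`. Boundedness of `b'` alone would
not suffice, in contrast to multiplication from the left. -/
lemma IsNull.mul_right {a : ∀ i, A i →L[ℂ] A i} {b b' : ∀ i, B i →L[ℂ] B i}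
    (h : IsNull ψ η b) (hb : b ∈ boundedFam B B) (h' : Mirror ψ η a b') :
    IsNull ψ η (b * b') := by
  unfold IsNull at *
  convert sub_mem (apply_mem_smallFam (hmap_mem_boundedFam h'.left id_mem_boundedFam) h)
    (apply_mem_smallFam (hmap_mem_boundedFam id_mem_boundedFam hb) h'.small) using 1
  funext i
  simp [hmap_hmap, ContinuousLinearMap.mul_def]

/-- The mechanism that carries exact identities between Alice's observables over to the classes of
Bob's operators. -/
lemma IsNull.of_mirror {a : ∀ i, A i →L[ℂ] A i} {b b' : ∀ i, B i →L[ℂ] B i}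
    (h : Mirror ψ η a b) (h' : Mirror ψ η a b') : IsNull ψ η (b - b') := by
  unfold IsNull
  convert sub_mem h'.small h.small using 1
  funext i
  simp [hmap_sub_right]

variable (ψ η)

/-- Equality of the action on the states, up to `O(η)`. -/
def nullCon : RingCon (mirrored ψ η) where
  r b b' := IsNull ψ η (b.1 - b'.1)
  iseqv := by
    refine ⟨fun b => ?_, fun {b b'} h => ?_, fun {b b' b''} h h' => ?_⟩
    · exact IsNull.of_mirror b.2.choose_spec b.2.choose_spec
    · rw [← neg_sub]; exact h.neg
    · rw [← sub_add_sub_cancel]; exact h.add h'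
  add' {b b' d d'} h h' := by
    have := h.add h'
    rwa [← add_sub_add_comm] at this
  mul' {b b' d d'} h h' := by
    -- The difference is split as `b (d - d') + (b - b') d'`; in the second term `d'` stands on the
    -- right and its mirror is needed.
    obtain ⟨a, ha⟩ := d'.2
    have h1 := h'.mul_left (bounded_of_mirrored b)
    have h2 : IsNull ψ η ((b.1 - b'.1) * d'.1) :=
      IsNull.mul_right h (sub_mem (bounded_of_mirrored b) (bounded_of_mirrored b')) ha
    have h3 := h1.add h2
    rwa [mul_sub, sub_mul, sub_add_sub_cancel] at h3

/-- The algebra of Bob's mirrored families up to their action on the states. -/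
def StateAlgebra : Type _ := (nullCon ψ η).Quotient

instance : Ring (StateAlgebra ψ η) := inferInstanceAs (Ring (nullCon ψ η).Quotient)

/-- The class of a mirrored family, as a ring homomorphism. -/
def stateRingHom : mirrored ψ η →+* StateAlgebra ψ η := (nullCon ψ η).mk'

instance : Algebra ℂ (StateAlgebra ψ η) :=
  ((stateRingHom ψ η).comp (algebraMap ℂ (mirrored ψ η))).toAlgebra' fun c x => by
    obtain ⟨b, rfl⟩ := (nullCon ψ η).mk'_surjective x
    change stateRingHom ψ η _ * stateRingHom ψ η _ = stateRingHom ψ η _ * stateRingHom ψ η _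
    rw [← map_mul, ← map_mul, Algebra.commutes]

variable {ψ η}

/-- The class of a mirrored family. -/
def stateClass : mirrored ψ η →ₐ[ℂ] StateAlgebra ψ η :=
  { stateRingHom ψ η with commutes' := fun _ => rfl }

lemma stateClass_eq_iff {b b' : mirrored ψ η} : stateClass b = stateClass b' ↔
    IsNull ψ η (b - b' : ∀ i, B i →L[ℂ] B i) :=
  (nullCon ψ η).eq

lemma stateClass_eq_of_mirror {a : ∀ i, A i →L[ℂ] A i} {b b' : mirrored ψ η}
    (h : Mirror ψ η a b) (h' : Mirror ψ η a b') : stateClass b = stateClass b' :=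
  stateClass_eq_iff.2 (IsNull.of_mirror h h')

/-- An identity of classes yields an approximate identity of vectors. -/
lemma hmap_sub_mem_smallFam {a : ∀ i, A i →L[ℂ] A i} {t b x : mirrored ψ η}
    (h : Mirror ψ η a b) {s : ℂ} (hx : stateClass (t * b) = s • stateClass x) :
    (fun i => hmap (a i) (t.1 i) (ψ i) - s • hmap (.id ℂ _) (x.1 i) (ψ i)) ∈
      smallFam (fun i => A i ⊗ₕ B i) η := by
  rw [← map_smul, stateClass_eq_iff] at hx
  convert add_mem (apply_mem_smallFam (hmap_mem_boundedFam id_mem_boundedFam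
    (bounded_of_mirrored t)) h.small) hx using 1
  funext i
  simp [hmap_hmap, hmap_sub_right, hmap_smul_right, ContinuousLinearMap.mul_def]

end families

/-! ### Tensor products of qubit operators -/

section qubits

variable {n : ℕ}

lemma tensorMatrix_mul (M N : Fin n → Matrix (Fin 2) (Fin 2) ℂ) :
    tensorMatrix M * tensorMatrix N = tensorMatrix fun j => M j * N j := by
  ext z w
  simp only [tensorMatrix, Matrix.mul_apply, Matrix.of_apply]
  rw [Finset.prod_univ_sum]
  simp [Finset.prod_mul_distrib]

lemma tensorMatrix_one : tensorMatrix (fun _ : Fin n => 1) = 1 := by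
  ext z w
  simp only [tensorMatrix, Matrix.of_apply, Matrix.one_apply, Finset.prod_ite_zero,
    Finset.prod_const_one, Finset.mem_univ, true_imp_iff, funext_iff]

lemma tensorMatrix_conjTranspose (M : Fin n → Matrix (Fin 2) (Fin 2) ℂ) :
    (tensorMatrix M).conjTranspose = tensorMatrix fun j => (M j).conjTranspose := by
  ext z w
  simp [tensorMatrix, Matrix.conjTranspose_apply]

lemma tensorOp_mul (M N : Fin n → Matrix (Fin 2) (Fin 2) ℂ) :
    tensorOp M * tensorOp N = tensorOp fun j => M j * N j := by
  rw [tensorOp, tensorOp, ← map_mul, tensorMatrix_mul, tensorOp]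

lemma tensorOp_one : tensorOp (fun _ : Fin n => 1) = 1 := by
  rw [tensorOp, tensorMatrix_one, map_one]

lemma toEuclideanCLM_ket (M : Matrix (Fin n → Fin 2) (Fin n → Fin 2) ℂ) (z : Fin n → Fin 2) :
    Matrix.toEuclideanCLM (𝕜 := ℂ) M (ket z) = ∑ w, M w z • ket w := by
  ext x
  simp [ket, Matrix.ofLp_toEuclideanCLM, Pi.single_apply]

lemma tensorOp_ket (M : Fin n → Matrix (Fin 2) (Fin 2) ℂ) (z : Fin n → Fin 2) :
    tensorOp M (ket z) = ∑ w, tensorMatrix M w z • ket w :=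
  toEuclideanCLM_ket _ _

lemma inner_ket (z w : Fin n → Fin 2) : inner ℂ (ket z) (ket w) = if z = w then 1 else 0 := by
  simp [ket, EuclideanSpace.inner_single_left]

lemma inner_tensorOp {M : Fin n → Matrix (Fin 2) (Fin 2) ℂ}
    (hM : ∀ j, (M j).conjTranspose * M j = 1) (x y : Qubits n) :
    inner ℂ (tensorOp M x) (tensorOp M y) = inner ℂ x y := by
  have h : star (tensorOp M) * tensorOp M = 1 := by
    rw [tensorOp, ← map_star, ← map_mul, Matrix.star_eq_conjTranspose,
      tensorMatrix_conjTranspose, tensorMatrix_mul]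
    simp [hM, tensorMatrix_one]
  rw [← ContinuousLinearMap.adjoint_inner_right, ← ContinuousLinearMap.star_eq_adjoint,
    ← mul_apply_eq_comp, h]
  rfl

/-- For `n = 0` both logical labels are the empty string and the second register could not store the
handedness. -/
lemma logical_injective (hn : 0 < n) : Function.Injective (logical n) :=
  fun _ _ h => congrFun h ⟨0, hn⟩

lemma logicalProj_ket (hn : 0 < n) (b c : Fin 2) :
    logicalProj n b (ket (logical n c)) = if b = c then ket (logical n c) else 0 := by
  rw [logicalProj, toEuclideanCLM_ket]
  split_ifs with h
  · subst h
    simp [Matrix.single_apply]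
  · have : logical n b ≠ logical n c := fun e => h (logical_injective hn e)
    simp [this]

lemma logicalZ_ket (hn : 0 < n) (b : Fin 2) :
    logicalZ n (ket (logical n b)) = (-1 : ℂ) ^ (b : ℕ) • ket (logical n b) := by
  rw [logicalZ, sub_apply, logicalProj_ket hn, logicalProj_ket hn]
  fin_cases b <;> simp

/-- Sums over a basis and its complex conjugate do not depend on the basis. -/
lemma sum_bilin_conj {G : Type*} [AddCommGroup G] [Module ℂ G]
    (β : Qubits n →ₗ[ℂ] Qubits n →ₗ[ℂ] G) {u : Matrix (Fin 2) (Fin 2) ℂ}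
    (hu : u * u.conjTranspose = 1) :
    ∑ z, β (tensorOp (fun _ => u.map (starRingEnd ℂ)) (ket z)) (tensorOp (fun _ => u) (ket z))
      = ∑ z, β (ket z) (ket z) := by
  have h : ∀ x y, ∑ z, tensorMatrix (fun _ : Fin n => u.map (starRingEnd ℂ)) x z
      * tensorMatrix (fun _ : Fin n => u) y z = if x = y then 1 else 0 := by
    intro x y
    -- The entries of `U U† = 1` are exactly the sums of products of `U` with its entrywise
    -- conjugate.
    have e : tensorMatrix (fun _ : Fin n => u) * (tensorMatrix fun _ : Fin n => u).conjTranspose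
        = 1 := by
      rw [tensorMatrix_conjTranspose, tensorMatrix_mul]
      simp [hu, tensorMatrix_one]
    have e' := congrFun (congrFun e y) x
    rw [Matrix.mul_apply, Matrix.one_apply] at e'
    simp only [eq_comm (a := x)]
    rw [← e']
    refine Finset.sum_congr rfl fun z _ => ?_
    rw [mul_comm]
    simp [tensorMatrix, Matrix.conjTranspose_apply]
  simp only [tensorOp_ket, map_sum, map_smul, LinearMap.sum_apply, LinearMap.smul_apply,
    Finset.smul_sum, smul_smul]
  rw [Finset.sum_comm]
  refine (Finset.sum_congr rfl fun x _ => Finset.sum_comm).trans ?_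
  simp only [← Finset.sum_smul, mul_comm (tensorMatrix (fun _ => u) _ _), h]
  simp

end qubits

/-! ### The frame of the swap gadget -/

/-- The columns are the images of the computational basis of the swap gadget in the reference
frame, for each handedness. -/
def swapFrame (b : Fin 2) : Matrix (Fin 2) (Fin 2) ℂ :=
  ((√2 : ℝ) : ℂ)⁻¹ • !![1, Complex.I; (-1) ^ (b : ℕ) * Complex.I, (-1) ^ (b : ℕ)]

lemma conj_inv_sqrt_two : (starRingEnd ℂ) (((√2 : ℝ) : ℂ)⁻¹) = ((√2 : ℝ) : ℂ)⁻¹ := by simp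

lemma swapFrame_unitary (b : Fin 2) :
    (swapFrame b).conjTranspose * swapFrame b = 1 ∧
      swapFrame b * (swapFrame b).conjTranspose = 1 := by
  have h := inv_sqrt_two_mul_self
  have hc := conj_inv_sqrt_two
  have hI := Complex.I_mul_I
  unfold swapFrame
  generalize ((√2 : ℝ) : ℂ)⁻¹ = c at h hc
  constructor <;> ext i j <;> fin_cases b <;> fin_cases i <;> fin_cases j <;>
    simp [Matrix.mul_apply, Fin.sum_univ_two, hc] <;> grind

lemma swapFrame_conj_unitary (b : Fin 2) :
    ((swapFrame b).map (starRingEnd ℂ)).conjTranspose * (swapFrame b).map (starRingEnd ℂ) = 1 := by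
  have h := congrArg (fun M : Matrix (Fin 2) (Fin 2) ℂ => M.map (starRingEnd ℂ))
    (swapFrame_unitary b).1
  simp only [Matrix.map_mul] at h
  rw [Matrix.map_one _ (map_zero _) (map_one _)] at h
  rw [← h]
  rfl

/-- The columns of the frame are eigenvectors of σ_y, with eigenvalues `(-1)^b` and `-(-1)^b`. For
σ_x and σ_y the sign of the handedness is thus absorbed by the frame. For σ_z no sign appears, and
the logical σ_z of the second register has to supply it. -/
lemma pauli_mul_swapFrame (b : Fin 2) :
    pauli 0 * swapFrame b = (-1 : ℂ) ^ (b : ℕ) • (swapFrame b * swapPauli 0) ∧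
    pauli 1 * swapFrame b = (-1 : ℂ) ^ (b : ℕ) • (swapFrame b * swapPauli 1) ∧
    pauli 2 * swapFrame b = swapFrame b * swapPauli 2 := by
  have hI := Complex.I_mul_I
  unfold swapFrame
  generalize ((√2 : ℝ) : ℂ)⁻¹ = c
  refine ⟨?_, ?_, ?_⟩ <;> ext i j <;> fin_cases b <;> fin_cases i <;> fin_cases j <;>
    simp [Matrix.mul_apply, Fin.sum_univ_two, pauli, swapPauli] <;> grind

/-! ### The swap isometry -/

section swap

variable {n : ℕ} {A B K : Type*} [NormedAddCommGroup A] [InnerProductSpace ℂ A]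
  [NormedAddCommGroup B] [InnerProductSpace ℂ B] [NormedAddCommGroup K] [InnerProductSpace ℂ K]

lemma norm_sq_sum_tmul {κ : Type*} [Fintype κ] {k : κ → K} (hk : Orthonormal ℂ k) (x : κ → A) :
    ‖∑ i, x i ⊗ₜ[ℂ] k i‖ ^ 2 = ∑ i, ‖x i‖ ^ 2 := by
  classical
  have : (inner ℂ (∑ i, x i ⊗ₜ[ℂ] k i) (∑ i, x i ⊗ₜ[ℂ] k i)) = ∑ i, inner ℂ (x i) (x i) := by
    simp only [sum_inner, inner_sum, TensorProduct.inner_tmul, orthonormal_iff_ite.1 hk]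
    simp
  rw [← inner_self_eq_norm_sq (𝕜 := ℂ), this, map_sum]
  simp only [inner_self_eq_norm_sq]

/-- The parallelogram law suffices, so `u` need not be a reflection. This matters because Bob's
words are norm preserving but square to one only in the quotient algebra or on part of it. -/
lemma norm_sq_flagPart {u : A →L[ℂ] A} (hu : ∀ x, ‖u x‖ = ‖x‖) (x : A) :
    ∑ b, ‖flagPart u b x‖ ^ 2 = ‖x‖ ^ 2 := by
  have h := parallelogram_law_with_norm ℂ x (u x)
  rw [hu] at h
  rw [Fin.sum_univ_two]
  have h0 : flagPart u 0 x = (1 / 2 : ℂ) • (x + u x) := rfl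
  have h1 : flagPart u 1 x = (1 / 2 : ℂ) • (x - u x) := rfl
  rw [h0, h1, norm_smul, norm_smul]
  norm_num
  nlinarith

lemma norm_sq_swapPart {c d : A →L[ℂ] A} (hc : ∀ x, ‖c x‖ = ‖x‖) (hd : ∀ x, ‖d x‖ = ‖x‖)
    (x : A) : ∑ z, ‖swapPart c d z x‖ ^ 2 = ‖x‖ ^ 2 := by
  rw [← norm_sq_flagPart hc x, Fin.sum_univ_two, Fin.sum_univ_two]
  have h0 : swapPart c d 0 x = flagPart c 0 x := rfl
  have h1 : swapPart c d 1 x = d (flagPart c 1 x) := rfl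
  rw [h0, h1, hd]

/-- The gadget at position `0` is applied last, so its two outcomes can be summed first, without
changing the total squared norm. -/
lemma norm_sq_swapWord {c d : Fin n → A →L[ℂ] A} (hc : ∀ j x, ‖c j x‖ = ‖x‖)
    (hd : ∀ j x, ‖d j x‖ = ‖x‖) (x : A) : ∑ z, ‖swapWord c d z x‖ ^ 2 = ‖x‖ ^ 2 := by
  induction n with
  | zero => simp [swapWord]
  | succ n ih =>
    rw [← (Fin.consEquiv fun _ => Fin 2).sum_comp, Fintype.sum_prod_type, Finset.sum_comm,
      ← ih (c := fun j => c j.succ) (d := fun j => d j.succ) (fun j => hc _) (fun j => hd _)]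
    refine Finset.sum_congr rfl fun z _ => ?_
    rw [← norm_sq_swapPart (hc 0) (hd 0)]
    simp [swapWord, List.ofFn_succ, Fin.consEquiv]

/-- The map `a ↦ a ⊗ k`. -/
def attachVec (k : K) : A →L[ℂ] A ⊗[ℂ] K := (TensorProduct.mkL ℂ A K).flip k

lemma attachVec_apply (k : K) (a : A) : attachVec k a = a ⊗ₜ[ℂ] k := rfl

/-- The vector of the registers that labels a component of the swapped state. -/
def frameVec (u : Fin 2 → Matrix (Fin 2) (Fin 2) ℂ) (b : Fin 2) (z : Fin n → Fin 2) :
    Qubits n ⊗[ℂ] Qubits n :=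
  tensorOp (fun _ => u b) (ket z) ⊗ₜ[ℂ] ket (logical n b)

/-- The swap map with sign operators `c`, flips `d` and handedness `f`. -/
def swapMap (u : Fin 2 → Matrix (Fin 2) (Fin 2) ℂ) (c d : Fin n → A →L[ℂ] A) (f : A →L[ℂ] A) :
    A →L[ℂ] WithAncillas n A :=
  ∑ k : Fin 2 × (Fin n → Fin 2),
    attachVec (frameVec u k.1 k.2) ∘L (flagPart f k.1 * swapWord c d k.2)

lemma orthonormal_frameVec (hn : 0 < n) {u : Fin 2 → Matrix (Fin 2) (Fin 2) ℂ}
    (hu : ∀ b, (u b).conjTranspose * u b = 1) :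
    Orthonormal ℂ fun k : Fin 2 × (Fin n → Fin 2) => frameVec u k.1 k.2 := by
  rw [orthonormal_iff_ite]
  rintro ⟨b, z⟩ ⟨b', z'⟩
  simp only [frameVec, TensorProduct.inner_tmul, inner_ket, (logical_injective hn).eq_iff,
    Prod.mk.injEq]
  by_cases hb : b = b'
  · subst hb
    simp [inner_tensorOp fun _ => hu b, inner_ket]
  · simp [hb]

lemma norm_swapMap (hn : 0 < n) {u : Fin 2 → Matrix (Fin 2) (Fin 2) ℂ}
    (hu : ∀ b, (u b).conjTranspose * u b = 1) {c d : Fin n → A →L[ℂ] A} {f : A →L[ℂ] A}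
    (hc : ∀ j x, ‖c j x‖ = ‖x‖) (hd : ∀ j x, ‖d j x‖ = ‖x‖) (hf : ∀ x, ‖f x‖ = ‖x‖) (x : A) :
    ‖swapMap u c d f x‖ = ‖x‖ := by
  have h := norm_sq_sum_tmul (orthonormal_frameVec hn hu)
    fun k : Fin 2 × (Fin n → Fin 2) => flagPart f k.1 (swapWord c d k.2 x)
  rw [Fintype.sum_prod_type (f := fun k : Fin 2 × (Fin n → Fin 2) => ‖_‖ ^ 2),
    Finset.sum_comm] at h
  simp only [norm_sq_flagPart hf, norm_sq_swapWord hc hd] at h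
  rw [← sq_eq_sq₀ (norm_nonneg _) (norm_nonneg _), ← h]
  simp [swapMap, attachVec_apply]

/-- The swap isometry. -/
def swapIsom (hn : 0 < n) {u : Fin 2 → Matrix (Fin 2) (Fin 2) ℂ}
    (hu : ∀ b, (u b).conjTranspose * u b = 1) {c d : Fin n → A →L[ℂ] A} {f : A →L[ℂ] A}
    (hc : ∀ j x, ‖c j x‖ = ‖x‖) (hd : ∀ j x, ‖d j x‖ = ‖x‖) (hf : ∀ x, ‖f x‖ = ‖x‖) :
    A →ₗᵢ[ℂ] WithAncillas n A :=
  ⟨(swapMap u c d f : A →ₗ[ℂ] WithAncillas n A), norm_swapMap hn hu hc hd hf⟩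

/-! ### Reference states -/

section registers

variable {L K₁ L₁ : Type*} [NormedAddCommGroup L] [InnerProductSpace ℂ L]
  [NormedAddCommGroup K₁] [InnerProductSpace ℂ K₁] [NormedAddCommGroup L₁] [InnerProductSpace ℂ L₁]

/-- The embedding of `A ⊗ B` with the registers in the state `k ⊗ l`. -/
def registers (k : K) (l : L) : A ⊗ₕ B →L[ℂ] (A ⊗[ℂ] K) ⊗ₕ (B ⊗[ℂ] L) :=
  hmap (attachVec k) (attachVec l)

lemma attachVec_add (k k' : K) : attachVec (A := A) (k + k') = attachVec k + attachVec k' :=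
  map_add _ _ _

lemma attachVec_smul (c : ℂ) (k : K) : attachVec (A := A) (c • k) = c • attachVec k :=
  map_smul _ _ _

/-- The vector with registers in the state `k ⊗ l`, as a bilinear map. -/
def registersBilin (x : A ⊗ₕ B) : K →ₗ[ℂ] L →ₗ[ℂ] (A ⊗[ℂ] K) ⊗ₕ (B ⊗[ℂ] L) :=
  LinearMap.mk₂ ℂ (fun k l => registers k l x)
    (fun k k' l => by simp only [registers, attachVec_add, hmap_add_left, add_apply])
    (fun c k l => by simp only [registers, attachVec_smul, hmap_smul_left, smul_apply])
    (fun k l l' => by simp only [registers, attachVec_add, hmap_add_right, add_apply])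
    (fun c k l => by simp only [registers, attachVec_smul, hmap_smul_right, smul_apply])

lemma registersBilin_apply (x : A ⊗ₕ B) (k : K) (l : L) :
    registersBilin x k l = registers k l x := rfl

lemma hmap_id_mapL_registers (T : L →L[ℂ] L) (k : K) (l : L) (x : A ⊗ₕ B) :
    hmap (.id ℂ (A ⊗[ℂ] K)) (TensorProduct.mapL (.id ℂ B) T) (registers k l x)
      = registers k (T l) x := by
  rw [registers, hmap_hmap, registers]
  congr 1

lemma inner_registers (k k' : K) (l l' : L) (x y : A ⊗ₕ B) :
    inner ℂ (registers k l x) (registers k' l' y)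
      = inner ℂ k k' * inner ℂ l l' * inner ℂ x y := by
  have h := inner_hmap_congr (f := attachVec (A := A) k) (f' := attachVec k')
    (h := .id ℂ A) (h' := (inner ℂ k k') • .id ℂ A)
    (g := attachVec (A := B) l) (g' := attachVec l') (k := .id ℂ B)
    (k' := (inner ℂ l l') • .id ℂ B)
    (fun a a' => by simp [attachVec_apply, mul_comm])
    (fun a a' => by simp [attachVec_apply, mul_comm]) x y
  rw [registers, registers, h, hmap_smul_left, hmap_smul_right, hmap_id_id]
  simp [inner_smul_right, mul_assoc]

lemma hmap_sum_attachVec {κ μ : Type*} [Fintype κ] [Fintype μ] (k : κ → K) (l : μ → L)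
    (S : κ → A →L[ℂ] A) (T : μ → B →L[ℂ] B) :
    hmap (∑ i, attachVec (k i) ∘L S i) (∑ j, attachVec (l j) ∘L T j)
      = ∑ i, ∑ j, registers (k i) (l j) ∘L hmap (S i) (T j) := by
  simp only [hmap_sum_left, hmap_sum_right, registers, hmap_comp]
  rw [Finset.sum_comm]

lemma sum_registers_conj (x : A ⊗ₕ B) (k : K₁) (l : L₁) {u : Matrix (Fin 2) (Fin 2) ℂ}
    (hu : u * u.conjTranspose = 1) :
    ∑ z : Fin n → Fin 2, registers (tensorOp (fun _ => u.map (starRingEnd ℂ)) (ket z) ⊗ₜ[ℂ] k)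
        (tensorOp (fun _ => u) (ket z) ⊗ₜ[ℂ] l) x
      = ∑ z : Fin n → Fin 2, registers (ket z ⊗ₜ[ℂ] k) (ket z ⊗ₜ[ℂ] l) x :=
  sum_bilin_conj ((registersBilin x).compl₁₂ ((TensorProduct.mk ℂ (Qubits n) K₁).flip k)
    ((TensorProduct.mk ℂ (Qubits n) L₁).flip l)) hu

end registers

lemma onBob_registers (T : (Qubits n ⊗[ℂ] Qubits n) →L[ℂ] (Qubits n ⊗[ℂ] Qubits n))
    (k l : Qubits n ⊗[ℂ] Qubits n) (x : A ⊗ₕ B) :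
    onBob (A := A) (B := B) T (registers k l x) = registers k (T l) x :=
  hmap_id_mapL_registers T k l x

lemma prod_bell (z w : Fin n → Fin 2) :
    ∏ j, bell (z j) (w j) = if z = w then (((√2 : ℝ) : ℂ)⁻¹) ^ n else 0 := by
  simp only [bell, Finset.prod_ite_zero, Finset.mem_univ, true_imp_iff, funext_iff]
  simp

lemma refState_eq (ξ : Fin 2 → A ⊗ₕ B) :
    refState (n := n) ξ = ∑ b, ∑ z, (((√2 : ℝ) : ℂ)⁻¹) ^ n •
      registers (A := A) (B := B) (ket z ⊗ₜ ket (logical n b)) (ket z ⊗ₜ ket (logical n b)) (ξ b) := by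
  simp only [refState, prod_bell, ite_smul, zero_smul, Finset.sum_ite_eq, Finset.mem_univ, if_true]
  rw [Finset.sum_comm]
  simp only [← Finset.smul_sum]
  rfl

/-- Bell pairs are invariant under `ū ⊗ u` for unitary `u`. Alice's frame is therefore the entrywise
conjugate of Bob's, separately for each handedness `b`. -/
lemma refState_eq_frame (ξ : Fin 2 → A ⊗ₕ B) :
    refState (n := n) ξ = ∑ b, ∑ z, (((√2 : ℝ) : ℂ)⁻¹) ^ n •
      registers (A := A) (B := B) (frameVec (fun b => (swapFrame b).map (starRingEnd ℂ)) b z)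
        (frameVec swapFrame b z) (ξ b) := by
  rw [refState_eq]
  refine Finset.sum_congr rfl fun b _ => ?_
  rw [← Finset.smul_sum, ← Finset.smul_sum]
  exact congrArg _ (sum_registers_conj _ _ _ (swapFrame_unitary b).2).symm

lemma norm_sq_refState (hn : 0 < n) (ξ : Fin 2 → A ⊗ₕ B) :
    ‖refState (n := n) ξ‖ ^ 2 = ‖ξ 0‖ ^ 2 + ‖ξ 1‖ ^ 2 := by
  have h : inner ℂ (refState (n := n) ξ) (refState ξ) = ∑ b, inner ℂ (ξ b) (ξ b) := by
    simp only [refState_eq, ← Finset.smul_sum, inner_smul_left, inner_smul_right, sum_inner,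
      inner_sum, inner_registers, TensorProduct.inner_tmul, inner_ket,
      (logical_injective hn).eq_iff]
    have hs : (((√2 : ℝ) : ℂ)⁻¹) ^ n * (((√2 : ℝ) : ℂ)⁻¹) ^ n * 2 ^ n = 1 := by
      rw [← mul_pow, ← mul_pow, inv_sqrt_two_mul_self]; norm_num
    simp [ite_mul, mul_ite, -inner_self_eq_norm_sq_to_K]
    linear_combination (inner ℂ (ξ 0) (ξ 0) + inner ℂ (ξ 1) (ξ 1)) * hs
  rw [← inner_self_eq_norm_sq (𝕜 := ℂ), h, map_sum]
  simp only [inner_self_eq_norm_sq, Fin.sum_univ_two]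

lemma refState_smul (c : ℂ) (ξ : Fin 2 → A ⊗ₕ B) :
    refState (n := n) (c • ξ) = c • refState ξ := by
  simp only [refState_eq, Finset.smul_sum, Pi.smul_apply, map_smul]
  simp only [smul_comm c]

lemma localIsom_swapIsom (hn : 0 < n) {u v : Fin 2 → Matrix (Fin 2) (Fin 2) ℂ}
    (hu : ∀ b, (u b).conjTranspose * u b = 1) {c d : Fin n → A →L[ℂ] A} {f : A →L[ℂ] A}
    (hc : ∀ j x, ‖c j x‖ = ‖x‖) (hd : ∀ j x, ‖d j x‖ = ‖x‖) (hf : ∀ x, ‖f x‖ = ‖x‖)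
    (hv : ∀ b, (v b).conjTranspose * v b = 1) {c' d' : Fin n → B →L[ℂ] B} {f' : B →L[ℂ] B}
    (hc' : ∀ j x, ‖c' j x‖ = ‖x‖) (hd' : ∀ j x, ‖d' j x‖ = ‖x‖) (hf' : ∀ x, ‖f' x‖ = ‖x‖) :
    localIsom (swapIsom hn hu hc hd hf) (swapIsom hn hv hc' hd' hf')
      = ∑ k : Fin 2 × (Fin n → Fin 2), ∑ l : Fin 2 × (Fin n → Fin 2),
        registers (A := A) (B := B) (frameVec u k.1 k.2) (frameVec v l.1 l.2) ∘L
          hmap (flagPart f k.1 * swapWord c d k.2) (flagPart f' l.1 * swapWord c' d' l.2) :=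
  hmap_sum_attachVec _ _ _ _

end swap

/-! ### Reference operators in the frame of the swap gadget -/

section reference

variable {n : ℕ}

lemma tensorMatrix_ite_add (k : Fin n) (M N : Matrix (Fin 2) (Fin 2) ℂ)
    (u : Fin n → Matrix (Fin 2) (Fin 2) ℂ) :
    tensorMatrix (fun j => if j = k then M + N else u j)
      = tensorMatrix (fun j => if j = k then M else u j)
        + tensorMatrix (fun j => if j = k then N else u j) := by
  ext z w
  simp only [tensorMatrix, Matrix.of_apply, Matrix.add_apply]
  simp only [← Finset.mul_prod_erase _ _ (Finset.mem_univ k), if_true, Matrix.add_apply, add_mul]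
  congr 2 <;> refine Finset.prod_congr rfl fun j hj => ?_ <;>
    simp [Finset.ne_of_mem_erase hj]

lemma tensorMatrix_ite_smul (k : Fin n) (s : ℂ) (M : Matrix (Fin 2) (Fin 2) ℂ)
    (u : Fin n → Matrix (Fin 2) (Fin 2) ℂ) :
    tensorMatrix (fun j => if j = k then s • M else u j)
      = s • tensorMatrix (fun j => if j = k then M else u j) := by
  ext z w
  simp only [tensorMatrix, Matrix.of_apply, Matrix.smul_apply]
  simp only [← Finset.mul_prod_erase _ _ (Finset.mem_univ k), if_true, Matrix.smul_apply,
    smul_eq_mul, mul_assoc]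
  congr 2
  refine Finset.prod_congr rfl fun j hj => ?_
  simp [Finset.ne_of_mem_erase hj]

lemma siteOp_add (k : Fin n) (M N : Matrix (Fin 2) (Fin 2) ℂ) :
    siteOp k (M + N) = siteOp k M + siteOp k N := by
  simp only [siteOp, tensorOp, tensorMatrix_ite_add, map_add]

lemma siteOp_smul (k : Fin n) (s : ℂ) (M : Matrix (Fin 2) (Fin 2) ℂ) :
    siteOp k (s • M) = s • siteOp k M := by
  simp only [siteOp, tensorOp, tensorMatrix_ite_smul, map_smul]

lemma siteOp_mul_tensorOp (k : Fin n) {s : ℂ} {M u N : Matrix (Fin 2) (Fin 2) ℂ}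
    (h : M * u = s • (u * N)) :
    siteOp k M * tensorOp (fun _ => u) = s • (tensorOp (fun _ => u) * siteOp k N) := by
  rw [siteOp, tensorOp_mul, siteOp, tensorOp_mul]
  have h1 : (fun j => (if j = k then M else 1) * u) = fun j => if j = k then s • (u * N) else u := by
    funext j; split_ifs <;> simp [h]
  have h2 : (fun j => u * (if j = k then N else 1)) = fun j => if j = k then u * N else u := by
    funext j; split_ifs <;> simp
  rw [h1, h2, tensorOp, tensorMatrix_ite_smul, map_smul]
  rfl

lemma singleRef_frameVec (hn : 0 < n) (k : Fin n) (q : Fin 3) (b : Fin 2) (z : Fin n → Fin 2) :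
    singleRef k (q.castLE (by norm_num)) (frameVec swapFrame b z)
      = ∑ w, ((-1 : ℂ) ^ (b : ℕ) * tensorMatrix (fun j => if j = k then swapPauli q else 1) w z)
        • frameVec swapFrame b w := by
  -- Here `s` is the sign produced by the frame and `t` the sign produced by the second register.
  -- For σ_x and σ_y the pair is `(-1)^b, 1`, for σ_z it is `1, (-1)^b`.
  have key : ∀ {s t : ℂ}, s * t = (-1 : ℂ) ^ (b : ℕ) →
      pauli (q.castLE (by norm_num)) * swapFrame b = s • (swapFrame b * swapPauli q) →
      siteOp k (pauli (q.castLE (by norm_num))) (tensorOp (fun _ => swapFrame b) (ket z)) ⊗ₜ[ℂ]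
        (t • ket (logical n b)) = ∑ w, ((-1 : ℂ) ^ (b : ℕ) *
          tensorMatrix (fun j => if j = k then swapPauli q else 1) w z)
            • frameVec swapFrame b w := by
    intro s t hst h
    rw [← mul_apply_eq_comp, siteOp_mul_tensorOp k h, smul_apply, mul_apply_eq_comp,
      siteOp, tensorOp_ket, map_sum, TensorProduct.smul_tmul_smul, hst, TensorProduct.sum_tmul,
      Finset.smul_sum]
    refine Finset.sum_congr rfl fun w _ => ?_
    rw [map_smul, ← TensorProduct.smul_tmul', smul_smul, frameVec]
  obtain ⟨h0, h1, h2⟩ := pauli_mul_swapFrame b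
  rw [frameVec, singleRef, TensorProduct.mapL_tmul]
  fin_cases q
  · simpa using key (mul_one _) h0
  · simpa using key (mul_one _) h1
  · have := key (one_mul _) (h2.trans (one_smul ℂ _).symm)
    rw [← logicalZ_ket hn] at this
    simpa using this

variable {A B : Type*} [NormedAddCommGroup A] [InnerProductSpace ℂ A]
  [NormedAddCommGroup B] [InnerProductSpace ℂ B]

section registers

variable {K L : Type*} [NormedAddCommGroup K] [InnerProductSpace ℂ K]
  [NormedAddCommGroup L] [InnerProductSpace ℂ L]

lemma hmap_id_mapL_sum_registers {Z : Type*} [Fintype Z] (T : L →L[ℂ] L) (e : Fin 2 → Z → K)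
    (f : Fin 2 → Z → L) (s : Fin 2 → Matrix Z Z ℂ)
    (hT : ∀ b z, T (f b z) = ∑ w, s b w z • f b w) (x : Fin 2 → A ⊗ₕ B) :
    hmap (.id ℂ (A ⊗[ℂ] K)) (TensorProduct.mapL (.id ℂ B) T)
        (∑ b, ∑ z, registers (e b z) (f b z) (x b))
      = ∑ k : Fin 2 × Z, ∑ l : Fin 2 × Z, registers (e k.1 k.2) (f l.1 l.2)
          (if k.1 = l.1 then s k.1 l.2 k.2 • x k.1 else 0) := by
  rw [Fintype.sum_prod_type]
  simp only [map_sum]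
  refine Finset.sum_congr rfl fun b _ => Finset.sum_congr rfl fun z _ => ?_
  rw [hmap_id_mapL_registers, hT, ← registersBilin_apply, map_sum, Fintype.sum_prod_type,
    Finset.sum_eq_single b]
  · simp [registersBilin_apply]
  · intro b' _ hb'
    simp [hb'.symm]
  · simp

lemma norm_attachVec_le (k : K) : ‖attachVec (A := A) k‖ ≤ ‖k‖ :=
  ContinuousLinearMap.opNorm_le_bound _ (norm_nonneg _) fun a => by
    rw [attachVec_apply, TensorProduct.norm_tmul, mul_comm]

lemma norm_registers_le (k : K) (l : L) : ‖registers (A := A) (B := B) k l‖ ≤ ‖k‖ * ‖l‖ :=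
  (norm_hmap_le _ _).trans (mul_le_mul (norm_attachVec_le k) (norm_attachVec_le l)
    (norm_nonneg _) (norm_nonneg _))

end registers

/-- The factor `√2 ^ n` compensates the normalization of the `n` Bell states, since all diagonal
components of the swapped state have coefficient one. -/
lemma refState_smul_eq (x : Fin 2 → A ⊗ₕ B) :
    refState (n := n) (((√2 : ℝ) : ℂ) ^ n • x) = ∑ b, ∑ z : Fin n → Fin 2,
      registers (A := A) (B := B) (frameVec (fun b => (swapFrame b).map (starRingEnd ℂ)) b z)
        (frameVec swapFrame b z) (x b) := by
  have h2 : ((√2 : ℝ) : ℂ) ^ n * (((√2 : ℝ) : ℂ)⁻¹) ^ n = 1 := by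
    rw [← mul_pow, mul_inv_cancel₀ (by simp), one_pow]
  rw [refState_smul, refState_eq_frame, Finset.smul_sum]
  refine Finset.sum_congr rfl fun b _ => ?_
  rw [Finset.smul_sum]
  refine Finset.sum_congr rfl fun z _ => ?_
  rw [smul_smul, h2, one_smul]

lemma onBob_refState_eq (T : (Qubits n ⊗[ℂ] Qubits n) →L[ℂ] (Qubits n ⊗[ℂ] Qubits n))
    (s : Fin 2 → Matrix (Fin n → Fin 2) (Fin n → Fin 2) ℂ)
    (hT : ∀ b z, T (frameVec swapFrame b z) = ∑ w, s b w z • frameVec swapFrame b w)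
    (x : Fin 2 → A ⊗ₕ B) :
    onBob (A := A) (B := B) T (refState (n := n) (((√2 : ℝ) : ℂ) ^ n • x))
      = ∑ k : Fin 2 × (Fin n → Fin 2), ∑ l : Fin 2 × (Fin n → Fin 2),
        registers (A := A) (B := B) (frameVec (fun b => (swapFrame b).map (starRingEnd ℂ)) k.1 k.2)
          (frameVec swapFrame l.1 l.2) (if k.1 = l.1 then s k.1 l.2 k.2 • x k.1 else 0) := by
  rw [refState_smul_eq]
  exact hmap_id_mapL_sum_registers T _ _ s hT x

end reference

/-! ### The swap isometry on mirrored families -/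

section mirrored

variable {ι : Type*} {A B : ι → Type*} [∀ i, NormedAddCommGroup (A i)]
  [∀ i, InnerProductSpace ℂ (A i)] [∀ i, NormedAddCommGroup (B i)]
  [∀ i, InnerProductSpace ℂ (B i)] {ψ : ∀ i, A i ⊗ₕ B i} {η : ι → ℝ} {n : ℕ}

/-- Alice's observables `a` and Bob's reflections `D`, all preserving norms, whose classes are
those of Pauli operators and of their normalized sums and differences. -/
structure SwapData (n : ℕ) (ψ : ∀ i, A i ⊗ₕ B i) (η : ι → ℝ) where
  pos : 0 < n
  p : Fin 3 → Fin n → mirrored ψ η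
  D : Fin 6 → Fin n → mirrored ψ η
  a : Fin 3 → Fin n → ∀ i, A i →L[ℂ] A i
  pauliFamily : PauliFamily fun q j => stateClass (p q j)
  mirror : ∀ q j, Mirror ψ η (a q j) (p q j).1
  class0 : ∀ j, stateClass (D 0 j)
    = ((√2 : ℝ) : ℂ)⁻¹ • (stateClass (p 2 j) + stateClass (p 0 j))
  class1 : ∀ j, stateClass (D 1 j)
    = ((√2 : ℝ) : ℂ)⁻¹ • (stateClass (p 2 j) - stateClass (p 0 j))
  class2 : ∀ j, stateClass (D 2 j)
    = ((√2 : ℝ) : ℂ)⁻¹ • (stateClass (p 2 j) + stateClass (p 1 j))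
  class3 : ∀ j, stateClass (D 3 j)
    = ((√2 : ℝ) : ℂ)⁻¹ • (stateClass (p 2 j) - stateClass (p 1 j))
  class4 : ∀ j, stateClass (D 4 j)
    = ((√2 : ℝ) : ℂ)⁻¹ • (stateClass (p 0 j) + stateClass (p 1 j))
  norm_a : ∀ q j i x, ‖a q j i x‖ = ‖x‖
  norm_D : ∀ y j i x, ‖(D y j).1 i x‖ = ‖x‖

/-- Bob's flag word. -/
def flagWord {R : Type*} [Ring R] [Algebra ℂ R] (D : Fin 6 → R) : R :=
  ((1 + Complex.I) * ((√2 : ℝ) : ℂ)⁻¹) • (D 4 * D 0 * D 2)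

/-- Bob's sign words. -/
def sgnWord {R : Type*} [Ring R] [Algebra ℂ R] (D : Fin 6 → R) : R := Complex.I • (D 0 * D 1)

/-- Bob's flip words. -/
def flipWord {R : Type*} [Ring R] [Algebra ℂ R] (D : Fin 6 → R) : R := -Complex.I • (D 2 * D 3)

lemma flagPart_apply {ι : Type*} {H : ι → Type*} [∀ i, NormedAddCommGroup (H i)]
    [∀ i, InnerProductSpace ℂ (H i)] (u : ∀ i, H i →L[ℂ] H i) (b : Fin 2) (i : ι) :
    flagPart u b i = flagPart (u i) b :=
  map_flagPart (Pi.evalAlgHom ℂ (fun i => H i →L[ℂ] H i) i) u b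

lemma swapWord_apply {ι : Type*} {H : ι → Type*} [∀ i, NormedAddCommGroup (H i)]
    [∀ i, InnerProductSpace ℂ (H i)] {n : ℕ} (c d : Fin n → ∀ i, H i →L[ℂ] H i)
    (z : Fin n → Fin 2) (i : ι) :
    swapWord c d z i = swapWord (fun j => c j i) (fun j => d j i) z :=
  map_swapWord (Pi.evalAlgHom ℂ (fun i => H i →L[ℂ] H i) i) c d z

variable (ψ η) in
/-- Evaluation of mirrored families. -/
def evalMirrored (i : ι) : mirrored ψ η →ₐ[ℂ] (B i →L[ℂ] B i) :=
  (Pi.evalAlgHom ℂ (fun i => B i →L[ℂ] B i) i).comp (mirrored ψ η).val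

lemma evalMirrored_apply (i : ι) (b : mirrored ψ η) : evalMirrored ψ η i b = b.1 i := rfl

section map

variable {R R' : Type*} [Ring R] [Algebra ℂ R] [Ring R'] [Algebra ℂ R'] (φ : R →ₐ[ℂ] R')

lemma map_flagWord (D : Fin 6 → R) : φ (flagWord D) = flagWord fun y => φ (D y) := by
  simp only [flagWord, map_smul, map_mul]

lemma map_sgnWord (D : Fin 6 → R) : φ (sgnWord D) = sgnWord fun y => φ (D y) := by
  simp only [sgnWord, map_smul, map_mul]

lemma map_flipWord (D : Fin 6 → R) : φ (flipWord D) = flipWord fun y => φ (D y) := by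
  simp only [flipWord, map_smul, map_mul]

lemma map_sgnElem {n : ℕ} (p : Fin 3 → Fin n → R) (j : Fin n) :
    φ (PauliFamily.sgnElem p j) = PauliFamily.sgnElem (fun q j => φ (p q j)) j := by
  simp only [PauliFamily.sgnElem, map_smul, map_mul]

lemma map_flipElem {n : ℕ} (p : Fin 3 → Fin n → R) (j : Fin n) :
    φ (PauliFamily.flipElem p j) = PauliFamily.flipElem (fun q j => φ (p q j)) j := by
  simp only [PauliFamily.flipElem, map_smul, map_mul]

lemma map_handElem {n : ℕ} (p : Fin 3 → Fin n → R) (j : Fin n) :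
    φ (PauliFamily.handElem p j) = PauliFamily.handElem (fun q j => φ (p q j)) j := by
  simp only [PauliFamily.handElem, map_smul, map_mul]

end map

section norms

variable {H : Type*} [NormedAddCommGroup H] [InnerProductSpace ℂ H] {D : Fin 6 → H →L[ℂ] H}
  (hD : ∀ y x, ‖D y x‖ = ‖x‖)

include hD

lemma norm_flagWord (x : H) : ‖flagWord D x‖ = ‖x‖ := by
  have h : ‖(1 + Complex.I) * ((√2 : ℝ) : ℂ)⁻¹‖ = 1 := by
    rw [norm_mul, norm_inv, Complex.norm_real, Real.norm_of_nonneg (Real.sqrt_nonneg 2),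
      Complex.norm_def]
    simp [Complex.normSq]
    norm_num
  rw [flagWord, smul_apply, norm_smul, h, one_mul, mul_apply_eq_comp, mul_apply_eq_comp, hD, hD, hD]

lemma norm_sgnWord (x : H) : ‖sgnWord D x‖ = ‖x‖ := by
  rw [sgnWord, smul_apply, norm_smul, Complex.norm_I, one_mul, mul_apply_eq_comp, hD, hD]

lemma norm_flipWord (x : H) : ‖flipWord D x‖ = ‖x‖ := by
  rw [flipWord, smul_apply, norm_smul, norm_neg, Complex.norm_I, one_mul, mul_apply_eq_comp, hD, hD]

end norms

/-! ### The swap isometries of both parties and their component expansion -/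

namespace SwapData

variable (s : SwapData n ψ η)

/-- Bob's isometry. -/
def isomB (i : ι) : B i →ₗᵢ[ℂ] WithAncillas n (B i) :=
  swapIsom s.pos (u := swapFrame) (fun b => (swapFrame_unitary b).1)
    (c := fun j => sgnWord fun y => (s.D y j).1 i) (d := fun j => flipWord fun y => (s.D y j).1 i)
    (f := flagWord fun y => (s.D y ⟨0, s.pos⟩).1 i)
    (fun j => norm_sgnWord fun y => s.norm_D y j i) (fun j => norm_flipWord fun y => s.norm_D y j i)
    (norm_flagWord fun y => s.norm_D y _ i)

/-- Alice's sign word. -/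
def sgnA (j : Fin n) : ∀ i, A i →L[ℂ] A i := Complex.I • (s.a 2 j * s.a 0 j)

/-- Alice's flip word. -/
def flipA (j : Fin n) : ∀ i, A i →L[ℂ] A i := -Complex.I • (s.a 2 j * s.a 1 j)

/-- Alice's flag word. -/
def flagA : ∀ i, A i →L[ℂ] A i :=
  -Complex.I • (s.a 2 ⟨0, s.pos⟩ * (s.a 1 ⟨0, s.pos⟩ * s.a 0 ⟨0, s.pos⟩))

lemma norm_sgnA (j : Fin n) (i : ι) (x : A i) : ‖s.sgnA j i x‖ = ‖x‖ := by
  simp [sgnA, norm_smul, s.norm_a]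

lemma norm_flipA (j : Fin n) (i : ι) (x : A i) : ‖s.flipA j i x‖ = ‖x‖ := by
  simp [flipA, norm_smul, s.norm_a]

lemma norm_flagA (i : ι) (x : A i) : ‖s.flagA i x‖ = ‖x‖ := by
  simp [flagA, norm_smul, s.norm_a]

/-- Alice's isometry. -/
def isomA (i : ι) : A i →ₗᵢ[ℂ] WithAncillas n (A i) :=
  swapIsom s.pos (u := fun b => (swapFrame b).map (starRingEnd ℂ)) swapFrame_conj_unitary
    (c := fun j => s.sgnA j i) (d := fun j => s.flipA j i) (f := s.flagA i)
    (fun j => s.norm_sgnA j i) (fun j => s.norm_flipA j i) (s.norm_flagA i)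

/-- The operator that prepares the junk vectors. -/
def junkOp (b : Fin 2) : mirrored ψ η :=
  flagPart (flagWord fun y => s.D y ⟨0, s.pos⟩) b
    * swapWord (fun j => sgnWord fun y => s.D y j) (fun j => flipWord fun y => s.D y j) 0

/-- The junk vectors, before normalization. -/
def junk (i : ι) (b : Fin 2) : A i ⊗ₕ B i := hmap (.id ℂ _) ((s.junkOp b).1 i) (ψ i)

/-- Alice's words are written in the order opposite to Bob's `i XZ`, to make up for the reversal in
`Mirror.mul`. -/
lemma mirror_sgnA (j : Fin n) :
    Mirror ψ η (s.sgnA j) (PauliFamily.sgnElem s.p j : mirrored ψ η).1 :=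
  ((s.mirror 2 j).mul (s.mirror 0 j)).smul Complex.I

lemma mirror_flipA (j : Fin n) :
    Mirror ψ η (s.flipA j) (PauliFamily.flipElem s.p j : mirrored ψ η).1 :=
  ((s.mirror 2 j).mul (s.mirror 1 j)).smul (-Complex.I)

lemma mirror_flagA :
    Mirror ψ η s.flagA (PauliFamily.handElem s.p ⟨0, s.pos⟩ : mirrored ψ η).1 :=
  ((s.mirror 2 _).mul ((s.mirror 1 _).mul (s.mirror 0 _))).smul (-Complex.I)

lemma mirror_word (b : Fin 2) (z : Fin n → Fin 2) :
    Mirror ψ η (flagPart s.flagA b * swapWord s.sgnA s.flipA z)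
      (swapWordRev (PauliFamily.sgnElem s.p) (PauliFamily.flipElem s.p) z
        * flagPart (PauliFamily.handElem s.p ⟨0, s.pos⟩) b : mirrored ψ η).1 := by
  have h := (s.mirror_flagA.flagPart b).mul
    (Mirror.swapWord s.mirror_sgnA s.mirror_flipA z)
  have e1 := map_swapWordRev (mirrored ψ η).val (PauliFamily.sgnElem s.p)
    (PauliFamily.flipElem s.p) z
  have e2 := map_flagPart (mirrored ψ η).val (PauliFamily.handElem s.p ⟨0, s.pos⟩) b
  change Mirror ψ η _ ((mirrored ψ η).val _ * (mirrored ψ η).val _)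
  rw [e1, e2]
  exact h

/-- Reduces certification to algebra. Each component of the swapped vector is a word of Alice tensor
a word of Bob times `T`, applied to `ψ`. Moving Alice's word to the right end of Bob's yields the
product in `h`. There are finitely many components and the register maps are uniformly bounded, so
the errors add up to a small family. -/
lemma localIsom_sub_mem_smallFam (T : mirrored ψ η)
    (t : Fin 2 → Matrix (Fin n → Fin 2) (Fin n → Fin 2) ℂ)
    (h : ∀ b b' w z, stateClass (flagPart (flagWord fun y => s.D y ⟨0, s.pos⟩) b'
        * swapWord (fun j => sgnWord fun y => s.D y j) (fun j => flipWord fun y => s.D y j) w * T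
        * (swapWordRev (PauliFamily.sgnElem s.p) (PauliFamily.flipElem s.p) z
          * flagPart (PauliFamily.handElem s.p ⟨0, s.pos⟩) b))
      = if b = b' then t b w z • stateClass (s.junkOp b) else 0) :
    (fun i => localIsom (s.isomA i) (s.isomB i) (hmap (.id ℂ _) (T.1 i) (ψ i))
      - ∑ k : Fin 2 × (Fin n → Fin 2), ∑ l : Fin 2 × (Fin n → Fin 2),
        registers (A := A i) (B := B i)
          (frameVec (fun b => (swapFrame b).map (starRingEnd ℂ)) k.1 k.2)
          (frameVec swapFrame l.1 l.2) (if k.1 = l.1 then t k.1 l.2 k.2 • s.junk i k.1 else 0)) ∈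
      smallFam (fun i => WithAncillas n (A i) ⊗ₕ WithAncillas n (B i)) η := by
  have key : ∀ k l : Fin 2 × (Fin n → Fin 2), (fun i =>
      hmap ((flagPart s.flagA k.1 * swapWord s.sgnA s.flipA k.2) i)
        ((flagPart (flagWord fun y => s.D y ⟨0, s.pos⟩) l.1
          * swapWord (fun j => sgnWord fun y => s.D y j)
            (fun j => flipWord fun y => s.D y j) l.2 * T : mirrored ψ η).1 i) (ψ i)
      - (if k.1 = l.1 then t k.1 l.2 k.2 • s.junk i k.1 else 0)) ∈
      smallFam (fun i => A i ⊗ₕ B i) η := by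
    intro k l
    have hc := h k.1 l.1 l.2 k.2
    split_ifs at hc ⊢ with hkl
    · exact hmap_sub_mem_smallFam (s.mirror_word k.1 k.2) hc
    -- Components with different flags vanish; the scalar being zero, the representative `x = 1` is
    -- arbitrary.
    · have := hmap_sub_mem_smallFam (s := 0) (x := 1) (s.mirror_word k.1 k.2)
        (hc.trans (zero_smul _ _).symm)
      simpa using this
  have hsum := Submodule.sum_mem _ fun k (_ : k ∈ Finset.univ) => Submodule.sum_mem _
    fun l (_ : l ∈ Finset.univ) => apply_mem_smallFam
      (K := fun i => WithAncillas n (A i) ⊗ₕ WithAncillas n (B i))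
      (T := fun i => registers (A := A i) (B := B i)
        (frameVec (n := n) (fun b => (swapFrame b).map (starRingEnd ℂ)) k.1 k.2)
          (frameVec swapFrame l.1 l.2)) (mem_boundedFam fun i => norm_registers_le _ _) (key k l)
  convert hsum using 1
  funext i
  simp only [Finset.sum_apply, map_sub, Finset.sum_sub_distrib]
  congr 1
  rw [isomA, isomB, localIsom_swapIsom]
  simp only [sum_apply, ContinuousLinearMap.comp_apply, hmap_hmap]
  refine Finset.sum_congr rfl fun k _ => Finset.sum_congr rfl fun l _ => ?_
  have eA : (flagPart s.flagA k.1 * swapWord s.sgnA s.flipA k.2) i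
      = flagPart (s.flagA i) k.1 * swapWord (fun j => s.sgnA j i) (fun j => s.flipA j i) k.2 := by
    rw [Pi.mul_apply, flagPart_apply, swapWord_apply]
  have eB : (flagPart (flagWord fun y => s.D y ⟨0, s.pos⟩) l.1
        * swapWord (fun j => sgnWord fun y => s.D y j) (fun j => flipWord fun y => s.D y j) l.2 * T
        : mirrored ψ η).1 i
      = flagPart (flagWord fun y => (s.D y ⟨0, s.pos⟩).1 i) l.1
        * swapWord (fun j => sgnWord fun y => (s.D y j).1 i)
          (fun j => flipWord fun y => (s.D y j).1 i) l.2 * T.1 i := by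
    rw [← evalMirrored_apply, map_mul, map_mul, map_flagPart, map_swapWord, map_flagWord]
    simp only [map_sgnWord, map_flipWord, evalMirrored_apply]
  rw [eA, eB]
  rfl

end SwapData

end mirrored

/-! ### Certification of the state and of the Pauli operators by the swap -/

section mirrored

variable {ι : Type*} {A B : ι → Type*} [∀ i, NormedAddCommGroup (A i)]
  [∀ i, InnerProductSpace ℂ (A i)] [∀ i, NormedAddCommGroup (B i)]
  [∀ i, InnerProductSpace ℂ (B i)] {ψ : ∀ i, A i ⊗ₕ B i} {η : ι → ℝ} {n : ℕ}

namespace SwapData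

variable (s : SwapData n ψ η)

lemma stateClass_sgnWord (j : Fin n) : stateClass (sgnWord fun y => s.D y j)
    = PauliFamily.sgnElem (fun q j => stateClass (s.p q j)) j := by
  rw [map_sgnWord, sgnWord, s.class0, s.class1,
    s.pauliFamily.sgnElem_eq inv_sqrt_two_mul_self]

lemma stateClass_flipWord (j : Fin n) : stateClass (flipWord fun y => s.D y j)
    = PauliFamily.flipElem (fun q j => stateClass (s.p q j)) j := by
  rw [map_flipWord, flipWord, s.class2, s.class3,
    s.pauliFamily.flipElem_eq inv_sqrt_two_mul_self]

lemma stateClass_flagWord_mul (j : Fin n) : stateClass (flagWord fun y => s.D y j)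
      * (1 + PauliFamily.sgnElem (fun q j => stateClass (s.p q j)) j)
    = PauliFamily.handElem (fun q j => stateClass (s.p q j)) j
      * (1 + PauliFamily.sgnElem (fun q j => stateClass (s.p q j)) j) := by
  rw [map_flagWord, flagWord, s.class4, s.class0, s.class2,
    s.pauliFamily.flagWord_mul inv_sqrt_two_mul_self]

/-- The junk vectors and the isometries certify the state. -/
lemma state_mem_smallFam : (fun i => localIsom (s.isomA i) (s.isomB i) (ψ i)
      - refState (((√2 : ℝ) : ℂ) ^ n • s.junk i)) ∈
      smallFam (fun i => WithAncillas n (A i) ⊗ₕ WithAncillas n (B i)) η := by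
  have h := s.localIsom_sub_mem_smallFam 1 (fun _ => tensorMatrix fun _ => 1)
    fun b b' w z => by
      rw [mul_one, junkOp]
      simp only [map_mul, map_flagPart, map_swapWord, map_swapWordRev, stateClass_sgnWord,
        stateClass_flipWord, map_sgnElem, map_flipElem, map_handElem]
      exact s.pauliFamily.component_state (s.stateClass_flagWord_mul _) b b' w z
  convert h using 1
  funext i
  have e := onBob_refState_eq (n := n) (.id ℂ _) (fun _ => tensorMatrix fun _ => 1)
    (fun b z => by simp [tensorMatrix_one, Matrix.one_apply]) (s.junk i)
  have e1 : hmap (.id ℂ (A i)) ((1 : mirrored ψ η).1 i) (ψ i) = ψ i :=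
    congrArg (fun T : A i ⊗ₕ B i →L[ℂ] A i ⊗ₕ B i => T (ψ i)) hmap_id_id
  have e2 : onBob (A := A i) (B := B i) (n := n) (.id ℂ _) = .id ℂ _ := by
    rw [onBob, TensorProduct.mapL_id_id, hmap_id_id]
  rw [e2] at e
  rw [e1]
  exact congrArg _ e

/-- The junk vectors and the isometries certify the Pauli operators. -/
lemma pauli_mem_smallFam (q : Fin 3) (k : Fin n) :
    (fun i => localIsom (s.isomA i) (s.isomB i) (hmap (.id ℂ _) ((s.p q k).1 i) (ψ i))
      - onBob (A := A i) (B := B i) (singleRef k (q.castLE (by norm_num)))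
        (refState (((√2 : ℝ) : ℂ) ^ n • s.junk i))) ∈
      smallFam (fun i => WithAncillas n (A i) ⊗ₕ WithAncillas n (B i)) η := by
  have h := s.localIsom_sub_mem_smallFam (s.p q k)
    (fun b => Matrix.of fun w z => (-1 : ℂ) ^ (b : ℕ)
      * tensorMatrix (fun j => if j = k then swapPauli q else 1) w z)
    fun b b' w z => by
      rw [junkOp]
      simp only [map_mul, map_flagPart, map_swapWord, map_swapWordRev, stateClass_sgnWord,
        stateClass_flipWord, map_sgnElem, map_flipElem, map_handElem]
      exact s.pauliFamily.component_pauli (s.stateClass_flagWord_mul _) q k b b' w z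
  convert h using 1
  funext i
  exact congrArg _ (onBob_refState_eq (singleRef k (q.castLE (by norm_num)))
    (fun b => Matrix.of fun w z => (-1 : ℂ) ^ (b : ℕ)
      * tensorMatrix (fun j => if j = k then swapPauli q else 1) w z)
    (fun b z => singleRef_frameVec s.pos k q b z) (s.junk i))

end SwapData

end mirrored

/-! ### Projective measurements -/

section measurements

variable {κ H : Type*} [Fintype κ] [NormedAddCommGroup H] [InnerProductSpace ℂ H]
  [CompleteSpace H]

/-- The observable with the value `f s` for the outcome `s`. -/
def spectralSum (P : κ → H →L[ℂ] H) (f : κ → ℝ) : H →L[ℂ] H := ∑ s, (f s : ℂ) • P s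

namespace IsProjMeas

variable {P : κ → H →L[ℂ] H} (hP : IsProjMeas P)

include hP

lemma spectralSum_mul (f g : κ → ℝ) :
    spectralSum P f * spectralSum P g = spectralSum P (f * g) := by
  classical
  simp only [spectralSum, Finset.sum_mul_sum, smul_mul_smul_comm]
  refine Finset.sum_congr rfl fun s _ => ?_
  rw [Finset.sum_eq_single s]
  · rw [(hP.isStarProjection s).isIdempotentElem.eq, Pi.mul_apply, Complex.ofReal_mul]
  · intro t _ ht
    rw [hP.mul_eq_zero s t ht.symm, smul_zero]
  · simp

lemma spectralSum_one : spectralSum P 1 = 1 := by simp [spectralSum, hP.sum_eq_one]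

lemma adjoint_spectralSum (f : κ → ℝ) : (spectralSum P f).adjoint = spectralSum P f := by
  rw [← ContinuousLinearMap.star_eq_adjoint, spectralSum, star_sum]
  refine Finset.sum_congr rfl fun s _ => ?_
  rw [star_smul, (hP.isStarProjection s).isSelfAdjoint.star_eq]
  simp

lemma spectralSum_comm (f g : κ → ℝ) : Commute (spectralSum P f) (spectralSum P g) := by
  rw [commute_iff_eq, hP.spectralSum_mul, hP.spectralSum_mul, mul_comm]

lemma spectralSum_sq {f : κ → ℝ} (hf : ∀ s, f s * f s = 1) :
    spectralSum P f * spectralSum P f = 1 := by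
  rw [hP.spectralSum_mul, ← hP.spectralSum_one]
  congr 1
  exact funext hf

end IsProjMeas

lemma norm_map_of_adjoint {T : H →L[ℂ] H} (h : T.adjoint = T) (h2 : T * T = 1) (x : H) :
    ‖T x‖ = ‖x‖ := by
  have : inner ℂ (T x) (T x) = inner ℂ x x := by
    rw [← ContinuousLinearMap.adjoint_inner_right, h, ← mul_apply_eq_comp, h2]
    rfl
  rw [← sq_eq_sq₀ (norm_nonneg _) (norm_nonneg _), ← inner_self_eq_norm_sq (𝕜 := ℂ),
    ← inner_self_eq_norm_sq (𝕜 := ℂ), this]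

omit [CompleteSpace H] in
lemma localProj_eq_spectralSum {J α : Type*} [Fintype J] [DecidableEq J] [Fintype α]
    [DecidableEq α] (P : (J → α) → H →L[ℂ] H) (j : J) (a : α) :
    localProj P j a = spectralSum P fun s => if s j = a then 1 else 0 := by
  simp [localProj, spectralSum, Finset.sum_filter, apply_ite]

omit [CompleteSpace H] in
lemma obs_eq_spectralSum {n : ℕ} (P : (Fin n → Fin 2) → H →L[ℂ] H) (j : Fin n) :
    obs P j = spectralSum P fun s => if s j = 0 then 1 else -1 := by
  simp only [obs, localProj_eq_spectralSum, spectralSum, ← Finset.sum_sub_distrib, ← sub_smul]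
  refine Finset.sum_congr rfl fun s _ => ?_
  congr 1
  generalize s j = b
  fin_cases b <;> simp

variable {n : ℕ} {P : (Fin n → Fin 2) → H →L[ℂ] H} (hP : IsProjMeas P)

include hP

lemma adjoint_obs (j : Fin n) : (obs P j).adjoint = obs P j := by
  rw [obs_eq_spectralSum, hP.adjoint_spectralSum]

lemma obs_sq (j : Fin n) : obs P j * obs P j = 1 := by
  rw [obs_eq_spectralSum, hP.spectralSum_sq]
  intro s
  split_ifs <;> norm_num

lemma obs_comm (j k : Fin n) : Commute (obs P j) (obs P k) := by
  rw [obs_eq_spectralSum, obs_eq_spectralSum]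
  exact hP.spectralSum_comm _ _

lemma norm_obs_apply (j : Fin n) (x : H) : ‖obs P j x‖ = ‖x‖ :=
  norm_map_of_adjoint (adjoint_obs hP j) (obs_sq hP j) x

end measurements

/-! ### Correlations -/

section correlations

variable {A B : Type*} [NormedAddCommGroup A] [InnerProductSpace ℂ A] [CompleteSpace A]
  [NormedAddCommGroup B] [InnerProductSpace ℂ B] [CompleteSpace B] {ψ : A ⊗ₕ B}

/-- Turns a large correlation into a small distance. Bob's `W` is left arbitrary because his
normalized sums and differences are not known to be unitary. -/
lemma norm_sq_hmap_sub {U : A →L[ℂ] A} (hU : U.adjoint = U) (hU1 : U * U = 1)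
    (W : B →L[ℂ] B) :
    ‖hmap U (.id ℂ B) ψ - hmap (.id ℂ A) W ψ‖ ^ 2
      = ‖ψ‖ ^ 2 + ‖hmap (.id ℂ A) W ψ‖ ^ 2 - 2 * expect ψ (hmap U W) := by
  have h1 : ‖hmap U (.id ℂ B) ψ‖ = ‖ψ‖ :=
    norm_hmap_eq (norm_map_of_adjoint hU hU1) (fun _ => rfl) ψ
  have h2 : inner ℂ (hmap U (.id ℂ B) ψ) (hmap (.id ℂ A) W ψ) = inner ℂ ψ (hmap U W ψ) := by
    rw [inner_hmap_left, hU, hmap_hmap, ContinuousLinearMap.adjoint_id]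
    rfl
  rw [@norm_sub_sq ℂ, h1, h2, expect]
  simp only [RCLike.re_to_complex]
  ring

omit [CompleteSpace A] [CompleteSpace B] in
lemma expect_smul_right (r : ℝ) (U : A →L[ℂ] A) (W : B →L[ℂ] B) :
    expect ψ (hmap U ((r : ℂ) • W)) = r * expect ψ (hmap U W) := by
  rw [expect, hmap_smul_right, smul_apply, inner_smul_right, Complex.re_ofReal_mul, expect]

/-- The defect of a CHSH pair. -/
lemma chsh_defect {U U' : A →L[ℂ] A} (hU : U.adjoint = U) (hU1 : U * U = 1)
    (hU' : U'.adjoint = U') (hU1' : U' * U' = 1) {D E : B →L[ℂ] B} (hD : ∀ x, ‖D x‖ = ‖x‖)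
    (hE : ∀ x, ‖E x‖ = ‖x‖) (hψ : ‖ψ‖ = 1) :
    ‖hmap U (.id ℂ B) ψ - hmap (.id ℂ A) (((√2 : ℝ) : ℂ)⁻¹ • (D + E)) ψ‖ ^ 2
      + ‖hmap U' (.id ℂ B) ψ - hmap (.id ℂ A) (((√2 : ℝ) : ℂ)⁻¹ • (D - E)) ψ‖ ^ 2
      = 4 - √2 * (expect ψ (hmap U (D + E)) + expect ψ (hmap U' (D - E))) := by
  have h2 : √2 * √2 = 2 := Real.mul_self_sqrt (by norm_num)
  have hc : ((√2 : ℝ) : ℂ)⁻¹ = ((√2 / 2 : ℝ) : ℂ) := by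
    rw [← Complex.ofReal_inv]
    congr 1
    field_simp
    linarith
  -- The normalized sum and difference need not preserve the norm of `ψ` individually, but their
  -- squared norms on `ψ` add up to two. With Alice's two unit vectors this gives the constant `4`.
  have hp := parallelogram_law_with_norm ℂ (hmap (.id ℂ A) D ψ) (hmap (.id ℂ A) E ψ)
  rw [norm_hmap_eq (fun _ => rfl) hD, norm_hmap_eq (fun _ => rfl) hE, hψ, ← add_apply,
    ← sub_apply, ← hmap_add_right, ← hmap_sub_right] at hp
  rw [norm_sq_hmap_sub hU hU1, norm_sq_hmap_sub hU' hU1', hc, expect_smul_right,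
    expect_smul_right, hmap_smul_right, hmap_smul_right, smul_apply, smul_apply, norm_smul,
    norm_smul, hψ, Complex.norm_real, Real.norm_of_nonneg (by positivity)]
  linear_combination (√2 ^ 2 / 4) * hp + (1 / 2) * (2 * h2)

end correlations

/-! ### Questions -/

section questions

variable {n : ℕ} {S : Set (Question n)}

lemma insertAt_removeAt (j : Fin n) (x : Question n) : insertAt j (x j) (removeAt j x) = x := by
  funext i
  unfold insertAt removeAt
  split_ifs with h
  · rw [h]
  · rfl

lemma removeAt_insertAt (j : Fin n) (q : Fin 5) (r : ShortQuestion n j) :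
    removeAt j (insertAt j q r) = r := by
  funext i
  simp [insertAt, removeAt, i.2]

lemma mem_shortQuestionSet {χ x : Question n} (hχ : χ ∈ S) (j k : Fin n)
    (h : ∀ i, i ≠ j → i ≠ k → x i = χ i) : removeAt j x ∈ shortQuestionSet S j := by
  refine ⟨χ, hχ, ?_⟩
  by_cases hk : k = j
  · left
    funext i
    exact h i i.2 (hk ▸ i.2)
  · right
    refine ⟨⟨k, hk⟩, x k - χ k, ?_⟩
    funext i
    by_cases hi : i = ⟨k, hk⟩
    · subst hi
      simp [removeAt]
    · have : (i : Fin n) ≠ k := fun e => hi (Subtype.ext e)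
      simp [removeAt, hi, h i i.2 this]

lemma removeAt_mem_shortQuestionSet {χ : Question n} (hχ : χ ∈ S) (j : Fin n) :
    removeAt j χ ∈ shortQuestionSet S j := ⟨χ, hχ, Or.inl rfl⟩

lemma mem_questionSet {x : Question n} {j : Fin n} (h : removeAt j x ∈ shortQuestionSet S j) :
    x ∈ questionSet S := by
  obtain ⟨χ, hχ, h | ⟨i, k, h⟩⟩ := h
  · refine ⟨χ, hχ, j, j, x j - χ j, 0, ?_⟩
    funext l
    by_cases hl : l = j
    · subst hl; simp
    · have := congrFun h ⟨l, hl⟩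
      simpa [removeAt, hl] using this
  · refine ⟨χ, hχ, j, i, x j - χ j, k, ?_⟩
    funext l
    by_cases hl : l = j
    · subst hl
      simp [i.2.symm]
    · have := congrFun h ⟨l, hl⟩
      by_cases hi : l = i
      · subst hi
        simpa [removeAt, hl] using this
      · have hi' : (⟨l, hl⟩ : {i : Fin n // i ≠ j}) ≠ i := fun e => hi (congrArg Subtype.val e)
        simpa [removeAt, hl, hi, hi'] using this

end questions

/-! ### Bob's conjugation observables -/

/-- The value assigned to the outcome `b` by the observable for the basis `q`. -/
def conjSign (q : Fin 5) (b : Fin 4) : ℝ :=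
  ![if q = 1 then -1 else 1, if q = 0 then -1 else 1, if q = 2 then -1 else 1, -1] b

lemma sum_localProj_eq_spectralSum {J H : Type*} [Fintype J] [DecidableEq J]
    [NormedAddCommGroup H] [InnerProductSpace ℂ H] (P : (J → Fin 4) → H →L[ℂ] H) (i : J)
    (q : Fin 5) :
    Strategy.sgn (q = 1) • localProj P i 0 + Strategy.sgn (q = 0) • localProj P i 1
        + Strategy.sgn (q = 2) • localProj P i 2 - localProj P i 3
      = spectralSum P fun s => conjSign q (s i) := by
  simp only [localProj_eq_spectralSum, spectralSum, Finset.smul_sum, ← Finset.sum_sub_distrib,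
    ← Finset.sum_add_distrib, smul_smul, ← sub_smul, ← add_smul]
  refine Finset.sum_congr rfl fun s _ => ?_
  congr 1
  generalize s i = b
  fin_cases b <;> simp [conjSign, Strategy.sgn] <;> split_ifs <;> simp

/-- The basis of Alice that corresponds to `Strategy.bobPauli`. -/
def aliceBasis : Fin 6 → Fin 5 := ![2, 0, 2, 1, 0, 1]

namespace Strategy

variable {n : ℕ} {S : Set (Question n)} {A B : Type*}
  [NormedAddCommGroup A] [InnerProductSpace ℂ A] [CompleteSpace A]
  [NormedAddCommGroup B] [InnerProductSpace ℂ B] [CompleteSpace B] (σ : Strategy n S A B)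

/-- The four outcomes carry the eigenvalues of σ_x⊗σ_x, σ_y⊗σ_y, σ_z⊗σ_z on the four Bell states. In
each of them the three signs multiply to `-1`, so the last identity is exact. The argument does not
depend on which of ◇, ◆ is asked. -/
lemma conjB_props (j : ℕ) (hj : j + 1 < n) :
    (∀ q, (σ.conjB j hj q).adjoint = σ.conjB j hj q) ∧
    (∀ q, σ.conjB j hj q * σ.conjB j hj q = 1) ∧
    σ.conjB j hj 0 * σ.conjB j hj 1 * σ.conjB j hj 2 = -1 := by
  have key : ∀ {J : Type} [Fintype J] [DecidableEq J] (P : (J → Fin 4) → B →L[ℂ] B)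
      (_ : IsProjMeas P) (i : J) (G : Fin 5 → B →L[ℂ] B)
      (_ : ∀ q, G q = spectralSum P fun s => conjSign q (s i)),
      (∀ q, (G q).adjoint = G q) ∧ (∀ q, G q * G q = 1) ∧ G 0 * G 1 * G 2 = -1 := by
    intro J _ _ P hP i G hG
    refine ⟨fun q => ?_, fun q => ?_, ?_⟩
    · rw [hG, hP.adjoint_spectralSum]
    · rw [hG, hP.spectralSum_sq]
      intro s
      generalize s i = b
      fin_cases b <;> simp [conjSign] <;> split_ifs <;> norm_num
    · rw [hG, hG, hG, hP.spectralSum_mul, hP.spectralSum_mul, ← hP.spectralSum_one]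
      simp only [spectralSum, ← Finset.sum_neg_distrib, ← neg_smul]
      refine Finset.sum_congr rfl fun s _ => ?_
      congr 1
      simp only [Pi.mul_apply, Pi.one_apply]
      generalize s i = b
      fin_cases b <;> simp [conjSign]
  by_cases h : j % 2 = 0
  · refine key σ.projDiamond σ.isProjMeas_projDiamond ⟨j / 2, by omega⟩ _ fun q => ?_
    simp only [conjB, Gam, dif_pos h, ← sum_localProj_eq_spectralSum]
  · refine key σ.projBlack σ.isProjMeas_projBlack ⟨j / 2, by omega⟩ _ fun q => ?_
    simp only [conjB, Gam, dif_neg h, ← sum_localProj_eq_spectralSum]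

/-! ### Consequences of the requested observations -/

lemma obsB_sq (y : Fin 6) (j : Fin n) : σ.obsB y j * σ.obsB y j = 1 :=
  obs_sq (σ.isProjMeas_projB y) j

lemma norm_obsB (y : Fin 6) (j : Fin n) (x : B) : ‖σ.obsB y j x‖ = ‖x‖ :=
  norm_obs_apply (σ.isProjMeas_projB y) j x

/-- Bob's six normalized sums and differences of observables, with the corresponding observable
of Alice. -/
def bobPauli (k : Fin 6) (j : Fin n) : B →L[ℂ] B :=
  ![((√2 : ℝ) : ℂ)⁻¹ • (σ.obsB 0 j + σ.obsB 1 j), ((√2 : ℝ) : ℂ)⁻¹ • (σ.obsB 0 j - σ.obsB 1 j),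
    ((√2 : ℝ) : ℂ)⁻¹ • (σ.obsB 2 j + σ.obsB 3 j), ((√2 : ℝ) : ℂ)⁻¹ • (σ.obsB 2 j - σ.obsB 3 j),
    ((√2 : ℝ) : ℂ)⁻¹ • (σ.obsB 4 j + σ.obsB 5 j), ((√2 : ℝ) : ℂ)⁻¹ • (σ.obsB 4 j - σ.obsB 5 j)] k

variable {σ} {ε : ℝ}

/-- The six squared defects are nonnegative and sum to `12 - √2 T`, with `T` the value of the triple
CHSH expression, so each of them is at most `ε`. Bob's operator does not depend on the entries of
`x` outside `j`, which later allows Alice's questions to be exchanged freely. -/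
lemma AttainsRequested.norm_sub_bobPauli (h : σ.AttainsRequested ε) {x : Question n} {j : Fin n}
    (hx : removeAt j x ∈ shortQuestionSet S j) (k : Fin 6) (hk : x j = aliceBasis k) :
    ‖hmap (σ.obsA x j) (.id ℂ B) σ.ψ - hmap (.id ℂ A) (σ.bobPauli k j) σ.ψ‖ ^ 2 ≤ ε := by
  have hq : ∀ q, IsProjMeas (σ.projA (insertAt j q (removeAt j x))) := fun q =>
    σ.isProjMeas_projA _ (mem_questionSet (j := j) (by rwa [removeAt_insertAt]))
  have hadj : ∀ q, (σ.obsAt j q (removeAt j x)).adjoint = σ.obsAt j q (removeAt j x) := fun q =>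
    adjoint_obs (hq q) j
  have hsq : ∀ q, σ.obsAt j q (removeAt j x) * σ.obsAt j q (removeAt j x) = 1 := fun q =>
    obs_sq (hq q) j
  let f : Fin 6 → ℝ := fun k => ‖hmap (σ.obsAt j (aliceBasis k) (removeAt j x)) (.id ℂ B) σ.ψ
    - hmap (.id ℂ A) (σ.bobPauli k j) σ.ψ‖ ^ 2
  have hf : ∀ k, 0 ≤ f k := fun k => sq_nonneg _
  have h1 : f 0 + f 1 = _ := chsh_defect (hadj 2) (hsq 2) (hadj 0) (hsq 0) (σ.norm_obsB 0 j)
    (σ.norm_obsB 1 j) σ.norm_ψ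
  have h2 : f 2 + f 3 = _ := chsh_defect (hadj 2) (hsq 2) (hadj 1) (hsq 1) (σ.norm_obsB 2 j)
    (σ.norm_obsB 3 j) σ.norm_ψ
  have h3 : f 4 + f 5 = _ := chsh_defect (hadj 0) (hsq 0) (hadj 1) (hsq 1) (σ.norm_obsB 4 j)
    (σ.norm_obsB 5 j) σ.norm_ψ
  have hT : expect σ.ψ (σ.tripleCHSH j (removeAt j x))
      = (expect σ.ψ (hmap (σ.obsAt j 2 (removeAt j x)) (σ.obsB 0 j + σ.obsB 1 j))
        + expect σ.ψ (hmap (σ.obsAt j 0 (removeAt j x)) (σ.obsB 0 j - σ.obsB 1 j)))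
        + (expect σ.ψ (hmap (σ.obsAt j 2 (removeAt j x)) (σ.obsB 2 j + σ.obsB 3 j))
        + expect σ.ψ (hmap (σ.obsAt j 1 (removeAt j x)) (σ.obsB 2 j - σ.obsB 3 j)))
        + (expect σ.ψ (hmap (σ.obsAt j 0 (removeAt j x)) (σ.obsB 4 j + σ.obsB 5 j))
        + expect σ.ψ (hmap (σ.obsAt j 1 (removeAt j x)) (σ.obsB 4 j - σ.obsB 5 j))) := by
    simp only [expect, tripleCHSH, add_apply, inner_add_right, Complex.add_re]
    ring
  have hE := h.chsh j _ hx
  have h2s : √2 * √2 = 2 := Real.mul_self_sqrt (by norm_num)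
  -- Multiplied by `√2`, the requested Bell value is exactly the total of the squares minus `ε`.
  have hs : √2 * (6 * √2 - ε / √2) = 12 - ε := by
    have : √2 * (ε / √2) = ε := by field_simp
    linear_combination 6 * h2s - this
  have hE' : 12 - ε ≤ √2 * expect σ.ψ (σ.tripleCHSH j (removeAt j x)) := by
    rw [← hs]
    exact mul_le_mul_of_nonneg_left hE (Real.sqrt_nonneg 2)
  rw [hT] at hE'
  have hA : σ.obsA x j = σ.obsAt j (aliceBasis k) (removeAt j x) := by
    rw [obsAt, ← hk, insertAt_removeAt]
  rw [hA]
  have h6 : f 0 + f 1 + (f 2 + f 3) + (f 4 + f 5) ≤ ε := by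
    rw [h1, h2, h3]
    linarith
  change f k ≤ ε
  have := hf 0; have := hf 1; have := hf 2; have := hf 3; have := hf 4; have := hf 5
  fin_cases k <;> dsimp only [Fin.reduceFinMk, Fin.zero_eta, Fin.mk_one, Fin.isValue] <;> linarith

lemma AttainsRequested.norm_sub_obsB_four (h : σ.AttainsRequested ε) {χ : Question n} (hχ : χ ∈ S)
    (j : Fin n) : ‖hmap (σ.obsAt j 3 (removeAt j χ)) (.id ℂ B) σ.ψ
      - hmap (.id ℂ A) (σ.obsB 4 j) σ.ψ‖ ^ 2 ≤ 2 * ε := by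
  have hP := σ.isProjMeas_projA (insertAt j 3 (removeAt j χ)) (mem_questionSet (j := j)
    (by rw [removeAt_insertAt]; exact removeAt_mem_shortQuestionSet hχ j))
  rw [norm_sq_hmap_sub (U := σ.obsAt j 3 (removeAt j χ)) (adjoint_obs hP j) (obs_sq hP j),
    norm_hmap_eq (fun _ => rfl) (σ.norm_obsB 4 j), σ.norm_ψ]
  linarith [h.corr_add χ hχ j]

lemma AttainsRequested.norm_sub_obsB_five (h : σ.AttainsRequested ε) {χ : Question n} (hχ : χ ∈ S)
    (j : Fin n) : ‖hmap (σ.obsAt j 4 (removeAt j χ)) (.id ℂ B) σ.ψ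
      - hmap (.id ℂ A) (σ.obsB 5 j) σ.ψ‖ ^ 2 ≤ 2 * ε := by
  have hP := σ.isProjMeas_projA (insertAt j 4 (removeAt j χ)) (mem_questionSet (j := j)
    (by rw [removeAt_insertAt]; exact removeAt_mem_shortQuestionSet hχ j))
  rw [norm_sq_hmap_sub (U := σ.obsAt j 4 (removeAt j χ)) (adjoint_obs hP j) (obs_sq hP j),
    norm_hmap_eq (fun _ => rfl) (σ.norm_obsB 5 j), σ.norm_ψ]
  linarith [h.corr_sub χ hχ j]

lemma removeAt_doubled_mem {χ : Question n} (hχ : χ ∈ S) (j : ℕ) (hj : j + 1 < n) (q : Fin 5) :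
    removeAt ⟨j, Nat.lt_of_succ_lt hj⟩ (doubled χ j hj q) ∈
        shortQuestionSet S ⟨j, Nat.lt_of_succ_lt hj⟩ ∧
      removeAt ⟨j + 1, hj⟩ (doubled χ j hj q) ∈ shortQuestionSet S ⟨j + 1, hj⟩ :=
  ⟨mem_shortQuestionSet hχ _ ⟨j + 1, hj⟩ fun i h h' => by simp [doubled, h, h'],
    mem_shortQuestionSet hχ _ ⟨j, by omega⟩ fun i h h' => by simp [doubled, h, h']⟩

lemma AttainsRequested.norm_sub_conjB (h : σ.AttainsRequested ε) (j : ℕ) (hj : j + 1 < n)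
    {q : Fin 5} (hq : q < 3) :
    ‖hmap (σ.obsA (doubled h.conj.choose j hj q) ⟨j, by omega⟩
        * σ.obsA (doubled h.conj.choose j hj q) ⟨j + 1, hj⟩) (.id ℂ B) σ.ψ
      - hmap (.id ℂ A) (σ.conjB j hj q) σ.ψ‖ ^ 2 ≤ ε := by
  obtain ⟨hχ, hc⟩ := h.conj.choose_spec
  have hP := σ.isProjMeas_projA _ (mem_questionSet (removeAt_doubled_mem hχ j hj q).1)
  have hcomm : Commute (σ.obsA (doubled h.conj.choose j hj q) ⟨j, by omega⟩)
    (σ.obsA (doubled h.conj.choose j hj q) ⟨j + 1, hj⟩) := obs_comm hP _ _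
  have h1 : ∀ k, (σ.obsA (doubled h.conj.choose j hj q) k).adjoint
    = σ.obsA (doubled h.conj.choose j hj q) k := fun k => adjoint_obs hP k
  have h2 : ∀ k, σ.obsA (doubled h.conj.choose j hj q) k * σ.obsA (doubled h.conj.choose j hj q) k
    = 1 := fun k => obs_sq hP k
  have hB := σ.conjB_props j hj
  rw [norm_sq_hmap_sub, norm_hmap_eq (fun _ => rfl) (norm_map_of_adjoint (hB.1 q) (hB.2.1 q)),
    σ.norm_ψ]
  · linarith [hc j hj q hq]
  · rw [ContinuousLinearMap.mul_def, ContinuousLinearMap.adjoint_comp, h1, h1]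
    exact hcomm.eq.symm
  · rw [hcomm.symm.mul_mul_mul_comm, h2, h2, one_mul]

end Strategy

/-! ### The family of all strategies that attain the requested observations -/

/-- Sorting the interleaved product gives `(a'b'c')(abc) = -1`, while anticommutation gives `(abc)²
= -1`. Cancelling the invertible `abc` leaves equal handedness. -/
lemma mul_mul_eq_of_anticommute {R : Type*} [Ring R] {a b c a' b' c' : R} (ha : a * a = 1)
    (hb : b * b = 1) (hc : c * c = 1) (hab : a * b = -(b * a)) (hac : a * c = -(c * a))
    (hbc : b * c = -(c * b)) (h1 : Commute a b') (h2 : Commute a c') (h3 : Commute b c')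
    (h : a' * a * (b' * b) * (c' * c) = -1) : a' * b' * c' = a * b * c := by
  have h4 : a' * b' * c' * (a * b * c) = -1 := by
    rw [← h]
    simp only [mul_assoc, h3.left_comm, h2.left_comm, h1.left_comm]
  have h5 : a * b * c * (a * b * c) = -1 := by
    calc a * b * c * (a * b * c) = a * b * (c * a) * b * c := by simp only [mul_assoc]
      _ = -(a * (b * a) * (c * b) * c) := by
          rw [← neg_eq_iff_eq_neg.2 hac]; simp only [mul_assoc, mul_neg, neg_mul]
      _ = -(a * a * (b * b) * (c * c)) := by
          rw [← neg_eq_iff_eq_neg.2 hab, ← neg_eq_iff_eq_neg.2 hbc]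
          simp only [mul_assoc, mul_neg, neg_mul, neg_neg]
      _ = -1 := by rw [ha, hb, hc, one_mul, one_mul]
  calc a' * b' * c' = -(a' * b' * c' * (a * b * c * (a * b * c))) := by rw [h5]; simp
    _ = a * b * c := by rw [← mul_assoc, h4]; simp

universe u v

/-- A strategy that attains the requested observations, with a special question. -/
structure Attaining (n : ℕ) where
  ε : ℝ≥0
  S : Set (Question n)
  A : Type u
  [normedAddCommGroupA : NormedAddCommGroup A]
  [innerProductSpaceA : InnerProductSpace ℂ A]
  [completeSpaceA : CompleteSpace A]
  B : Type v
  [normedAddCommGroupB : NormedAddCommGroup B]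
  [innerProductSpaceB : InnerProductSpace ℂ B]
  [completeSpaceB : CompleteSpace B]
  σ : Strategy n S A B
  attains : σ.AttainsRequested ε
  χ : Question n
  mem : χ ∈ S

/-! ### Pauli relations in the state algebra of all attaining strategies -/

namespace Attaining

attribute [instance] normedAddCommGroupA innerProductSpaceA completeSpaceA normedAddCommGroupB
  innerProductSpaceB completeSpaceB

variable {n : ℕ}

/-- The states. -/
def state (i : Attaining.{u, v} n) : i.A ⊗ₕ i.B := i.σ.ψ

/-- The error scale. -/
def err (i : Attaining.{u, v} n) : ℝ := √i.ε

lemma mem_smallFam_of_sq_le {H : Attaining.{u, v} n → Type*} [∀ i, NormedAddCommGroup (H i)]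
    [∀ i, NormedSpace ℂ (H i)] {w : ∀ i, H i} (C : ℝ) (h : ∀ i, ‖w i‖ ^ 2 ≤ C * i.ε) :
    w ∈ smallFam H err := by
  refine ⟨√(max C 0), fun i => ?_⟩
  rw [err, ← Real.sqrt_mul (le_max_right _ _)]
  exact Real.le_sqrt_of_sq_le ((h i).trans
    (mul_le_mul_of_nonneg_right (le_max_left _ _) i.ε.2))

lemma obsB_mem_boundedFam (y : Fin 6) (j : Fin n) :
    (fun i : Attaining.{u, v} n => i.σ.obsB y j) ∈ boundedFam B B :=
  mem_boundedFam_of_norm_map fun i => i.σ.norm_obsB y j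

lemma bobPauli_mem_boundedFam (k : Fin 6) (j : Fin n) :
    (fun i : Attaining.{u, v} n => i.σ.bobPauli k j) ∈ boundedFam B B := by
  have h := obsB_mem_boundedFam.{u, v} (n := n)
  fin_cases k
  · exact Submodule.smul_mem _ _ (add_mem (h 0 j) (h 1 j))
  · exact Submodule.smul_mem _ _ (sub_mem (h 0 j) (h 1 j))
  · exact Submodule.smul_mem _ _ (add_mem (h 2 j) (h 3 j))
  · exact Submodule.smul_mem _ _ (sub_mem (h 2 j) (h 3 j))
  · exact Submodule.smul_mem _ _ (add_mem (h 4 j) (h 5 j))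
  · exact Submodule.smul_mem _ _ (sub_mem (h 4 j) (h 5 j))

lemma mirror_bobPauli (x : Attaining.{u, v} n → Question n) (j : Fin n) (k : Fin 6)
    (hx : ∀ i, removeAt j (x i) ∈ shortQuestionSet i.S j) (hk : ∀ i, x i j = aliceBasis k) :
    Mirror state err (fun i => i.σ.obsA (x i) j) (fun i => i.σ.bobPauli k j) where
  left := mem_boundedFam_of_norm_map fun i =>
    norm_obs_apply (i.σ.isProjMeas_projA _ (mem_questionSet (hx i))) j
  right := bobPauli_mem_boundedFam k j
  small := mem_smallFam_of_sq_le 1 fun i => by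
    rw [one_mul]
    exact i.attains.norm_sub_bobPauli (hx i) k (hk i)

lemma removeAt_update_mem (j : Fin n) (q : Fin 5) (i : Attaining.{u, v} n) :
    removeAt j (Function.update i.χ j q) ∈ shortQuestionSet i.S j :=
  mem_shortQuestionSet i.mem j j fun l h _ => by simp [h]

lemma mirror_update (j : Fin n) (k : Fin 6) :
    Mirror state err (fun i : Attaining.{u, v} n =>
      i.σ.obsA (Function.update i.χ j (aliceBasis k)) j) (fun i => i.σ.bobPauli k j) :=
  mirror_bobPauli _ j k (removeAt_update_mem j _) fun i => by simp

/-- Bob's sums and differences as mirrored families. -/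
def pauliB (k : Fin 6) (j : Fin n) : mirrored (state.{u, v} (n := n)) err :=
  ⟨fun i => i.σ.bobPauli k j, (mirror_update j k).mem⟩

lemma obsB_eq {S : Set (Question n)} {A B : Type*}
    [NormedAddCommGroup A] [InnerProductSpace ℂ A] [CompleteSpace A]
    [NormedAddCommGroup B] [InnerProductSpace ℂ B] [CompleteSpace B] (σ : Strategy n S A B)
    (y : Fin 6) (j : Fin n) : σ.obsB y j =
      ![((√2 : ℝ) : ℂ)⁻¹ • (σ.bobPauli 0 j + σ.bobPauli 1 j),
        ((√2 : ℝ) : ℂ)⁻¹ • (σ.bobPauli 0 j - σ.bobPauli 1 j),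
        ((√2 : ℝ) : ℂ)⁻¹ • (σ.bobPauli 2 j + σ.bobPauli 3 j),
        ((√2 : ℝ) : ℂ)⁻¹ • (σ.bobPauli 2 j - σ.bobPauli 3 j),
        ((√2 : ℝ) : ℂ)⁻¹ • (σ.bobPauli 4 j + σ.bobPauli 5 j),
        ((√2 : ℝ) : ℂ)⁻¹ • (σ.bobPauli 4 j - σ.bobPauli 5 j)] y := by
  have key : ∀ D E : B →L[ℂ] B,
      D = ((√2 : ℝ) : ℂ)⁻¹ • (((√2 : ℝ) : ℂ)⁻¹ • (D + E) + ((√2 : ℝ) : ℂ)⁻¹ • (D - E)) ∧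
      E = ((√2 : ℝ) : ℂ)⁻¹ • (((√2 : ℝ) : ℂ)⁻¹ • (D + E) - ((√2 : ℝ) : ℂ)⁻¹ • (D - E)) := by
    intro D E
    rw [← smul_add, ← smul_sub, smul_smul, smul_smul, inv_sqrt_two_mul_self]
    constructor <;> module
  fin_cases y
  · exact (key _ _).1
  · exact (key _ _).2
  · exact (key _ _).1
  · exact (key _ _).2
  · exact (key _ _).1
  · exact (key _ _).2

lemma obsB_mem_mirrored (y : Fin 6) (j : Fin n) :
    (fun i => i.σ.obsB y j) ∈ mirrored (state.{u, v} (n := n)) err := by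
  have h : ∀ k, (fun i => i.σ.bobPauli k j) ∈ mirrored (state.{u, v} (n := n)) err :=
    fun k => (pauliB k j).2
  simp only [obsB_eq]
  fin_cases y
  · exact Subalgebra.smul_mem _ (add_mem (h 0) (h 1)) _
  · exact Subalgebra.smul_mem _ (sub_mem (h 0) (h 1)) _
  · exact Subalgebra.smul_mem _ (add_mem (h 2) (h 3)) _
  · exact Subalgebra.smul_mem _ (sub_mem (h 2) (h 3)) _
  · exact Subalgebra.smul_mem _ (add_mem (h 4) (h 5)) _
  · exact Subalgebra.smul_mem _ (sub_mem (h 4) (h 5)) _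

/-- Bob's observables as mirrored families. -/
def reflB (y : Fin 6) (j : Fin n) : mirrored (state.{u, v} (n := n)) err :=
  ⟨fun i => i.σ.obsB y j, obsB_mem_mirrored y j⟩

lemma reflB_eq (y : Fin 6) (j : Fin n) : reflB.{u, v} y j =
    ![((√2 : ℝ) : ℂ)⁻¹ • (pauliB 0 j + pauliB 1 j), ((√2 : ℝ) : ℂ)⁻¹ • (pauliB 0 j - pauliB 1 j),
      ((√2 : ℝ) : ℂ)⁻¹ • (pauliB 2 j + pauliB 3 j), ((√2 : ℝ) : ℂ)⁻¹ • (pauliB 2 j - pauliB 3 j),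
      ((√2 : ℝ) : ℂ)⁻¹ • (pauliB 4 j + pauliB 5 j),
      ((√2 : ℝ) : ℂ)⁻¹ • (pauliB 4 j - pauliB 5 j)] y := by
  refine Subtype.ext (funext fun i => ?_)
  change i.σ.obsB y j = _
  rw [obsB_eq]
  fin_cases y <;> rfl

lemma reflB_sq (y : Fin 6) (j : Fin n) : reflB.{u, v} y j * reflB y j = 1 :=
  Subtype.ext (funext fun i => i.σ.obsB_sq y j)

/-- The classes of Bob's sums and differences. -/
def pauliClass (k : Fin 6) (j : Fin n) : StateAlgebra (state.{u, v} (n := n)) err :=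
  stateClass (pauliB k j)

/-- Each of Alice's three bases occurs in two of the three CHSH tests. Her observable is the same in
both, so it identifies the two candidates on Bob's side. -/
lemma pauliClass_eq {k k' : Fin 6} (h : aliceBasis k = aliceBasis k') (j : Fin n) :
    pauliClass.{u, v} k j = pauliClass k' j :=
  stateClass_eq_of_mirror (mirror_update j k) (by rw [h]; exact mirror_update j k')

/-- Bob's sums and differences need not be reflections; the relation is inherited from Alice's
observable, which is one exactly. -/
lemma pauliClass_sq (k : Fin 6) (j : Fin n) : pauliClass.{u, v} k j * pauliClass k j = 1 := by
  rw [pauliClass, ← map_mul, ← map_one stateClass]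
  have h := (mirror_update.{u, v} j k).mul (mirror_update j k)
  have e : (fun i : Attaining.{u, v} n => i.σ.obsA (Function.update i.χ j (aliceBasis k)) j)
      * (fun i => i.σ.obsA (Function.update i.χ j (aliceBasis k)) j) = 1 := funext fun i =>
    obs_sq (i.σ.isProjMeas_projA _ (mem_questionSet (removeAt_update_mem j _ i))) j
  rw [e] at h
  exact stateClass_eq_of_mirror h Mirror.one

/-- Bob's observable `(p + p') / √2` squares to one exactly. As `p` and `p'` also square to one in
the quotient, the mixed terms of the expanded square must cancel. -/
lemma pauliClass_anti (j : Fin n) :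
    pauliClass.{u, v} 0 j * pauliClass 1 j = -(pauliClass 1 j * pauliClass 0 j) ∧
    pauliClass.{u, v} 2 j * pauliClass 3 j = -(pauliClass 3 j * pauliClass 2 j) ∧
    pauliClass.{u, v} 4 j * pauliClass 5 j = -(pauliClass 5 j * pauliClass 4 j) := by
  have key : ∀ k k' : Fin 6, (((√2 : ℝ) : ℂ)⁻¹ • (pauliB.{u, v} k j + pauliB k' j)) *
      (((√2 : ℝ) : ℂ)⁻¹ • (pauliB k j + pauliB k' j)) = 1 →
      pauliClass.{u, v} k j * pauliClass k' j = -(pauliClass k' j * pauliClass k j) := by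
    intro k k' h
    have h := congrArg stateClass h
    rw [map_mul, map_smul, map_add, map_one, smul_mul_smul_comm, inv_sqrt_two_mul_self,
      add_mul, mul_add, mul_add] at h
    have h1 := pauliClass_sq.{u, v} k j
    have h2 := pauliClass_sq.{u, v} k' j
    unfold pauliClass at *
    rw [h1, h2] at h
    linear_combination (norm := module) (2 : ℂ) • h
  have h := fun y => reflB_sq.{u, v} y j
  simp only [reflB_eq] at h
  exact ⟨key 0 1 (h 0), key 2 3 (h 2), key 4 5 (h 4)⟩

/-- A special question changed at `j` and at `l` contains both bases, and Alice's two observables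
then belong to one measurement. This is why questions with two altered entries are needed. -/
lemma pauliClass_comm (k k' : Fin 6) {j l : Fin n} (hjl : j ≠ l) :
    Commute (pauliClass.{u, v} k j) (pauliClass k' l) := by
  set x : Attaining.{u, v} n → Question n := fun i =>
    Function.update (Function.update i.χ j (aliceBasis k)) l (aliceBasis k') with hx
  have hj : ∀ i, removeAt j (x i) ∈ shortQuestionSet i.S j := fun i =>
    mem_shortQuestionSet i.mem j l fun m h h' => by simp [hx, h, h']
  have hl : ∀ i, removeAt l (x i) ∈ shortQuestionSet i.S l := fun i =>
    mem_shortQuestionSet i.mem l j fun m h h' => by simp [hx, h, h']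
  have m1 := mirror_bobPauli x j k hj fun i => by simp [hx, hjl]
  have m2 := mirror_bobPauli x l k' hl fun i => by simp [hx]
  rw [commute_iff_eq, pauliClass, pauliClass, ← map_mul, ← map_mul]
  have h := m1.mul m2
  have e : (fun i : Attaining.{u, v} n => i.σ.obsA (x i) j) * (fun i => i.σ.obsA (x i) l)
      = (fun i => i.σ.obsA (x i) l) * (fun i => i.σ.obsA (x i) j) := funext fun i =>
    (obs_comm (i.σ.isProjMeas_projA _ (mem_questionSet (hj i))) j l).eq
  rw [e] at h
  exact stateClass_eq_of_mirror (m2.mul m1) h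

/-- The index of the sum or difference that serves as a Pauli operator. -/
def pauliIndex : Fin 3 → Fin 6 := ![4, 5, 0]

lemma aliceBasis_pauliIndex (q : Fin 3) :
    aliceBasis (pauliIndex q) = q.castLE (by norm_num) := by fin_cases q <;> rfl

lemma mirror_conjB (j : ℕ) (hj : j + 1 < n) {q : Fin 5} (hq : q < 3) :
    Mirror state err (fun i : Attaining.{u, v} n =>
      i.σ.obsA (Strategy.doubled i.attains.conj.choose j hj q) ⟨j, by omega⟩ *
        i.σ.obsA (Strategy.doubled i.attains.conj.choose j hj q) ⟨j + 1, hj⟩)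
      (fun i => i.σ.conjB j hj q) where
  left := by
    have h : ∀ i : Attaining.{u, v} n, IsProjMeas (i.σ.projA
        (Strategy.doubled i.attains.conj.choose j hj q)) := fun i => i.σ.isProjMeas_projA _
      (mem_questionSet (Strategy.removeAt_doubled_mem i.attains.conj.choose_spec.1 j hj q).1)
    exact mul_mem_boundedFam (mem_boundedFam_of_norm_map fun i => norm_obs_apply (h i) _)
      (mem_boundedFam_of_norm_map fun i => norm_obs_apply (h i) _)
  right := mem_boundedFam_of_norm_map fun i => norm_map_of_adjoint
    ((i.σ.conjB_props j hj).1 q) ((i.σ.conjB_props j hj).2.1 q)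
  small := mem_smallFam_of_sq_le 1 fun i => by
    rw [one_mul]
    exact i.attains.norm_sub_conjB j hj hq

/-- For a question with equal entries at `j` and `j + 1`, Alice's product observable mirrors both
the product of Bob's two Pauli operators and his sign observable from ◇ or ◆. The special question
behind it may differ from `i.χ`, which is harmless because `mirror_bobPauli` holds for all
admissible questions. -/
lemma pauliClass_mul_mul (j : ℕ) (hj : j + 1 < n) :
    (pauliClass.{u, v} (pauliIndex 0) ⟨j + 1, hj⟩ * pauliClass (pauliIndex 0) ⟨j, by omega⟩)
      * (pauliClass (pauliIndex 1) ⟨j + 1, hj⟩ * pauliClass (pauliIndex 1) ⟨j, by omega⟩)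
      * (pauliClass (pauliIndex 2) ⟨j + 1, hj⟩ * pauliClass (pauliIndex 2) ⟨j, by omega⟩) = -1 := by
  have hlt : ∀ q : Fin 3, q.castLE (by norm_num) < (3 : Fin 5) := by decide
  let G : Fin 3 → mirrored (state.{u, v} (n := n)) err := fun q =>
    ⟨fun i => i.σ.conjB j hj (q.castLE (by norm_num)), (mirror_conjB j hj (hlt q)).mem⟩
  have hG : ∀ q, pauliClass.{u, v} (pauliIndex q) ⟨j + 1, hj⟩ *
      pauliClass (pauliIndex q) ⟨j, by omega⟩ = stateClass (G q) := by
    intro q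
    rw [pauliClass, pauliClass, ← map_mul]
    refine stateClass_eq_of_mirror (Mirror.mul ?_ ?_) (mirror_conjB j hj (hlt q))
    · refine mirror_bobPauli _ _ (pauliIndex q) (fun i =>
        (Strategy.removeAt_doubled_mem i.attains.conj.choose_spec.1 j hj _).1) fun i => ?_
      rw [aliceBasis_pauliIndex]
      simp [Strategy.doubled]
    · refine mirror_bobPauli _ _ (pauliIndex q) (fun i =>
        (Strategy.removeAt_doubled_mem i.attains.conj.choose_spec.1 j hj _).2) fun i => ?_
      rw [aliceBasis_pauliIndex]
      simp [Strategy.doubled]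
  rw [hG, hG, hG, ← map_mul, ← map_mul, ← map_one stateClass, ← map_neg]
  congr 1
  exact Subtype.ext (funext fun i => (i.σ.conjB_props j hj).2.2)

lemma pauliClass_pauliIndex_anti {q q' : Fin 3} (h : q ≠ q') (j : Fin n) :
    pauliClass.{u, v} (pauliIndex q) j * pauliClass (pauliIndex q') j
      = -(pauliClass (pauliIndex q') j * pauliClass (pauliIndex q) j) := by
  obtain ⟨h0, h1, h2⟩ := pauliClass_anti.{u, v} j
  rw [pauliClass_eq (k := 1) (k' := 4) rfl] at h0
  rw [pauliClass_eq (k := 3) (k' := 5) rfl, pauliClass_eq (k := 2) (k' := 0) rfl] at h1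
  fin_cases q <;> fin_cases q'
  · exact absurd rfl h
  · exact h2
  · exact (neg_eq_iff_eq_neg.2 h0).symm
  · exact (neg_eq_iff_eq_neg.2 h2).symm
  · exact absurd rfl h
  · exact (neg_eq_iff_eq_neg.2 h1).symm
  · exact h0
  · exact h1
  · exact absurd rfl h

/-- Neighbouring positions are compared by `pauliClass_mul_mul`, and the equality propagates along
the chain down to position `0`. -/
lemma pauliClass_hand (j l : Fin n) :
    pauliClass.{u, v} (pauliIndex 0) j * pauliClass (pauliIndex 1) j * pauliClass (pauliIndex 2) j
      = pauliClass (pauliIndex 0) l * pauliClass (pauliIndex 1) l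
        * pauliClass (pauliIndex 2) l := by
  have key : ∀ (m : ℕ) (hm : m < n), pauliClass.{u, v} (pauliIndex 0) ⟨m, hm⟩
      * pauliClass (pauliIndex 1) ⟨m, hm⟩ * pauliClass (pauliIndex 2) ⟨m, hm⟩
      = pauliClass (pauliIndex 0) ⟨0, by omega⟩ * pauliClass (pauliIndex 1) ⟨0, by omega⟩
        * pauliClass (pauliIndex 2) ⟨0, by omega⟩ := by
    intro m hm
    induction m with
    | zero => rfl
    | succ m ih =>
      rw [← ih (by omega)]
      have hne : (⟨m, by omega⟩ : Fin n) ≠ ⟨m + 1, hm⟩ := by simp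
      exact mul_mul_eq_of_anticommute (pauliClass_sq _ _) (pauliClass_sq _ _) (pauliClass_sq _ _)
        (pauliClass_pauliIndex_anti (by decide) _) (pauliClass_pauliIndex_anti (by decide) _)
        (pauliClass_pauliIndex_anti (by decide) _) (pauliClass_comm _ _ hne)
        (pauliClass_comm _ _ hne) (pauliClass_comm _ _ hne) (pauliClass_mul_mul m hm)
  exact (key j j.2).trans (key l l.2).symm

/-- Bob's Pauli operators. -/
def pauliP (q : Fin 3) (j : Fin n) : mirrored (state.{u, v} (n := n)) err :=
  pauliB (pauliIndex q) j

lemma pauliFamily : PauliFamily fun q (j : Fin n) => stateClass (pauliP.{u, v} q j) where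
  sq _ j := pauliClass_sq _ j
  anti _ _ j h := pauliClass_pauliIndex_anti h j
  comm _ _ _ _ h := pauliClass_comm _ _ h
  hand j l := pauliClass_hand j l

/-- The data of the swap isometries. -/
def swapData (hn : 0 < n) : SwapData n (state.{u, v} (n := n)) err where
  pos := hn
  p := pauliP
  D := reflB
  a q j := fun i => i.σ.obsA (Function.update i.χ j (q.castLE (by norm_num))) j
  pauliFamily := pauliFamily
  mirror q j := by
    have h := mirror_update.{u, v} j (pauliIndex q)
    rwa [aliceBasis_pauliIndex] at h
  class0 j := by
    rw [reflB_eq]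
    change stateClass (((√2 : ℝ) : ℂ)⁻¹ • (pauliB 0 j + pauliB 1 j)) = _
    rw [map_smul, map_add]
    change _ • (pauliClass 0 j + pauliClass 1 j) = _ • (pauliClass 0 j + pauliClass 4 j)
    rw [pauliClass_eq (k := 1) (k' := 4) rfl]
  class1 j := by
    rw [reflB_eq]
    change stateClass (((√2 : ℝ) : ℂ)⁻¹ • (pauliB 0 j - pauliB 1 j)) = _
    rw [map_smul, map_sub]
    change _ • (pauliClass 0 j - pauliClass 1 j) = _ • (pauliClass 0 j - pauliClass 4 j)
    rw [pauliClass_eq (k := 1) (k' := 4) rfl]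
  class2 j := by
    rw [reflB_eq]
    change stateClass (((√2 : ℝ) : ℂ)⁻¹ • (pauliB 2 j + pauliB 3 j)) = _
    rw [map_smul, map_add]
    change _ • (pauliClass 2 j + pauliClass 3 j) = _ • (pauliClass 0 j + pauliClass 5 j)
    rw [pauliClass_eq (k := 2) (k' := 0) rfl, pauliClass_eq (k := 3) (k' := 5) rfl]
  class3 j := by
    rw [reflB_eq]
    change stateClass (((√2 : ℝ) : ℂ)⁻¹ • (pauliB 2 j - pauliB 3 j)) = _
    rw [map_smul, map_sub]
    change _ • (pauliClass 2 j - pauliClass 3 j) = _ • (pauliClass 0 j - pauliClass 5 j)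
    rw [pauliClass_eq (k := 2) (k' := 0) rfl, pauliClass_eq (k := 3) (k' := 5) rfl]
  class4 j := by
    rw [reflB_eq]
    change stateClass (((√2 : ℝ) : ℂ)⁻¹ • (pauliB 4 j + pauliB 5 j)) = _
    rw [map_smul, map_add]
    rfl
  norm_a q j i x :=
    norm_obs_apply (i.σ.isProjMeas_projA _ (mem_questionSet (removeAt_update_mem j _ i))) j x
  norm_D y j i x := i.σ.norm_obsB y j x

end Attaining

/-! ### Operators on Bob's registers -/

section onBob

variable {K L : Type*} [NormedAddCommGroup K] [InnerProductSpace ℂ K] [NormedAddCommGroup L]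
  [InnerProductSpace ℂ L] {A B : Type*} [NormedAddCommGroup A] [InnerProductSpace ℂ A]
  [NormedAddCommGroup B] [InnerProductSpace ℂ B]

lemma hmap_id_mapL_add (T T' : L →L[ℂ] L) (x : K ⊗ₕ (B ⊗[ℂ] L)) :
    hmap (.id ℂ K) (TensorProduct.mapL (.id ℂ B) (T + T')) x
      = hmap (.id ℂ K) (TensorProduct.mapL (.id ℂ B) T) x
        + hmap (.id ℂ K) (TensorProduct.mapL (.id ℂ B) T') x := by
  rw [TensorProduct.mapL_add_right, hmap_add_right, add_apply]

lemma hmap_id_mapL_smul (c : ℂ) (T : L →L[ℂ] L) (x : K ⊗ₕ (B ⊗[ℂ] L)) :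
    hmap (.id ℂ K) (TensorProduct.mapL (.id ℂ B) (c • T)) x
      = c • hmap (.id ℂ K) (TensorProduct.mapL (.id ℂ B) T) x := by
  rw [TensorProduct.mapL_smul_right, hmap_smul_right, smul_apply]

lemma norm_hmap_id_mapL_apply_le (T : L →L[ℂ] L) (x : K ⊗ₕ (B ⊗[ℂ] L)) :
    ‖hmap (.id ℂ K) (TensorProduct.mapL (.id ℂ B) T) x‖ ≤ ‖T‖ * ‖x‖ := by
  refine ContinuousLinearMap.le_of_opNorm_le _ ?_ x
  calc _ ≤ ‖ContinuousLinearMap.id ℂ K‖ * (‖ContinuousLinearMap.id ℂ B‖ * ‖T‖) :=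
        (norm_hmap_le _ _).trans (mul_le_mul_of_nonneg_left (TensorProduct.norm_mapL_le _ _)
          (norm_nonneg _))
    _ ≤ 1 * (1 * ‖T‖) := by
        gcongr
        · exact ContinuousLinearMap.norm_id_le
        · exact ContinuousLinearMap.norm_id_le
    _ = ‖T‖ := by rw [one_mul, one_mul]

lemma map_hmap_smul_add {H : Type*} [NormedAddCommGroup H] [NormedSpace ℂ H]
    (V : A ⊗ₕ B →L[ℂ] H) (c : ℂ) (T T' : B →L[ℂ] B) (x : A ⊗ₕ B) :
    V (hmap (.id ℂ A) (c • (T + T')) x)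
      = c • (V (hmap (.id ℂ A) T x) + V (hmap (.id ℂ A) T' x)) := by
  rw [hmap_smul_right, hmap_add_right, smul_apply, add_apply, map_smul, map_add]

lemma map_hmap_smul_sub {H : Type*} [NormedAddCommGroup H] [NormedSpace ℂ H]
    (V : A ⊗ₕ B →L[ℂ] H) (c : ℂ) (T T' : B →L[ℂ] B) (x : A ⊗ₕ B) :
    V (hmap (.id ℂ A) (c • (T - T')) x)
      = c • (V (hmap (.id ℂ A) T x) - V (hmap (.id ℂ A) T' x)) := by
  rw [hmap_smul_right, hmap_sub_right, smul_apply, sub_apply, map_smul, map_sub]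

lemma smul_add_sub_smul_add {H : Type*} [AddCommGroup H] [Module ℂ H] (c : ℂ) (x y z w : H) :
    c • (x + y) - c • (z + w) = c • (x - z + (y - w)) := by module

lemma smul_sub_sub_smul_sub {H : Type*} [AddCommGroup H] [Module ℂ H] (c : ℂ) (x y z w : H) :
    c • (x - y) - c • (z - w) = c • (x - z - (y - w)) := by module

variable {n : ℕ}

lemma onBob_add_apply (T T' : (Qubits n ⊗[ℂ] Qubits n) →L[ℂ] (Qubits n ⊗[ℂ] Qubits n))
    (x : WithAncillas n A ⊗ₕ WithAncillas n B) : onBob (A := A) (B := B) (T + T') x = onBob (A := A) (B := B) T x + onBob (A := A) (B := B) T' x :=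
  hmap_id_mapL_add T T' x

lemma onBob_smul_apply (c : ℂ) (T : (Qubits n ⊗[ℂ] Qubits n) →L[ℂ] (Qubits n ⊗[ℂ] Qubits n))
    (x : WithAncillas n A ⊗ₕ WithAncillas n B) : onBob (A := A) (B := B) (c • T) x = c • onBob (A := A) (B := B) T x :=
  hmap_id_mapL_smul c T x

lemma onBob_sub_apply (T T' : (Qubits n ⊗[ℂ] Qubits n) →L[ℂ] (Qubits n ⊗[ℂ] Qubits n))
    (x : WithAncillas n A ⊗ₕ WithAncillas n B) : onBob (A := A) (B := B) (T - T') x = onBob (A := A) (B := B) T x - onBob (A := A) (B := B) T' x := by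
  have h : T = (T - T') + T' := by abel
  rw [eq_sub_iff_add_eq, ← onBob_add_apply, ← h]

lemma norm_onBob_apply_le (T : (Qubits n ⊗[ℂ] Qubits n) →L[ℂ] (Qubits n ⊗[ℂ] Qubits n))
    (x : WithAncillas n A ⊗ₕ WithAncillas n B) : ‖onBob (A := A) (B := B) T x‖ ≤ ‖T‖ * ‖x‖ :=
  norm_hmap_id_mapL_apply_le T x

lemma singleRef_three (k : Fin n) :
    singleRef k 3 = ((√2 : ℝ) : ℂ)⁻¹ • (singleRef k 0 + singleRef k 1) := by
  have h : pauli 3 = ((√2 : ℝ) : ℂ)⁻¹ • (pauli 0 + pauli 1) := rfl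
  rw [singleRef, singleRef, singleRef, h, siteOp_smul, siteOp_add, if_neg (by decide),
    if_neg (by decide), if_neg (by decide), TensorProduct.mapL_smul_left,
    TensorProduct.mapL_add_left]

lemma singleRef_four (k : Fin n) :
    singleRef k 4 = ((√2 : ℝ) : ℂ)⁻¹ • (singleRef k 0 - singleRef k 1) := by
  have h : pauli 4 = ((√2 : ℝ) : ℂ)⁻¹ • (pauli 0 + (-1 : ℂ) • pauli 1) := by
    rw [neg_one_smul, ← sub_eq_add_neg]; rfl
  rw [singleRef, singleRef, singleRef, h, siteOp_smul, siteOp_add, siteOp_smul,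
    if_neg (by decide), if_neg (by decide), if_neg (by decide), TensorProduct.mapL_smul_left,
    TensorProduct.mapL_add_left, TensorProduct.mapL_smul_left, sub_eq_add_neg]
  congr 2
  module

lemma onBob_singleRef_three (k : Fin n) (x : WithAncillas n A ⊗ₕ WithAncillas n B) :
    onBob (A := A) (B := B) (singleRef k 3) x = ((√2 : ℝ) : ℂ)⁻¹ •
      (onBob (A := A) (B := B) (singleRef k 0) x + onBob (A := A) (B := B) (singleRef k 1) x) := by
  rw [singleRef_three]
  exact (onBob_smul_apply _ _ _).trans (congrArg _ (onBob_add_apply _ _ _))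

lemma onBob_singleRef_four (k : Fin n) (x : WithAncillas n A ⊗ₕ WithAncillas n B) :
    onBob (A := A) (B := B) (singleRef k 4) x = ((√2 : ℝ) : ℂ)⁻¹ •
      (onBob (A := A) (B := B) (singleRef k 0) x - onBob (A := A) (B := B) (singleRef k 1) x) := by
  rw [singleRef_four]
  exact (onBob_smul_apply _ _ _).trans (congrArg _ (onBob_sub_apply _ _ _))

lemma norm_localIsom (VA : A →ₗᵢ[ℂ] WithAncillas n A) (VB : B →ₗᵢ[ℂ] WithAncillas n B)
    (x : A ⊗ₕ B) : ‖localIsom VA VB x‖ = ‖x‖ :=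
  norm_hmap_eq VA.norm_map VB.norm_map x

end onBob

lemma insertAt_removeAt_eq_update {n : ℕ} (k : Fin n) (q : Fin 5) (x : Question n) :
    insertAt k q (removeAt k x) = Function.update x k q := by
  funext i
  by_cases h : i = k <;> simp [insertAt, removeAt, h]

open Classical in
/-- The multiple of `ξ` that yields a normalized reference state, or `ψ, 0` if there is none. -/
def normalizeJunk (n : ℕ) {A B : Type*} [NormedAddCommGroup A] [InnerProductSpace ℂ A]
    [NormedAddCommGroup B] [InnerProductSpace ℂ B] (ψ : A ⊗ₕ B) (ξ : Fin 2 → A ⊗ₕ B) :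
    Fin 2 → A ⊗ₕ B :=
  if refState (n := n) ξ = 0 then ![ψ, 0] else ((‖refState (n := n) ξ‖⁻¹ : ℝ) : ℂ) • ξ

/-! ### Uniform certification of the single observables and normalization of the junk -/

namespace Attaining

variable {n : ℕ} (hn : 0 < n)

/-- The local isometries of the swap. -/
def isom (i : Attaining.{u, v} n) :
    i.A ⊗ₕ i.B →L[ℂ] WithAncillas n i.A ⊗ₕ WithAncillas n i.B :=
  localIsom ((swapData hn).isomA i) ((swapData hn).isomB i)

/-- The junk vectors before normalization. -/
def rawJunk (i : Attaining.{u, v} n) : Fin 2 → i.A ⊗ₕ i.B :=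
  ((√2 : ℝ) : ℂ) ^ n • (swapData hn).junk i

lemma norm_isom (i : Attaining.{u, v} n) (x : i.A ⊗ₕ i.B) : ‖isom hn i x‖ = ‖x‖ :=
  norm_localIsom _ _ x

lemma observable_mem_smallFam_of_sub {k : Fin n} {q : Fin 5}
    {T : ∀ i : Attaining.{u, v} n, i.B →L[ℂ] i.B}
    (h1 : (fun i => hmap (i.σ.obsAt k q (removeAt k i.χ)) (.id ℂ i.B) i.state
      - hmap (.id ℂ i.A) (T i) i.state) ∈ smallFam (fun i => i.A ⊗ₕ i.B) err)
    (h2 : (fun i => isom hn i (hmap (.id ℂ i.A) (T i) i.state)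
      - onBob (A := i.A) (B := i.B) (singleRef k q) (refState (rawJunk hn i))) ∈
      smallFam (fun i => WithAncillas n i.A ⊗ₕ WithAncillas n i.B) err) :
    (fun i : Attaining.{u, v} n => isom hn i
        (hmap (i.σ.obsAt k q (removeAt k i.χ)) (.id ℂ i.B) i.state)
      - onBob (A := i.A) (B := i.B) (singleRef k q) (refState (rawJunk hn i))) ∈
      smallFam (fun i => WithAncillas n i.A ⊗ₕ WithAncillas n i.B) err := by
  convert add_mem (apply_mem_smallFam (mem_boundedFam_of_norm_map (norm_isom hn)) h1) h2 using 1
  funext i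
  simp only [Pi.add_apply, map_sub]
  abel

lemma pauliP_mem_smallFam (k : Fin n) (q : Fin 3) :
    (fun i : Attaining.{u, v} n => isom hn i (hmap (.id ℂ i.A) ((pauliP q k).1 i) i.state)
      - onBob (A := i.A) (B := i.B) (singleRef k (q.castLE (by norm_num)))
        (refState (rawJunk hn i))) ∈
      smallFam (fun i : Attaining.{u, v} n => WithAncillas n i.A ⊗ₕ WithAncillas n i.B) err :=
  (swapData hn).pauli_mem_smallFam q k

/-- Bob's observable is exactly the normalized sum of his x and y operators, and the reference
observable is the same combination, so linearity suffices. -/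
lemma obsB_four_mem_smallFam (k : Fin n) :
    (fun i : Attaining.{u, v} n => isom hn i (hmap (.id ℂ i.A) (i.σ.obsB 4 k) i.state)
      - onBob (A := i.A) (B := i.B) (singleRef k 3) (refState (rawJunk hn i))) ∈
      smallFam (fun i : Attaining.{u, v} n => WithAncillas n i.A ⊗ₕ WithAncillas n i.B) err := by
  convert Submodule.smul_mem _ ((√2 : ℝ) : ℂ)⁻¹ (add_mem (pauliP_mem_smallFam.{u, v} hn k 0)
    (pauliP_mem_smallFam.{u, v} hn k 1)) using 1
  funext i
  have h4 : i.σ.obsB 4 k = ((√2 : ℝ) : ℂ)⁻¹ • ((pauliP 0 k).1 i + (pauliP 1 k).1 i) :=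
    obsB_eq i.σ 4 k
  rw [h4]
  exact (congrArg₂ (· - ·) (map_hmap_smul_add _ _ _ _ _) (onBob_singleRef_three k _)).trans
    (smul_add_sub_smul_add _ _ _ _ _)

lemma obsB_five_mem_smallFam (k : Fin n) :
    (fun i : Attaining.{u, v} n => isom hn i (hmap (.id ℂ i.A) (i.σ.obsB 5 k) i.state)
      - onBob (A := i.A) (B := i.B) (singleRef k 4) (refState (rawJunk hn i))) ∈
      smallFam (fun i : Attaining.{u, v} n => WithAncillas n i.A ⊗ₕ WithAncillas n i.B) err := by
  convert Submodule.smul_mem _ ((√2 : ℝ) : ℂ)⁻¹ (sub_mem (pauliP_mem_smallFam.{u, v} hn k 0)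
    (pauliP_mem_smallFam.{u, v} hn k 1)) using 1
  funext i
  have h5 : i.σ.obsB 5 k = ((√2 : ℝ) : ℂ)⁻¹ • ((pauliP 0 k).1 i - (pauliP 1 k).1 i) :=
    obsB_eq i.σ 5 k
  rw [h5]
  exact (congrArg₂ (· - ·) (map_hmap_smul_sub _ _ _ _ _) (onBob_singleRef_four k _)).trans
    (smul_sub_sub_smul_sub _ _ _ _ _)

/-- Alice's observable is first replaced by an operator of Bob: for x, y, z by the CHSH bound, for x
± y by the requested direct correlations. -/
lemma observable_mem_smallFam (k : Fin n) (q : Fin 5) :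
    (fun i : Attaining.{u, v} n => isom hn i
        (hmap (i.σ.obsAt k q (removeAt k i.χ)) (.id ℂ i.B) i.state)
      - onBob (A := i.A) (B := i.B) (singleRef k q) (refState (rawJunk hn i))) ∈
      smallFam (fun i => WithAncillas n i.A ⊗ₕ WithAncillas n i.B) err := by
  have hm : ∀ q : Fin 3, (fun i => hmap (i.σ.obsAt k (q.castLE (by norm_num)) (removeAt k i.χ))
      (.id ℂ i.B) i.state - hmap (.id ℂ i.A) ((pauliP q k).1 i) i.state) ∈
      smallFam (fun i : Attaining.{u, v} n => i.A ⊗ₕ i.B) err := fun q => by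
    simp only [Strategy.obsAt, insertAt_removeAt_eq_update]
    exact ((swapData hn).mirror q k).small
  match q with
  | 0 => exact observable_mem_smallFam_of_sub hn (hm 0) (pauliP_mem_smallFam hn k 0)
  | 1 => exact observable_mem_smallFam_of_sub hn (hm 1) (pauliP_mem_smallFam hn k 1)
  | 2 => exact observable_mem_smallFam_of_sub hn (hm 2) (pauliP_mem_smallFam hn k 2)
  | 3 =>
    exact observable_mem_smallFam_of_sub hn
      (mem_smallFam_of_sq_le 2 fun i => i.attains.norm_sub_obsB_four i.mem k)
      (obsB_four_mem_smallFam hn k)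
  | 4 =>
    exact observable_mem_smallFam_of_sub hn
      (mem_smallFam_of_sq_le 2 fun i => i.attains.norm_sub_obsB_five i.mem k)
      (obsB_five_mem_smallFam hn k)

/-- The normalized junk vectors. -/
def junk (i : Attaining.{u, v} n) : Fin 2 → i.A ⊗ₕ i.B :=
  normalizeJunk n i.state (rawJunk hn i)

lemma norm_refState_junk (i : Attaining.{u, v} n) : ‖refState (n := n) (junk hn i)‖ = 1 := by
  unfold junk normalizeJunk
  split_ifs with h
  · have h1 := norm_sq_refState hn ![i.state, 0]
    have h2 : ‖i.state‖ = 1 := i.σ.norm_ψ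
    simp only [Matrix.cons_val_zero, Matrix.cons_val_one, h2, norm_zero] at h1
    rw [← Real.sqrt_sq (norm_nonneg (refState _)), h1]
    norm_num
  · rw [refState_smul, norm_smul, Complex.norm_real, norm_inv, norm_norm,
      inv_mul_cancel₀ (norm_ne_zero_iff.2 h)]

/-- The distance from a nonzero vector `R` to its normalization is the deviation of its norm from
one. The swapped state is a unit vector, so the reverse triangle inequality bounds this deviation.
-/
lemma norm_rawJunk_sub_junk_le (i : Attaining.{u, v} n) :
    ‖refState (n := n) (rawJunk hn i) - refState (junk hn i)‖
      ≤ ‖isom hn i i.state - refState (rawJunk hn i)‖ := by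
  have hV : ‖isom hn i i.state‖ = 1 := (norm_isom hn i _).trans i.σ.norm_ψ
  by_cases h : refState (n := n) (rawJunk hn i) = 0
  -- If the raw reference state vanishes, both sides are equal to one, whatever unit junk has been
  -- substituted.
  · rw [h, zero_sub, norm_neg, norm_refState_junk, sub_zero, hV]
  · rw [junk, normalizeJunk, if_neg h, refState_smul]
    set R := refState (n := n) (rawJunk hn i)
    have e : R - ((‖R‖⁻¹ : ℝ) : ℂ) • R = ((1 - ‖R‖⁻¹ : ℝ) : ℂ) • R := by
      rw [Complex.ofReal_sub, sub_smul, Complex.ofReal_one, one_smul]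
    rw [e, norm_smul, Complex.norm_real, Real.norm_eq_abs, ← abs_norm R, ← abs_mul, abs_norm,
      sub_mul, one_mul, inv_mul_cancel₀ (norm_ne_zero_iff.2 h), abs_sub_comm, ← hV]
    exact abs_norm_sub_norm_le _ _

/-- All requested approximations hold with a common constant. -/
lemma exists_constant : ∃ C : ℝ≥0, ∀ i : Attaining.{u, v} n,
    ‖isom hn i i.state - refState (junk hn i)‖ ≤ C * √i.ε ∧
    ∀ (k : Fin n) (q : Fin 5),
      ‖isom hn i (hmap (i.σ.obsAt k q (removeAt k i.χ)) (.id ℂ i.B) i.state)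
        - onBob (A := i.A) (B := i.B) (singleRef k q) (refState (junk hn i))‖ ≤ C * √i.ε := by
  obtain ⟨C₀, hC₀⟩ : (fun i : Attaining.{u, v} n => isom hn i i.state
      - refState (rawJunk hn i)) ∈ smallFam _ err := (swapData hn).state_mem_smallFam
  choose C hC using fun (k : Fin n) (q : Fin 5) => observable_mem_smallFam.{u, v} hn k q
  simp only [err] at hC₀ hC
  have hsum : ∀ k q, |C k q| + ‖singleRef (n := n) k q‖ * |C₀| ≤
      ∑ p : Fin n × Fin 5, (|C p.1 p.2| + ‖singleRef (n := n) p.1 p.2‖ * |C₀|) := fun k q =>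
    Finset.single_le_sum (f := fun p : Fin n × Fin 5 =>
      |C p.1 p.2| + ‖singleRef (n := n) p.1 p.2‖ * |C₀|) (fun p _ => by positivity)
      (Finset.mem_univ (k, q))
  have hnn : 0 ≤ ∑ p : Fin n × Fin 5, (|C p.1 p.2| + ‖singleRef (n := n) p.1 p.2‖ * |C₀|) :=
    Finset.sum_nonneg fun p _ => by positivity
  -- The state costs `|C₀|` for the swap and again for the normalization. For an observable the
  -- normalization error is multiplied by the norm of the reference operator; the sum dominates all
  -- finitely many cases.
  refine ⟨NNReal.mk (2 * |C₀| + ∑ p : Fin n × Fin 5, (|C p.1 p.2| + ‖singleRef (n := n) p.1 p.2‖ * |C₀|))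
    (by positivity), fun i => ?_⟩
  have hs : 0 ≤ √(i.ε : ℝ) := Real.sqrt_nonneg _
  have h0 : ‖isom hn i i.state - refState (rawJunk hn i)‖ ≤ |C₀| * √i.ε :=
    (hC₀ i).trans (mul_le_mul_of_nonneg_right (le_abs_self _) hs)
  have h1 := (norm_rawJunk_sub_junk_le hn i).trans h0
  rw [NNReal.coe_mk]
  refine ⟨?_, fun k q => ?_⟩
  · calc _ ≤ ‖isom hn i i.state - refState (rawJunk hn i)‖
          + ‖refState (n := n) (rawJunk hn i) - refState (junk hn i)‖ :=
          norm_sub_le_norm_sub_add_norm_sub _ _ _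
      _ ≤ |C₀| * √i.ε + |C₀| * √i.ε := add_le_add h0 h1
      _ ≤ _ := by
        rw [add_mul]
        have := mul_nonneg hnn hs
        linarith
  · calc _ ≤ ‖isom hn i (hmap (i.σ.obsAt k q (removeAt k i.χ)) (.id ℂ i.B) i.state)
          - onBob (A := i.A) (B := i.B) (singleRef k q) (refState (rawJunk hn i))‖
          + ‖onBob (A := i.A) (B := i.B) (singleRef k q) (refState (n := n) (rawJunk hn i))
            - onBob (A := i.A) (B := i.B) (singleRef k q) (refState (junk hn i))‖ :=
          norm_sub_le_norm_sub_add_norm_sub _ _ _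
      _ ≤ |C k q| * √i.ε + ‖singleRef (n := n) k q‖ * (|C₀| * √i.ε) := by
        refine add_le_add ((hC k q i).trans
          (mul_le_mul_of_nonneg_right (le_abs_self _) hs)) ?_
        rw [← map_sub]
        exact (norm_onBob_apply_le _ _).trans
          (mul_le_mul_of_nonneg_left h1 (by positivity))
      _ ≤ _ := by
        have := mul_le_mul_of_nonneg_right (hsum k q) hs
        have := mul_nonneg (abs_nonneg C₀) hs
        linarith

end Attaining

/-! ### Product observables -/

lemma ofFn_prod_update {M : Type*} [Monoid M] {n : ℕ} (f : Fin n → M) (m : Fin n)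
    (h : ∀ j ≤ m, f j = 1) (a : M) :
    (List.ofFn (Function.update f m a)).prod = a * (List.ofFn f).prod := by
  induction n with
  | zero => exact m.elim0
  | succ n ih =>
    cases m using Fin.cases with
    | zero =>
      have h0 := h 0 le_rfl
      simp [List.ofFn_succ, h0]
    | succ m =>
      have h0 := h 0 (Fin.zero_le _)
      have e : (fun j : Fin n => Function.update f m.succ a j.succ)
          = Function.update (fun j => f j.succ) m a := by
        funext j
        by_cases hj : j = m <;> simp [hj]
      rw [List.ofFn_succ, List.ofFn_succ, e, List.prod_cons, List.prod_cons,
        ih _ m fun j hj => h j.succ (Fin.succ_le_succ_iff.2 hj), h0]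
      simp [h0, (Fin.succ_ne_zero m).symm]

section reference

variable {n : ℕ}

lemma logicalProj_mul (hn : 0 < n) (b c : Fin 2) :
    logicalProj n b * logicalProj n c = if b = c then logicalProj n b else 0 := by
  rw [logicalProj, logicalProj, ← map_mul]
  split_ifs with h
  · subst h
    rw [Matrix.single_mul_single_same, mul_one]
  · rw [Matrix.single_mul_single_of_ne _ _ _ _ fun e => h (logical_injective hn e), map_zero]

lemma tensorOp_pow_mul_siteOp (M : Fin n → Matrix (Fin 2) (Fin 2) ℂ) {s : Fin n → Fin 2}
    {m : Fin n} (h : s m = 0) :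
    tensorOp (fun j => M j ^ (s j : ℕ)) * siteOp m (M m)
      = tensorOp fun j => M j ^ (Function.update s m 1 j : ℕ) := by
  rw [siteOp, tensorOp_mul]
  congr 1
  funext j
  by_cases hj : j = m
  · subst hj
    simp [h]
  · simp [hj]

/-- On the branch `|1⟩` the logical σ_z contributes `-1` precisely when the basis is z, which is the
sign by which the conjugate of the Pauli operator differs from the operator itself. -/
lemma productRef_mul_singleRef (hn : 0 < n) (χ : Question n) {s : Fin n → Fin 2} {m : Fin n}
    (h : s m = 0) :
    productRef χ s * singleRef m (χ m) = productRef χ (Function.update s m 1) := by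
  have e0 := tensorOp_pow_mul_siteOp (fun j => pauli (χ j)) h
  have e1 := tensorOp_pow_mul_siteOp (fun j => conjOp (pauli (χ j))) h
  rw [productRef, singleRef, add_mul, ← TensorProduct.mapL_mul, ← TensorProduct.mapL_mul,
    productRef, ← e0, ← e1, conjOp_pauli]
  split_ifs with hq
  · have h1 : logicalProj n 0 * logicalZ n = logicalProj n 0 := by
      rw [logicalZ, mul_sub, logicalProj_mul hn, logicalProj_mul hn, if_pos rfl,
        if_neg (by decide), sub_zero]
    have h2 : logicalProj n 1 * logicalZ n = (-1 : ℂ) • logicalProj n 1 := by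
      rw [logicalZ, mul_sub, logicalProj_mul hn, logicalProj_mul hn, if_pos rfl,
        if_neg (by decide), zero_sub]
      exact (neg_one_smul ℂ _).symm
    rw [h1, h2, ← neg_one_smul ℂ (pauli (χ m)), siteOp_smul, mul_smul_comm,
      TensorProduct.mapL_smul_left, TensorProduct.mapL_smul_right]
  · rfl

variable {A B : Type*} [NormedAddCommGroup A] [InnerProductSpace ℂ A] [NormedAddCommGroup B]
  [InnerProductSpace ℂ B]

/-- For `s = 0` the operator projects the second register onto the span of the two logical states.
It need not be the identity, but it fixes the reference state. -/
lemma onBob_productRef_zero (hn : 0 < n) (χ : Question n) (ξ : Fin 2 → A ⊗ₕ B) :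
    onBob (A := A) (B := B) (productRef χ 0) (refState ξ) = refState ξ := by
  have h : ∀ (z : Fin n → Fin 2) (b : Fin 2), productRef χ 0 (ket z ⊗ₜ ket (logical n b))
      = ket z ⊗ₜ ket (logical n b) := by
    intro z b
    simp only [productRef, Pi.zero_apply, Fin.val_zero, pow_zero, tensorOp_one, add_apply,
      TensorProduct.mapL_tmul, logicalProj_ket hn]
    fin_cases b <;> simp
  rw [refState_eq]
  simp only [map_sum, map_smul]
  refine Finset.sum_congr rfl fun b _ => Finset.sum_congr rfl fun z _ => ?_
  congr 1
  exact (onBob_registers _ _ _ _).trans (by rw [h])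

end reference

/-! ### Left inverses of isometries -/

section leftInverse

variable {A K : Type*} [NormedAddCommGroup A] [InnerProductSpace ℂ A] [CompleteSpace A]
  [NormedAddCommGroup K] [InnerProductSpace ℂ K]

/-- An isometry of a complete space has a contractive left inverse. -/
lemma exists_leftInverse (V : A →ₗᵢ[ℂ] K) :
    ∃ L : K →L[ℂ] A, ‖L‖ ≤ 1 ∧ ∀ x, L (V x) = x := by
  have hc : CompleteSpace (LinearMap.range V.toLinearMap) :=
    V.equivRange.symm.toIsometryEquiv.completeSpace
  refine ⟨V.equivRange.symm.toContinuousLinearEquiv.toContinuousLinearMap.comp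
    (LinearMap.range V.toLinearMap).orthogonalProjectionOnto, ?_, fun x => ?_⟩
  · refine ContinuousLinearMap.opNorm_le_bound _ zero_le_one fun y => ?_
    change ‖V.equivRange.symm _‖ ≤ _
    rw [LinearIsometryEquiv.norm_map]
    exact (ContinuousLinearMap.le_of_opNorm_le _ (Submodule.orthogonalProjectionOnto_norm_le _) y)
  · change V.equivRange.symm _ = x
    rw [LinearIsometryEquiv.symm_apply_eq]
    exact Submodule.orthogonalProjectionOnto_mem_subspace_eq_self (V.equivRange x)

end leftInverse

/-! ### From single observables to product observables -/

section products

variable {K L A B : Type*} [NormedAddCommGroup K] [InnerProductSpace ℂ K] [NormedAddCommGroup L]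
  [InnerProductSpace ℂ L] [NormedAddCommGroup A] [InnerProductSpace ℂ A] [CompleteSpace A]
  [NormedAddCommGroup B] [InnerProductSpace ℂ B]

/-- If `V O ψ ≈ T' R`, `V a ψ ≈ T R` and `V ψ ≈ R` then `V a O ψ ≈ T' T R`. -/
lemma norm_mul_sub_le {VA : A →ₗᵢ[ℂ] K} {VB : B →L[ℂ] B ⊗[ℂ] L} {a O : A →L[ℂ] A}
    (ha : ‖a‖ ≤ 1) {T T' : L →L[ℂ] L} {ψ : A ⊗ₕ B} {R : K ⊗ₕ (B ⊗[ℂ] L)} {δ e : ℝ}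
    (h0 : ‖hmap VA.toContinuousLinearMap VB ψ - R‖ ≤ δ)
    (h1 : ‖hmap VA.toContinuousLinearMap VB (hmap a (.id ℂ B) ψ)
      - hmap (.id ℂ K) (TensorProduct.mapL (.id ℂ B) T) R‖ ≤ δ)
    (h2 : ‖hmap VA.toContinuousLinearMap VB (hmap O (.id ℂ B) ψ)
      - hmap (.id ℂ K) (TensorProduct.mapL (.id ℂ B) T') R‖ ≤ e) :
    ‖hmap VA.toContinuousLinearMap VB (hmap (a * O) (.id ℂ B) ψ)
      - hmap (.id ℂ K) (TensorProduct.mapL (.id ℂ B) (T' * T)) R‖ ≤ e + 2 * ‖T'‖ * δ := by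
  obtain ⟨M, hM, hMV⟩ := exists_leftInverse VA
  -- The operator `a` transported to the large space of Alice: a contraction that satisfies `a' V =
  -- V a` and commutes with everything on Bob's side.
  set a' : K →L[ℂ] K := VA.toContinuousLinearMap.comp (a.comp M) with ha'
  have hcomp : a'.comp VA.toContinuousLinearMap = VA.toContinuousLinearMap.comp a := by
    ext x
    simp [ha', hMV]
  have hnorm : ∀ x, ‖hmap a' (.id ℂ (B ⊗[ℂ] L)) x‖ ≤ ‖x‖ := by
    intro x
    have h : ‖a'‖ ≤ 1 := ContinuousLinearMap.opNorm_le_bound _ zero_le_one fun y => by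
      rw [one_mul]
      change ‖VA (a (M y))‖ ≤ _
      rw [VA.norm_map]
      simpa using (a.le_of_opNorm_le ha _).trans
        (mul_le_mul_of_nonneg_left (M.le_of_opNorm_le hM y) zero_le_one)
    have h' : ‖hmap a' (.id ℂ (B ⊗[ℂ] L))‖ ≤ 1 := (norm_hmap_le _ _).trans
      (mul_le_one₀ h (norm_nonneg _) ContinuousLinearMap.norm_id_le)
    simpa using ContinuousLinearMap.le_of_opNorm_le _ h' x
  have hV : ∀ O' : A →L[ℂ] A, hmap VA.toContinuousLinearMap VB (hmap (a * O') (.id ℂ B) ψ)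
      = hmap a' (.id ℂ (B ⊗[ℂ] L))
        (hmap VA.toContinuousLinearMap VB (hmap O' (.id ℂ B) ψ)) := by
    intro O'
    rw [hmap_hmap, hmap_hmap, hmap_hmap, hcomp, ContinuousLinearMap.id_comp]
    rfl
  have hV1 : hmap VA.toContinuousLinearMap VB (hmap a (.id ℂ B) ψ)
      = hmap a' (.id ℂ (B ⊗[ℂ] L)) (hmap VA.toContinuousLinearMap VB ψ) := by
    rw [hmap_hmap, hmap_hmap, hcomp, ContinuousLinearMap.id_comp, ContinuousLinearMap.comp_id]
  have hc : ∀ x, hmap a' (.id ℂ (B ⊗[ℂ] L)) (hmap (.id ℂ K) (TensorProduct.mapL (.id ℂ B) T') x)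
      = hmap (.id ℂ K) (TensorProduct.mapL (.id ℂ B) T') (hmap a' (.id ℂ (B ⊗[ℂ] L)) x) := by
    intro x
    rw [hmap_hmap, hmap_hmap, ContinuousLinearMap.id_comp, ContinuousLinearMap.comp_id,
      ContinuousLinearMap.id_comp, ContinuousLinearMap.comp_id]
  have hT : hmap (.id ℂ K) (TensorProduct.mapL (.id ℂ B) (T' * T)) R
      = hmap (.id ℂ K) (TensorProduct.mapL (.id ℂ B) T')
        (hmap (.id ℂ K) (TensorProduct.mapL (.id ℂ B) T) R) := by
    rw [hmap_hmap, ← TensorProduct.mapL_comp, ContinuousLinearMap.id_comp,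
      ContinuousLinearMap.id_comp]
    rfl
  -- The chain is `V a O ψ = a' V O ψ ≈ a' T' R = T' a' R ≈ T' a' V ψ = T' V a ψ ≈ T' T R`. The
  -- first approximation costs `e`, the other two cost `‖T'‖ δ` each.
  have e1 := (hnorm _).trans h2
  have e2 := (norm_hmap_id_mapL_apply_le T' _).trans
    (mul_le_mul_of_nonneg_left ((hnorm _).trans h0) (norm_nonneg T'))
  have e3 := (norm_hmap_id_mapL_apply_le T' _).trans
    (mul_le_mul_of_nonneg_left h1 (norm_nonneg T'))
  rw [map_sub, ← hV, hc] at e1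
  rw [map_sub, map_sub, ← hV1] at e2
  rw [map_sub, ← hT] at e3
  calc _ ≤ _ := norm_sub_le_norm_sub_add_norm_sub _ _ _
    _ ≤ _ := add_le_add e1 (norm_sub_le_norm_sub_add_norm_sub _ _ _)
    _ ≤ e + (‖T'‖ * δ + ‖T'‖ * δ) := by
      refine add_le_add le_rfl (add_le_add ?_ e3)
      rw [norm_sub_rev]
      exact e2
    _ = _ := by ring

end products

/-! ### Induction over the positions of a product observable -/

namespace Strategy

variable {n : ℕ} {S : Set (Question n)} {A B : Type*}
  [NormedAddCommGroup A] [InnerProductSpace ℂ A] [CompleteSpace A]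
  [NormedAddCommGroup B] [InnerProductSpace ℂ B] [CompleteSpace B] (σ : Strategy n S A B)

lemma obsProd_zero (χ : Question n) : σ.obsProd χ 0 = 1 := by
  simp [obsProd]

lemma obsProd_update (χ : Question n) {s : Fin n → Fin 2} {m : Fin n} (h : ∀ j ≤ m, s j = 0) :
    σ.obsProd χ (Function.update s m 1) = σ.obsA χ m * σ.obsProd χ s := by
  rw [obsProd, obsProd, ← ofFn_prod_update _ m]
  · congr 2
    funext j
    by_cases hj : j = m
    · subst hj
      simp
    · simp [hj]
  · intro j hj
    simp [h j hj]

/-- The norms of the reference product operators. -/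
def productNorm (p : Question n × (Fin n → Fin 2)) : ℝ := ‖productRef p.1 p.2‖

lemma productNorm_nonneg (p : Question n × (Fin n → Fin 2)) : 0 ≤ productNorm p :=
  ContinuousLinearMap.opNorm_nonneg _

/-- A bound for all reference product operators. -/
def productBound (n : ℕ) : ℝ := ∑ p : Question n × (Fin n → Fin 2), productNorm p

lemma productBound_nonneg (n : ℕ) : 0 ≤ productBound n :=
  Finset.sum_nonneg fun p _ => productNorm_nonneg p

lemma norm_productRef_le (χ : Question n) (s : Fin n → Fin 2) :
    ‖productRef χ s‖ ≤ productBound n := by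
  have h : productNorm (χ, s) ≤ productBound n :=
    Finset.single_le_sum (fun p _ => productNorm_nonneg p) (Finset.mem_univ _)
  exact h

variable {σ}

lemma CertifiesSingle.certifiesProducts (hn : 0 < n) {ξ : Fin 2 → A ⊗ₕ B}
    {VA : Question n → A →ₗᵢ[ℂ] WithAncillas n A} {VB : B →ₗᵢ[ℂ] WithAncillas n B} {δ : ℝ}
    (hδ : 0 ≤ δ) (h : σ.CertifiesSingle ξ VA VB δ) :
    σ.CertifiesProducts ξ VA VB ((1 + n * (2 * productBound n)) * δ) := by
  intro χ hχ s
  have hP := σ.isProjMeas_projA χ (mem_questionSet (j := ⟨0, hn⟩)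
    (removeAt_mem_shortQuestionSet hχ _))
  -- Induction on the number `k` of trailing positions that may carry an exponent. A new observable
  -- is then always the leftmost factor of the ordered product, and each step adds at most `2 *
  -- productBound n * δ`.
  have key : ∀ (k : ℕ) (_ : k ≤ n) (s : Fin n → Fin 2) (_ : ∀ j : Fin n, j + k < n → s j = 0),
      ‖localIsom (VA χ) VB (hmap (σ.obsProd χ s) (.id ℂ B) σ.ψ)
        - onBob (A := A) (B := B) (productRef χ s) (refState ξ)‖
        ≤ (1 + k * (2 * productBound n)) * δ := by
    intro k
    induction k with
    | zero =>
      intro _ s hs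
      have h0 : s = 0 := funext fun j => hs j j.2
      have e : hmap (1 : A →L[ℂ] A) (.id ℂ B) σ.ψ = σ.ψ :=
        congrArg (fun T : A ⊗ₕ B →L[ℂ] A ⊗ₕ B => T σ.ψ) hmap_id_id
      rw [h0, obsProd_zero, onBob_productRef_zero hn, e]
      simpa using h.state χ hχ
    | succ k ih =>
      intro hk s hs
      set m : Fin n := ⟨n - (k + 1), by omega⟩ with hm
      have hle : (1 + k * (2 * productBound n)) * δ
          ≤ (1 + (k + 1 : ℕ) * (2 * productBound n)) * δ := by
        have := productBound_nonneg n
        gcongr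
        exact k.le_succ
      rcases Fin.exists_fin_two.1 ⟨s m, rfl⟩ with h0 | h1
      · refine (ih (by omega) s fun j hj => ?_).trans hle
        rcases Nat.lt_or_ge (j + (k + 1)) n with hj' | hj'
        · exact hs j hj'
        · have : j = m := Fin.ext (by simp only [hm]; omega)
          rw [this, h0]
      · set s' := Function.update s m 0 with hs'
        have hs0 : ∀ j ≤ m, s' j = 0 := by
          intro j hj
          by_cases hjm : j = m
          · simp [hs', hjm]
          · have hlt : (j : ℕ) < n - (k + 1) := lt_of_le_of_ne hj fun e => hjm (Fin.ext e)
            rw [hs', Function.update_of_ne hjm]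
            exact hs j (by omega)
        have hs1 : s = Function.update s' m 1 := by
          rw [hs', Function.update_idem, ← h1, Function.update_eq_self]
        have hobs : σ.obsAt m (χ m) (removeAt m χ) = σ.obsA χ m := by
          rw [obsAt, insertAt_removeAt]
        have h2 := h.observable χ hχ m (χ m)
        rw [hobs] at h2
        have h3 := ih (by omega) s' fun j hj => hs0 j (by
          rw [Fin.le_def]; simp only [hm]; omega)
        rw [hs1, σ.obsProd_update χ hs0, ← productRef_mul_singleRef hn χ (hs0 m le_rfl)]
        have ha : ‖σ.obsA χ m‖ ≤ 1 := ContinuousLinearMap.opNorm_le_bound _ zero_le_one fun x => by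
          rw [one_mul]; exact (norm_obs_apply hP m x).le
        refine (norm_mul_sub_le ha (h.state χ hχ) h2 h3).trans ?_
        have h4 := mul_le_mul_of_nonneg_right (norm_productRef_le χ s') hδ
        push_cast
        linarith
  exact key n le_rfl s fun j hj => absurd hj (by omega)

end Strategy

section

variable {ι : Type*} {A B : ι → Type*} [∀ i, NormedAddCommGroup (A i)]
  [∀ i, InnerProductSpace ℂ (A i)] [∀ i, NormedAddCommGroup (B i)]
  [∀ i, InnerProductSpace ℂ (B i)] {ψ : ∀ i, A i ⊗ₕ B i} {η : ι → ℝ} {n : ℕ}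

lemma SwapData.junkOp_apply (s : SwapData n ψ η) (i : ι) (b : Fin 2) :
    (s.junkOp b).1 i = flagPart (flagWord fun y => (s.D y ⟨0, s.pos⟩).1 i) b
      * swapWord (fun j => sgnWord fun y => (s.D y j).1 i)
        (fun j => flipWord fun y => (s.D y j).1 i) 0 := by
  rw [SwapData.junkOp, ← evalMirrored_apply, map_mul, map_flagPart, map_swapWord, map_flagWord]
  simp only [map_sgnWord, map_flipWord, evalMirrored_apply]

end

/-! ### One isometry of Bob and one junk state for all special questions -/

namespace Attaining

variable {n : ℕ} (hn : 0 < n)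

/-- The right-hand side involves only the strategy and not the special question of the index, so the
junk is shared by all special questions. -/
lemma rawJunk_eq (i : Attaining.{u, v} n) : rawJunk hn i = ((√2 : ℝ) : ℂ) ^ n • fun b =>
    hmap (.id ℂ _) (flagPart (flagWord fun y => i.σ.obsB y ⟨0, hn⟩) b
      * swapWord (fun j => sgnWord fun y => i.σ.obsB y j)
        (fun j => flipWord fun y => i.σ.obsB y j) 0) i.σ.ψ := by
  rw [rawJunk]
  congr 1
  funext b
  rw [SwapData.junk, SwapData.junkOp_apply]
  rfl

open Classical in
include hn in
lemma exists_certifiesSingle : ∃ C : ℝ≥0, ∀ (ε : ℝ≥0) (S : Set (Question n))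
    (A : Type u) [NormedAddCommGroup A] [InnerProductSpace ℂ A] [CompleteSpace A]
    (B : Type v) [NormedAddCommGroup B] [InnerProductSpace ℂ B] [CompleteSpace B]
    (σ : Strategy n S A B), σ.AttainsRequested ε →
    ∃ (ξ : Fin 2 → A ⊗ₕ B) (VA : Question n → A →ₗᵢ[ℂ] WithAncillas n A)
      (VB : B →ₗᵢ[ℂ] WithAncillas n B), σ.CertifiesSingle ξ VA VB (C * √ε) := by
  obtain ⟨C, hC⟩ := exists_constant.{u, v} hn
  refine ⟨C, fun ε S A _ _ _ B _ _ _ σ h => ?_⟩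
  let i : ∀ χ ∈ S, Attaining.{u, v} n := fun χ hχ => .mk ε S A B σ h χ hχ
  -- The conjugation correlations guarantee that `S` is nonempty. The question found here fixes the
  -- common data and also serves as default for Alice's isometry outside `S`.
  obtain ⟨χ₀, hχ₀, -⟩ := h.conj
  have hB : ∀ χ (hχ : χ ∈ S), (swapData hn).isomB (i χ hχ) = (swapData hn).isomB (i χ₀ hχ₀) :=
    fun χ hχ => rfl
  have hJ : ∀ χ (hχ : χ ∈ S), junk hn (i χ hχ) = junk hn (i χ₀ hχ₀) := by
    intro χ hχ
    refine congrArg (fun ξ : Fin 2 → A ⊗ₕ B => normalizeJunk n σ.ψ ξ) ?_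
    exact (rawJunk_eq hn (i χ hχ)).trans (rawJunk_eq hn (i χ₀ hχ₀)).symm
  refine ⟨junk hn (i χ₀ hχ₀), fun χ => if hχ : χ ∈ S then (swapData hn).isomA (i χ hχ)
    else (swapData hn).isomA (i χ₀ hχ₀), (swapData hn).isomB (i χ₀ hχ₀), ?_, fun χ hχ => ?_,
    fun χ hχ k q => ?_⟩
  · have h1 := norm_sq_refState hn (junk hn (i χ₀ hχ₀))
    rw [norm_refState_junk] at h1
    exact h1.symm.trans (one_pow 2)
  · have h1 := (hC (i χ hχ)).1
    simp only [dif_pos hχ]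
    rw [← hJ χ hχ, ← hB χ hχ]
    exact h1
  · have h1 := (hC (i χ hχ)).2 k q
    simp only [dif_pos hχ]
    rw [← hJ χ hχ, ← hB χ hχ]
    exact h1

end Attaining

end SelfTesting

end

theorem mainTheorem7 :
    ∃ δ γ : ℝ≥0 → ℕ → ℝ≥0, (∀ n, δ 0 n = 0) ∧ (∀ n, γ 0 n = 0) ∧
      ∀ (n : ℕ), 1 ≤ n → ∀ (ε : ℝ≥0) (S : Set (Question n))
        (A : Type*) [NormedAddCommGroup A] [InnerProductSpace ℂ A] [CompleteSpace A]
        (B : Type*) [NormedAddCommGroup B] [InnerProductSpace ℂ B] [CompleteSpace B]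
        (σ : Strategy n S A B), σ.AttainsRequested ε →
        (∃ (ξ : Fin 2 → A ⊗ₕ B) (VA : Question n → A →ₗᵢ[ℂ] WithAncillas n A)
          (VB : B →ₗᵢ[ℂ] WithAncillas n B), σ.CertifiesSingle ξ VA VB (δ ε n)) ∧
        ∀ (ξ : Fin 2 → A ⊗ₕ B) (VA : Question n → A →ₗᵢ[ℂ] WithAncillas n A)
          (VB : B →ₗᵢ[ℂ] WithAncillas n B), σ.CertifiesSingle ξ VA VB (δ ε n) →
          σ.CertifiesProducts ξ VA VB (γ ε n) := by
  choose C hC using fun (n : ℕ) (hn : 1 ≤ n) => Attaining.exists_certifiesSingle (n := n) hn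
  -- The value at `n = 0` is arbitrary. The factor `√ε` in both error functions makes them vanish at
  -- `ε = 0`.
  let C' : ℕ → ℝ≥0 := fun n => if hn : 1 ≤ n then C n hn else 0
  let K : ℕ → ℝ≥0 := fun n => ⟨1 + n * (2 * Strategy.productBound n), by
    have := Strategy.productBound_nonneg n
    positivity⟩
  refine ⟨fun ε n => C' n * NNReal.sqrt ε, fun ε n => K n * (C' n * NNReal.sqrt ε), by simp,
    by simp, fun n hn ε S A _ _ _ B _ _ _ σ h => ⟨?_, fun ξ VA VB hV => ?_⟩⟩
  · have h1 := hC n hn ε S A B σ h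
    simpa [C', hn] using h1
  · exact hV.certifiesProducts hn (NNReal.coe_nonneg _)
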